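/- **Setting.** Let $n\ge 4$ and let $G$ be of type $D_n$. Realize the root system in $\mathbb R^n$ with standard basis $e_1,\dots,e_n$, simple roots $\alpha_1=e_1+e_2$ and $\alpha_i=e_i-e_{i-1}$ $(2\le i\le n)$, positive roots $R^+=\{e_j\pm e_i: 1\le i<j\le n\}$ and fundamental weights $\omega_1,\dots,\omega_n$, i.e. $\langle\omega_i,\check\alpha_j\rangle=\delta_{ij}$. The Weyl group $W$ is generated by $s_1=(1,-2)(-1,2)$ and $s_i=(i-1,i)(-(i-1),-i)$ for $2\le i\le n$. It consists of the signed permutations $v$ of $\{\pm1,\dots,\pm n\}$ with an even number of negative entries in the one-line notation $v=(v(1),\dots,v(n))$, and it acts by $v(e_k)=e_{v(k)}$, where $e_{-k}=-e_k$. For $1\le r\le n$ let $W^{I_r}=\{v\in W: v(\alpha_j)\in R^+ \text{ for all } j\ne r\}$. Write $x\ge 0$ if $x$ is a linear combination of simple roots with nonnegative real coefficients. Call $v$ *maximal* if it is a maximal element, for the Bruhat order, of $\{v\in W^{I_r}: v(\omega_r)\ge 0\}$. For integers $p\ge0$ and $s,t$ let $J_{p,[s,t]}$ be the set of sequences $\underline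 i=(i_1,\dots,i_p)$ of integers in $[s,t]$ with $i_{k+1}-i_k\ge 2$ for all $k$ (for $p=0$, only the empty sequence). Put $\underline i'=(i_1-1,\dots,i_p-1)$, $-\underline i=(-i_p,\dots,-i_1)$, and let $[\underline i]$ be the set of entries of $\underline i$. For a finite set $S$ of integers, $S\uparrow$ is the list of its elements in increasing order. For $s\in\{2,3,4\}$ put $C_s=[s,n]\setminus([\underline i]\cup[\underline i'])$, and let $(C_s\uparrow)^-$ be the list obtained from $C_s\uparrow$ by replacing its first entry $t=\min C_s$ by $-t$. **Proposition 5.1.** The maximal elements $v$ are the following. (i) Let $r=1$. There is exactly one maximal $v$: - $n\equiv0\ (4)$: $v=(-(n-1),-(n-3),\dots,-3,-1,2,4,\dots,n-2,n)$ and $v(4\omega_1)=2\alpha_2+2\sum_{i=2}^{n/2}\alpha_{2i}$; - $n\equiv2\ (4)$: $v=(-(n-1),-(n-3),\dots,-3,1,2,4,\dots,n-2,n)$ and $v(4\omega_1)=2\alpha_1+2\sum_{i=2}^{n/2}\alpha_{2i}$; - $n\equiv1\ (4)$: $v=(-(n-1),-(n-3),\dots,-4,-1,2,3,5,\dots,n-2,n)$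 and $v(4\omega_1)=\alpha_1+3\alpha_2+2\alpha_3+2\sum_{i=2}^{(n-1)/2}\alpha_{2i+1}$; - $n\equiv3\ (4)$: $v=(-(n-1),-(n-3),\dots,-4,1,2,3,5,\dots,n-2,n)$ and $v(4\omega_1)=3\alpha_1+\alpha_2+2\alpha_3+2\sum_{i=2}^{(n-1)/2}\alpha_{2i+1}$. (ii) Let $r=2$. There is exactly one maximal $v$ (the block from $-(n-3)$ to $-3$, resp. to $-4$, is empty for $n=4$, resp. $n=5$): - $n\equiv0\ (4)$: $v=(n-1,-(n-3),\dots,-3,1,2,4,\dots,n-2,n)$ and $v(4\omega_2)=2\alpha_1+2\sum_{i=2}^{n/2}\alpha_{2i}$; - $n\equiv2\ (4)$: $v=(n-1,-(n-3),\dots,-3,-1,2,4,\dots,n-2,n)$ and $v(4\omega_2)=2\alpha_2+2\sum_{i=2}^{n/2}\alpha_{2i}$; - $n\equiv1\ (4)$: $v=(n-1,-(n-3),\dots,-4,1,2,3,5,\dots,n-2,n)$ and $v(4\omega_2)=3\alpha_1+\alpha_2+2\alpha_3+2\sum_{i=2}^{(n-1)/2}\alpha_{2i+1}$; - $n\equiv3\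 (4)$: $v=(n-1,-(n-3),\dots,-4,-1,2,3,5,\dots,n-2,n)$ and $v(4\omega_2)=\alpha_1+3\alpha_2+2\alpha_3+2\sum_{i=2}^{(n-1)/2}\alpha_{2i+1}$. (iii) Let $3\le r\le n-1$ and $n+1-r=2m$. Let $Z$ be the set of the sequences $(1,3,i_1,\dots,i_{m-2})$ with $(i_1,\dots,i_{m-2})\in J_{m-2,[5,n]}$ (empty if $m=1$). For every $\underline i\in J_{m,[1,n]}\setminus Z$ there is a unique $v\in W^{I_r}$ with $v(\omega_r)=\sum_{k=1}^m\alpha_{i_k}$, and it is maximal. Explicitly, each of the following is the unique element of $W^{I_r}$ of the given weight, and is maximal: - (a) for $\underline i\in J_{m,[3,n]}$: $v_{\underline i}(\omega_r)=\sum_{k=1}^m\alpha_{i_k}$, with $v_{\underline i}=(\varepsilon,\,C_2\uparrow,\,-\underline i',\,\underline i)$, where $\varepsilon=-1$ if $m$ is odd and $\varepsilon=1$ if $m$ is even; - (b) for $\underline i\in J_{m-1,[4,n]}$: $v_{1,\underline i}(\omega_r)=\alpha_1+\sum_{k=1}^{m-1}\alpha_{i_k}$, with $v_{1,\underline i}=(C_3\uparrow,-\underline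 i',1,2,\underline i)$ if $m$ is odd and $((C_3\uparrow)^-,-\underline i',1,2,\underline i)$ if $m$ is even; - (c) for $\underline i\in J_{m-1,[4,n]}$: $v_{2,\underline i}(\omega_r)=\alpha_2+\sum_{k=1}^{m-1}\alpha_{i_k}$, with $v_{2,\underline i}=((C_3\uparrow)^-,-\underline i',-1,2,\underline i)$ if $m$ is odd and $(C_3\uparrow,-\underline i',-1,2,\underline i)$ if $m$ is even. Every maximal $v$ is one of the elements in (a), (b), (c). (iv) Let $3\le r\le n-1$ and $n+1-r=2m+1$. Each of the following is the unique element of $W^{I_r}$ of the given weight, and is maximal: - (a) for $\underline i\in J_{m,[4,n]}$: $v_{\underline i}(\omega_r)=\frac12\alpha_1+\frac12\alpha_2+\sum_{k=1}^m\alpha_{i_k}$, with $v_{\underline i}=(\varepsilon,\,C_3\uparrow,\,-\underline i',\,2,\,\underline i)$, where $\varepsilon=-1$ if $m$ is odd and $\varepsilon=1$ if $m$ is even; - (b) for $\underline i\in J_{m-1,[5,n]}$: $v_{\underline i,1}(\omega_r)=\frac32\alpha_1+\frac12\alpha_2+\alpha_3+\sum_{k=1}^{m-1}\alpha_{i_k}$,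 with $v_{\underline i,1}=(C_4\uparrow,-\underline i',1,2,3,\underline i)$ if $m$ is odd and $((C_4\uparrow)^-,-\underline i',1,2,3,\underline i)$ if $m$ is even; - (c) for $\underline i\in J_{m-1,[5,n]}$: $v_{\underline i,2}(\omega_r)=\frac12\alpha_1+\frac32\alpha_2+\alpha_3+\sum_{k=1}^{m-1}\alpha_{i_k}$, with $v_{\underline i,2}=((C_4\uparrow)^-,-\underline i',-1,2,3,\underline i)$ if $m$ is odd and $(C_4\uparrow,-\underline i',-1,2,3,\underline i)$ if $m$ is even. Every maximal $v$ is one of the elements in (a), (b), (c). (v) Let $r=n$. There is exactly one maximal $v$, namely $v=(1,3,4,\dots,n-1,n,2)$, and $v(\omega_n)=\frac12\alpha_1+\frac12\alpha_2$. -/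

import Mathlib

/-! The Weyl group, the root system and the fundamental weights of type `D_n`, in the standard
coordinates: `E = ℝⁿ` with standard basis `e_1, …, e_n`, simple roots `α_1 = e_1 + e_2` and
`α_i = e_i - e_{i-1}` for `2 ≤ i ≤ n`, and the Weyl group acting by signed permutations. -/

namespace TypeD

open Equiv

/-- `vec n k` is `e_k` for `1 ≤ k ≤ n`, is `-e_{-k}` for `-n ≤ k ≤ -1`, and is `0` otherwise. -/
noncomputable def vec (n : ℕ) (k : ℤ) : Fin n → ℝ :=
  fun j => if k = (j : ℤ) + 1 then 1 else if k = -((j : ℤ) + 1) then -1 else 0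

/-- The simple root `α_i`, `1 ≤ i ≤ n`. -/
noncomputable def simpleRoot (n : ℕ) (i : ℤ) : Fin n → ℝ :=
  if i = 1 then vec n 1 + vec n 2 else vec n i - vec n (i - 1)

/-- The set `R⁺` of positive roots, `e_j - e_i` and `e_j + e_i` for `1 ≤ i < j ≤ n`. -/
def posRoots (n : ℕ) : Set (Fin n → ℝ) :=
  {x | ∃ i j : ℤ, 1 ≤ i ∧ i < j ∧ j ≤ n ∧ (x = vec n j - vec n i ∨ x = vec n j + vec n i)}

/-- The fundamental weight `ω_r`, `1 ≤ r ≤ n`: `ω_1 = (e_1 + e_2 + ⋯ + e_n) / 2`,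
`ω_2 = (-e_1 + e_2 + ⋯ + e_n) / 2` and `ω_r = e_r + ⋯ + e_n` for `r ≥ 3`. The lemma
`fundWeight_pairing` below shows that this is the basis dual to the simple coroots. -/
noncomputable def fundWeight (n : ℕ) (r : ℤ) : Fin n → ℝ :=
  fun j =>
    if r = 1 then 1 / 2
    else if r = 2 then (if (j : ℕ) = 0 then -1 / 2 else 1 / 2)
    else if r ≤ (j : ℤ) + 1 then 1 else 0

/-- The pairing `⟨x, α̌⟩ = 2 (x, α) / (α, α)` with the coroot of `α`. -/
noncomputable def corootPairing {n : ℕ} (x a : Fin n → ℝ) : ℝ :=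
  2 * (x ⬝ᵥ a) / (a ⬝ᵥ a)

theorem dotProduct_vec {n : ℕ} (x : Fin n → ℝ) (k : Fin n) :
    x ⬝ᵥ vec n ((k : ℤ) + 1) = x k := by
  have h : ∀ j : Fin n, vec n ((k : ℤ) + 1) j = if j = k then 1 else 0 := by
    intro j
    unfold vec
    by_cases hjk : j = k
    · simp [hjk]
    · have : (j : ℤ) ≠ k := by
        intro h; apply hjk; ext; exact_mod_cast h
      rw [if_neg (by omega), if_neg (by omega), if_neg hjk]
  simp [dotProduct, h]

/-- `⟨ω_i, α̌_j⟩ = δ_{ij}`. -/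
theorem fundWeight_pairing {n : ℕ} (hn : 2 ≤ n) {i j : ℤ} (hi : 1 ≤ i)
    (hj : 1 ≤ j) (hjn : j ≤ n) :
    corootPairing (fundWeight n i) (simpleRoot n j) = if i = j then 1 else 0 := by
  have key : ∀ (x : Fin n → ℝ) (k : ℤ) (h1 : 1 ≤ k) (h2 : k ≤ n),
      x ⬝ᵥ vec n k = x ⟨(k - 1).toNat, by omega⟩ := by
    intro x k h1 h2
    rw [← dotProduct_vec x ⟨(k - 1).toNat, by omega⟩]
    congr 2
    simp; omega
  have key2 : ∀ (k l : ℤ) (h1 : 1 ≤ k) (h2 : k ≤ n) (h3 : 1 ≤ l),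
      vec n l ⟨(k - 1).toNat, by omega⟩ = if k = l then 1 else 0 := by
    intro k l h1 h2 h3
    unfold vec
    grind
  unfold corootPairing simpleRoot
  by_cases h1 : j = 1
  · subst h1
    rw [if_pos rfl, dotProduct_add, dotProduct_add]
    rw [key _ 1 (by omega) (by omega), key _ 2 (by omega) (by omega),
      key _ 1 (by omega) (by omega), key _ 2 (by omega) (by omega)]
    simp only [Pi.add_apply]
    rw [key2 1 1 (by omega) (by omega) (by omega), key2 1 2 (by omega) (by omega) (by omega),
      key2 2 1 (by omega) (by omega) (by omega), key2 2 2 (by omega) (by omega) (by omega)]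
    simp only [fundWeight]
    norm_num
    grind
  · rw [if_neg h1, dotProduct_sub, dotProduct_sub]
    rw [key _ j (by omega) (by omega), key _ (j - 1) (by omega) (by omega),
      key _ j (by omega) (by omega), key _ (j - 1) (by omega) (by omega)]
    simp only [Pi.sub_apply]
    rw [key2 j j (by omega) (by omega) (by omega),
      key2 j (j - 1) (by omega) (by omega) (by omega),
      key2 (j - 1) j (by omega) (by omega) (by omega),
      key2 (j - 1) (j - 1) (by omega) (by omega) (by omega)]
    rw [if_pos rfl, if_pos rfl, if_neg (by omega), if_neg (by omega)]
    simp only [fundWeight]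
    grind

/-- `x ≥ 0` for `x ∈ E`: `x` is a combination of the simple roots with coefficients `≥ 0`. -/
def NonnegWeight (n : ℕ) (x : Fin n → ℝ) : Prop :=
  ∃ c : ℤ → ℝ, (∀ i, 0 ≤ c i) ∧ x = ∑ i ∈ Finset.Icc (1 : ℤ) n, c i • simpleRoot n i

/-- The simple reflection `s_i`, `1 ≤ i ≤ n`, as a permutation of the integers (it moves only
elements of `[-n, n] \ {0}`): `s_1 = (1, -2)(-1, 2)`, and `s_i = (i - 1, i)(-(i - 1), -i)`
for `2 ≤ i ≤ n`. -/
def simpleRefl (i : ℤ) : Perm ℤ :=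
  if i = 1 then swap 1 (-2) * swap (-1) 2 else swap (i - 1) i * swap (-(i - 1)) (-i)

/-- The Weyl group `W` of type `D_n`, generated by `s_1, …, s_n`. Its elements are the
permutations `w` of `ℤ` with `w (-k) = -w k`, fixing every `k` with `|k| > n`, such that the
number of negative integers among `w 1, …, w n` is even. -/
def weylGroup (n : ℕ) : Subgroup (Perm ℤ) :=
  Subgroup.closure (simpleRefl '' Set.Icc 1 (n : ℤ))

/-- The action of `W` on `E`: the linear map with `e_k ↦ e_{w k}`, where `e_{-k} = -e_k`. -/
noncomputable def act (n : ℕ) (w : Perm ℤ) (x : Fin n → ℝ) : Fin n → ℝ :=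
  ∑ k : Fin n, x k • vec n (w ((k : ℤ) + 1))

/-- The length of `w ∈ W`: the least number of factors in an expression of `w` as a product of
simple reflections. -/
noncomputable def length (n : ℕ) (w : Perm ℤ) : ℕ :=
  sInf {k | ∃ l : List ℤ, l.length = k ∧ (∀ i ∈ l, 1 ≤ i ∧ i ≤ n) ∧
    (l.map simpleRefl).prod = w}

/-- The reflections in `W`: the conjugates of the simple reflections. -/
def IsReflection (n : ℕ) (t : Perm ℤ) : Prop :=
  ∃ w ∈ weylGroup n, ∃ i : ℤ, 1 ≤ i ∧ i ≤ n ∧ t = w * simpleRefl i * w⁻¹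

/-- The Bruhat order on `W`: the reflexive and transitive closure of the relation `u < t u`
for a reflection `t` with `ℓ(u) < ℓ(t u)`. -/
def BruhatLE (n : ℕ) : Perm ℤ → Perm ℤ → Prop :=
  Relation.ReflTransGen fun u w =>
    u ∈ weylGroup n ∧ ∃ t, IsReflection n t ∧ w = t * u ∧ length n u < length n w

/-- `W^{I_r}` for `I_r = {α_r}`: the `w ∈ W` with `w(α_j) ∈ R⁺` for every `j ≠ r`. -/
def minReps (n : ℕ) (r : ℤ) : Set (Perm ℤ) :=
  {w | w ∈ weylGroup n ∧
    ∀ j : ℤ, 1 ≤ j → j ≤ n → j ≠ r → act n w (simpleRoot n j) ∈ posRoots n}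

/-- The maximal elements, in the Bruhat order, of `{v ∈ W^{I_r} : v(ω_r) ≥ 0}`. -/
def maximalSet (n : ℕ) (r : ℤ) : Set (Perm ℤ) :=
  {v | v ∈ minReps n r ∧ NonnegWeight n (act n v (fundWeight n r)) ∧
    ∀ u ∈ minReps n r, NonnegWeight n (act n u (fundWeight n r)) → BruhatLE n v u → u = v}

/-- `v` is the unique element of `W^{I_r}` with `v(ω_r) = x`. -/
def IsUniqueOfWeight (n : ℕ) (r : ℤ) (x : Fin n → ℝ) (v : Perm ℤ) : Prop :=
  v ∈ minReps n r ∧ act n v (fundWeight n r) = x ∧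
    ∀ u ∈ minReps n r, act n u (fundWeight n r) = x → u = v

/-- The one-line notation `(v 1, v 2, …, v n)`. -/
def oneLine (n : ℕ) (v : Perm ℤ) : List ℤ :=
  (List.range n).map fun k => v ((k : ℤ) + 1)

/-- `J_{p,[s,t]}`: the sequences `(i_1, …, i_p)` in `[s, t]` with `i_{k+1} - i_k ≥ 2`. -/
def J (p : ℕ) (s t : ℤ) : Set (List ℤ) :=
  {i | i.length = p ∧ (∀ x ∈ i, s ≤ x ∧ x ≤ t) ∧ i.IsChain fun a b => b - a ≥ 2}

/-- The sequences `(1, 3, i_1, …, i_{m-2})` with `i_k ∈ {5, …, n}` and `i_{k+1} - i_k ≥ 2`. -/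
def Z (m : ℕ) (n : ℤ) : Set (List ℤ) :=
  {l | ∃ i : List ℤ, i.length + 2 = m ∧ i ∈ J i.length 5 n ∧ l = 1 :: 3 :: i}

/-- `α_{i_1} + ⋯ + α_{i_p}` for `i = (i_1, …, i_p)`. -/
noncomputable def rootSum (n : ℕ) (i : List ℤ) : Fin n → ℝ :=
  (i.map (simpleRoot n)).sum

/-- `i' = (i_1 - 1, …, i_p - 1)`. -/
def primed (i : List ℤ) : List ℤ := i.map fun x => x - 1

/-- `-i = (-i_p, …, -i_1)`. -/
def negRev (i : List ℤ) : List ℤ := (i.map fun x => -x).reverse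

/-- `[s, n] \ {[i], [i']}`. -/
noncomputable def gaps (s : ℤ) (n : ℕ) (i : List ℤ) : Finset ℤ :=
  Finset.Icc s (n : ℤ) \ (i.toFinset ∪ (primed i).toFinset)

/-- `S↑`: the elements of `S` in increasing order. -/
def up (S : Finset ℤ) : List ℤ := S.sort (· ≤ ·)

/-- The least element of `S` (with the value `0` if `S` is empty). -/
def least (S : Finset ℤ) : ℤ := S.min.untopD 0

/-- The arithmetic progression `a, a + 2, a + 4, …` with `k` terms. -/
def steps (a : ℤ) (k : ℕ) : List ℤ := (List.range k).map fun j => a + 2 * (j : ℤ)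

/-- `S↑` with its first entry `t = min S` replaced by `-t`. -/
def upNeg (S : Finset ℤ) : List ℤ := -least S :: up (S.erase (least S))

end TypeD

open TypeD

namespace TypeD

open Equiv

variable {n : ℕ}

/-! The proof replaces each element of `W^{I_r}` by its weight `v(ω_r)`, which determines it
(`minReps_unique`). A Bruhat step upwards subtracts from the weight a nonnegative multiple of a
positive root (`bruhat_step`). Hence maximality lies between two conditions on a nonnegative weight
`x`. It suffices that no reflection lowers `x` to another nonnegative vector (`LocMax`,
`mem_maximalSet_of_locMax`). It is necessary that no simple reflection does (`SimpleMax`,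
`simpleMax_of_mem_maximalSet`). The core of the argument is that, for the vectors that occur, both
conditions describe the same explicit list `IsStd`.

The vectors that occur are `v(ω_r)` for `r ≥ 3` and `v(2ω_r)` for `r = 1, 2`; all their coordinates
lie in `{-1, 0, 1}`. Pairing with the fundamental weights turns `x ≥ 0` into inequalities: the
suffix sums `S_k` are nonnegative for `k ≥ 3`, and `S_2 ± x_1 ≥ 0`. Reading the conditions for the
simple roots from the last coordinate downwards (`scan`) shows that beyond some position `t` there
are only zeros and adjacent pairs `(-1, 1)`, that is, a sum of simple roots with gaps at least 2,
while positions `2, …, t` carry ones. The two end nodes `α_1`, `α_2` then force `t ≤ 3` and restrict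
`x_1` (`exists_isStd`). Conversely, for such a vector one of the same inequalities excludes every
reflection (`stdCoord_no_move`, `IsStd.locMax`).

It remains to see which of these vectors are weights, and of which elements. Every ternary vector is
conjugate to a dominant one. For `r ≥ 3` the squared norm `n + 1 - r` identifies it with `ω_r`, and
the parity of the norm separates the families of the even and the odd case. For `r = 1, 2` the norm
`n` forbids zeros, so the pairs are packed without room, and the evenness of the number of sign
changes fixes the remaining sign. The same parity, with the inequalities defining `W^{I_r}`, gives
the one-line notation (`oneLine_of_three_le`, `IsStd.oneLine_spin`). -/

/-- The coordinate of `x` along `e_k`, extended to an odd function of `k ∈ ℤ`. -/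
noncomputable def coord (x : Fin n → ℝ) (k : ℤ) : ℝ := x ⬝ᵥ vec n k

/-! ### Coordinates as odd functions of a signed index -/

theorem vec_neg (k : ℤ) : vec n (-k) = -vec n k := by
  funext j
  simp only [vec, Pi.neg_apply]
  grind

theorem vec_eq_zero {k : ℤ} (h : ¬ (k ≠ 0 ∧ -n ≤ k ∧ k ≤ n)) : vec n k = 0 := by
  funext j
  have := j.2
  simp only [vec, Pi.zero_apply]
  grind

theorem coord_neg_right (x : Fin n → ℝ) (k : ℤ) : coord x (-k) = -coord x k := by
  simp [coord, vec_neg]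

theorem coord_add (x y : Fin n → ℝ) (k : ℤ) : coord (x + y) k = coord x k + coord y k := by
  simp [coord]

theorem coord_sub (x y : Fin n → ℝ) (k : ℤ) : coord (x - y) k = coord x k - coord y k := by
  simp [coord]

theorem coord_smul (c : ℝ) (x : Fin n → ℝ) (k : ℤ) : coord (c • x) k = c * coord x k := by
  simp [coord]

theorem coord_sum {ι : Type*} (s : Finset ι) (f : ι → Fin n → ℝ) (k : ℤ) :
    coord (∑ i ∈ s, f i) k = ∑ i ∈ s, coord (f i) k := by
  simp [coord, sum_dotProduct]

theorem coord_fin (x : Fin n → ℝ) (j : Fin n) : coord x ((j : ℤ) + 1) = x j :=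
  dotProduct_vec x j

theorem coord_apply (x : Fin n → ℝ) {k : ℤ} (h1 : 1 ≤ k) (h2 : k ≤ n) :
    coord x k = x ⟨(k - 1).toNat, by omega⟩ := by
  rw [← coord_fin x]
  congr 1
  simp; omega

theorem coord_eq_zero (x : Fin n → ℝ) {k : ℤ} (h : ¬ (k ≠ 0 ∧ -n ≤ k ∧ k ≤ n)) :
    coord x k = 0 := by
  simp [coord, vec_eq_zero h]

theorem coord_ext {x y : Fin n → ℝ} (h : ∀ k : ℤ, 1 ≤ k → k ≤ n → coord x k = coord y k) :
    x = y := by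
  funext j
  rw [← coord_fin x, ← coord_fin y]
  exact h _ (by omega) (by omega)

theorem coord_vec (k : ℤ) {l : ℤ} (h : l ≠ 0 ∧ -n ≤ l ∧ l ≤ n) :
    coord (vec n k) l = if k = l then 1 else if k = -l then -1 else 0 := by
  have key : ∀ l : ℤ, 1 ≤ l → l ≤ n →
      coord (vec n k) l = if k = l then 1 else if k = -l then -1 else 0 := by
    intro l h1 h2
    rw [coord_apply _ h1 h2]
    simp only [vec]
    grind
  rcases lt_or_gt_of_ne h.1 with h0 | h0
  · have := key (-l) (by omega) (by omega)
    rw [coord_neg_right] at this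
    grind
  · exact key l (by omega) h.2.2

theorem sum_fin_eq_sum_Icc (f : ℤ → ℝ) :
    ∑ j : Fin n, f ((j : ℤ) + 1) = ∑ k ∈ Finset.Icc (1 : ℤ) n, f k := by
  refine Finset.sum_bij (fun j _ => (j : ℤ) + 1) ?_ ?_ ?_ ?_
  · intro j _; simp
  · intro a _ b _ h; ext; simpa using h
  · intro k hk
    rw [Finset.mem_Icc] at hk
    exact ⟨⟨(k - 1).toNat, by omega⟩, Finset.mem_univ _, by simp; omega⟩
  · intro j _; rfl

theorem dot_eq_sum (x y : Fin n → ℝ) :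
    x ⬝ᵥ y = ∑ k ∈ Finset.Icc (1 : ℤ) n, coord x k * coord y k := by
  rw [← sum_fin_eq_sum_Icc fun k => coord x k * coord y k]
  simp [coord_fin, dotProduct]

/-! ### The Weyl group as signed permutations, and its action -/

theorem simpleRefl_neg {i : ℤ} (hi : 1 ≤ i) (k : ℤ) : simpleRefl i (-k) = -simpleRefl i k := by
  unfold simpleRefl
  split_ifs <;> simp only [Perm.mul_apply, swap_apply_def] <;> grind

theorem simpleRefl_mul_self {i : ℤ} (hi : 1 ≤ i) : simpleRefl i * simpleRefl i = 1 := by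
  ext k
  unfold simpleRefl
  split_ifs <;> simp only [Perm.mul_apply, Perm.one_apply, swap_apply_def] <;> grind

theorem simpleRefl_inv {i : ℤ} (hi : 1 ≤ i) : (simpleRefl i)⁻¹ = simpleRefl i :=
  inv_eq_of_mul_eq_one_left (simpleRefl_mul_self hi)

theorem simpleRefl_mem {i : ℤ} (h1 : 1 ≤ i) (h2 : i ≤ n) : simpleRefl i ∈ weylGroup n :=
  Subgroup.subset_closure ⟨i, ⟨h1, h2⟩, rfl⟩

theorem weyl_induction (p : Perm ℤ → Prop) (one : p 1)
    (mul : ∀ (i : ℤ) (w : Perm ℤ), 1 ≤ i → i ≤ n → w ∈ weylGroup n → p w → p (simpleRefl i * w))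
    {w : Perm ℤ} (hw : w ∈ weylGroup n) : p w := by
  unfold weylGroup at hw
  induction hw using Subgroup.closure_induction_left with
  | one => exact one
  | mul_left x hx y hy ih =>
    obtain ⟨i, hi, rfl⟩ := hx
    exact mul i y hi.1 hi.2 hy ih
  | inv_mul_cancel x hx y hy ih =>
    obtain ⟨i, hi, rfl⟩ := hx
    rw [simpleRefl_inv hi.1]
    exact mul i y hi.1 hi.2 hy ih

theorem weyl_neg {w : Perm ℤ} (hw : w ∈ weylGroup n) : ∀ k, w (-k) = -w k := by
  refine weyl_induction (fun w => ∀ k, w (-k) = -w k) (by simp) ?_ hw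
  intro i w h1 _ _ ih k
  rw [Perm.mul_apply, Perm.mul_apply, ih, simpleRefl_neg h1]

theorem weyl_zero {w : Perm ℤ} (hw : w ∈ weylGroup n) : w 0 = 0 := by
  have := weyl_neg hw 0
  simp at this; omega

theorem weyl_fix (hn : 2 ≤ n) {w : Perm ℤ} (hw : w ∈ weylGroup n) :
    ∀ k : ℤ, ¬ (-n ≤ k ∧ k ≤ n) → w k = k := by
  refine weyl_induction (fun w => ∀ k : ℤ, ¬ (-n ≤ k ∧ k ≤ n) → w k = k) (by simp) ?_ hw
  intro i w h1 h2 _ ih k hk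
  rw [Perm.mul_apply, ih k hk]
  unfold simpleRefl
  split_ifs <;> simp only [Perm.mul_apply, swap_apply_def] <;> grind

/-- The index set `{±1, …, ±n}`. -/
def Idx (n : ℕ) (k : ℤ) : Prop := k ≠ 0 ∧ -n ≤ k ∧ k ≤ n

theorem weyl_idx (hn : 2 ≤ n) {w : Perm ℤ} (hw : w ∈ weylGroup n) {k : ℤ} (hk : Idx n k) :
    Idx n (w k) := by
  have h0 : w k ≠ 0 := by
    rw [← weyl_zero hw]
    exact fun h => hk.1 (w.injective h)
  by_contra hc
  have := weyl_fix hn hw (w k) (fun h => hc ⟨h0, h.1, h.2⟩)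
  rw [w.injective this] at hc
  exact hc hk

theorem weyl_idx_iff (hn : 2 ≤ n) {w : Perm ℤ} (hw : w ∈ weylGroup n) {k : ℤ} :
    Idx n (w k) ↔ Idx n k :=
  ⟨fun h => by simpa using weyl_idx hn (inv_mem hw) h, weyl_idx hn hw⟩

theorem coord_vec_weyl (hn : 2 ≤ n) {w : Perm ℤ} (hw : w ∈ weylGroup n) (k l : ℤ) :
    coord (vec n (w k)) l = coord (vec n k) (w⁻¹ l) := by
  by_cases hl : Idx n l
  · have hl' : Idx n (w⁻¹ l) := weyl_idx hn (inv_mem hw) hl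
    rw [coord_vec _ hl, coord_vec _ hl']
    have h1 : w k = l ↔ k = w⁻¹ l := by rw [Perm.eq_inv_iff_eq]
    have h2 : w k = -l ↔ k = -w⁻¹ l := by
      rw [← weyl_neg (inv_mem hw), Perm.eq_inv_iff_eq]
    simp only [h1, h2]
  · have hl' : ¬ Idx n (w⁻¹ l) := by rwa [weyl_idx_iff hn (inv_mem hw)]
    rw [coord_eq_zero _ hl, coord_eq_zero _ hl']

theorem act_smul (w : Perm ℤ) (c : ℝ) (x : Fin n → ℝ) : act n w (c • x) = c • act n w x := by
  simp [act, Finset.smul_sum, smul_smul]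

theorem act_add (w : Perm ℤ) (x y : Fin n → ℝ) : act n w (x + y) = act n w x + act n w y := by
  simp [act, add_smul, Finset.sum_add_distrib]

theorem act_neg (w : Perm ℤ) (x : Fin n → ℝ) : act n w (-x) = -act n w x := by
  simpa using act_smul w (-1) x

theorem act_sub (w : Perm ℤ) (x y : Fin n → ℝ) : act n w (x - y) = act n w x - act n w y := by
  rw [sub_eq_add_neg, act_add, act_neg, ← sub_eq_add_neg]

theorem act_sum {ι : Type*} (w : Perm ℤ) (s : Finset ι) (f : ι → Fin n → ℝ) :
    act n w (∑ i ∈ s, f i) = ∑ i ∈ s, act n w (f i) := by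
  simp only [act, Finset.sum_apply, Finset.sum_smul]
  exact Finset.sum_comm

/-- With coordinates extended to an odd function, `W` acts by precomposition with the inverse. This
reduces the multiplicativity of the action, its orthogonality and the reflection formula to facts
about indices. -/
theorem coord_act (hn : 2 ≤ n) {w : Perm ℤ} (hw : w ∈ weylGroup n) (x : Fin n → ℝ) (k : ℤ) :
    coord (act n w x) k = coord x (w⁻¹ k) := by
  unfold act
  simp only [coord_sum, coord_smul, coord_vec_weyl hn hw]
  by_cases hl : Idx n (w⁻¹ k)
  · generalize w⁻¹ k = l at hl
    have key : ∀ l : ℤ, 1 ≤ l → l ≤ n →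
        ∑ j : Fin n, x j * coord (vec n ((j : ℤ) + 1)) l = coord x l := by
      intro l h1 h2
      rw [coord_apply x h1 h2, Finset.sum_eq_single (⟨(l - 1).toNat, by omega⟩ : Fin n)]
      · rw [coord_vec _ ⟨by omega, by omega, h2⟩, if_pos (by simp; omega), mul_one]
      · intro b _ hb
        have : ((b : ℕ) : ℤ) + 1 ≠ l := by
          intro h; apply hb; ext; simp; omega
        rw [coord_vec _ ⟨by omega, by omega, h2⟩, if_neg this, if_neg (by omega), mul_zero]
      · simp
    rcases lt_or_gt_of_ne hl.1 with h0 | h0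
    · have := key (-l) (by omega) (by have := hl.2.1; omega)
      simp only [coord_neg_right, mul_neg, Finset.sum_neg_distrib] at this
      linarith
    · exact key l (by omega) hl.2.2
  · rw [coord_eq_zero x hl]
    exact Finset.sum_eq_zero fun j _ => by rw [coord_eq_zero _ hl, mul_zero]

theorem act_mul (hn : 2 ≤ n) {u w : Perm ℤ} (hu : u ∈ weylGroup n) (hw : w ∈ weylGroup n)
    (x : Fin n → ℝ) : act n (u * w) x = act n u (act n w x) := by
  refine coord_ext fun k _ _ => ?_
  rw [coord_act hn (mul_mem hu hw), coord_act hn hu, coord_act hn hw, mul_inv_rev, Perm.mul_apply]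

theorem act_one (hn : 2 ≤ n) (x : Fin n → ℝ) : act n 1 x = x := by
  refine coord_ext fun k _ _ => ?_
  rw [coord_act hn (one_mem _)]; simp

theorem act_inv_act (hn : 2 ≤ n) {w : Perm ℤ} (hw : w ∈ weylGroup n) (x : Fin n → ℝ) :
    act n w⁻¹ (act n w x) = x := by
  rw [← act_mul hn (inv_mem hw) hw, inv_mul_cancel, act_one hn]

theorem act_vec (hn : 2 ≤ n) {w : Perm ℤ} (hw : w ∈ weylGroup n) (k : ℤ) :
    act n w (vec n k) = vec n (w k) :=
  coord_ext fun l _ _ => by rw [coord_act hn hw, coord_vec_weyl hn hw]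

theorem act_dot (hn : 2 ≤ n) {w : Perm ℤ} (hw : w ∈ weylGroup n) (x y : Fin n → ℝ) :
    act n w x ⬝ᵥ y = x ⬝ᵥ act n w⁻¹ y := by
  have : act n w x ⬝ᵥ y = ∑ j : Fin n, x j * coord y (w ((j : ℤ) + 1)) := by
    simp only [act, sum_dotProduct, smul_dotProduct, smul_eq_mul]
    exact Finset.sum_congr rfl fun j _ => by rw [coord, dotProduct_comm y]
  rw [this, dotProduct]
  refine Finset.sum_congr rfl fun j _ => ?_
  rw [← coord_fin (act n w⁻¹ y), coord_act hn (inv_mem hw), inv_inv]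

theorem act_dot_act (hn : 2 ≤ n) {w : Perm ℤ} (hw : w ∈ weylGroup n) (x y : Fin n → ℝ) :
    act n w x ⬝ᵥ act n w y = x ⬝ᵥ y := by
  rw [act_dot hn hw, act_inv_act hn hw]

/-! ### Roots as pairs of signed indices, and their reflections -/

/-- The root `e_b - e_a`. -/
noncomputable def root (n : ℕ) (a b : ℤ) : Fin n → ℝ := vec n b - vec n a

/-- `e_b - e_a` is a root. -/
def IsPair (n : ℕ) (a b : ℤ) : Prop := Idx n a ∧ Idx n b ∧ a ≠ b ∧ a ≠ -b

theorem act_root (hn : 2 ≤ n) {w : Perm ℤ} (hw : w ∈ weylGroup n) (a b : ℤ) :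
    act n w (root n a b) = root n (w a) (w b) := by
  simp only [root, act_sub, act_vec hn hw]

theorem IsPair.weyl (hn : 2 ≤ n) {w : Perm ℤ} (hw : w ∈ weylGroup n) {a b : ℤ}
    (h : IsPair n a b) : IsPair n (w a) (w b) := by
  refine ⟨weyl_idx hn hw h.1, weyl_idx hn hw h.2.1, fun e => h.2.2.1 (w.injective e), ?_⟩
  rw [← weyl_neg hw]
  exact fun e => h.2.2.2 (w.injective e)

theorem IsPair.swap {a b : ℤ} (h : IsPair n a b) : IsPair n b a :=
  ⟨h.2.1, h.1, h.2.2.1.symm, fun e => h.2.2.2 (by omega)⟩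

theorem root_swap (a b : ℤ) : root n b a = -root n a b := by simp [root]

theorem root_neg_neg (a b : ℤ) : root n (-b) (-a) = root n a b := by
  simp only [root, vec_neg]; abel

/-- Allowing signed indices merges the two kinds `e_j - e_i` and `e_j + e_i` of positive roots:
positivity becomes the single inequality `a < b`. -/
theorem mem_posRoots_iff {x : Fin n → ℝ} :
    x ∈ posRoots n ↔ ∃ a b, IsPair n a b ∧ a < b ∧ x = root n a b := by
  constructor
  · rintro ⟨i, j, h1, h2, h3, rfl | rfl⟩
    · exact ⟨i, j, ⟨⟨by omega, by omega, by omega⟩, ⟨by omega, by omega, by omega⟩, by omega,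
        by omega⟩, h2, rfl⟩
    · exact ⟨-i, j, ⟨⟨by omega, by omega, by omega⟩, ⟨by omega, by omega, by omega⟩, by omega,
        by omega⟩, by omega, by rw [root, vec_neg]; abel⟩
  · rintro ⟨a, b, ⟨⟨a0, a1, a2⟩, ⟨b0, b1, b2⟩, h1, h2⟩, h, rfl⟩
    rcases lt_or_gt_of_ne a0 with ha | ha
    · rcases lt_or_gt_of_ne b0 with hb | hb
      · exact ⟨-b, -a, by omega, by omega, by omega, Or.inl (root_neg_neg _ _).symm⟩
      · rcases lt_or_gt_of_ne h2 with hc | hc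
        · exact ⟨b, -a, by omega, by omega, by omega, Or.inr (by rw [root, vec_neg]; abel)⟩
        · exact ⟨-a, b, by omega, by omega, by omega, Or.inr (by rw [root, vec_neg]; abel)⟩
    · exact ⟨a, b, by omega, by omega, by omega, Or.inl rfl⟩

/-- The reflection in the root `e_b - e_a`. -/
def pairRefl (a b : ℤ) : Perm ℤ := swap a b * swap (-a) (-b)

/-- The index `a` in `α_i = e_b - e_a`. -/
def lo (i : ℤ) : ℤ := if i = 1 then -2 else i - 1

/-- The index `b` in `α_i = e_b - e_a`. -/
def hi (i : ℤ) : ℤ := if i = 1 then 1 else i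

theorem simpleRoot_eq (i : ℤ) : simpleRoot n i = root n (lo i) (hi i) := by
  unfold simpleRoot lo hi root
  split_ifs
  · rw [vec_neg]; abel
  · rfl

theorem simpleRefl_eq (i : ℤ) : simpleRefl i = pairRefl (lo i) (hi i) := by
  unfold simpleRefl lo hi pairRefl
  split_ifs
  · rw [swap_comm, swap_comm (-1 : ℤ)]; norm_num
  · rfl

theorem isPair_simple (hn : 2 ≤ n) {i : ℤ} (h1 : 1 ≤ i) (h2 : i ≤ n) : IsPair n (lo i) (hi i) := by
  unfold lo hi IsPair Idx
  split_ifs <;> omega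

theorem lo_lt_hi (i : ℤ) : lo i < hi i := by unfold lo hi; split_ifs <;> omega

theorem coord_root_idx {a b k : ℤ} (hk : Idx n k) : coord (root n a b) k =
    (if b = k then 1 else if b = -k then -1 else 0) -
      (if a = k then 1 else if a = -k then -1 else 0) := by
  rw [root, coord_sub, coord_vec _ hk, coord_vec _ hk]

/-- Evaluation at `a` and at `b` recovers the pair up to `(a, b) ↦ (-b, -a)`, the only redundancy in
the description. -/
theorem root_injective {a b c d : ℤ} (h : IsPair n a b) (h' : IsPair n c d)
    (e : root n a b = root n c d) : (a = c ∧ b = d) ∨ (a = -d ∧ b = -c) := by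
  have h1 := congrArg (fun x => coord x a) e
  have h2 := congrArg (fun x => coord x b) e
  simp only [coord_root_idx h.1, coord_root_idx h.2.1] at h1 h2
  unfold IsPair Idx at h h'
  grind

theorem root_mem_posRoots_iff {a b : ℤ} (h : IsPair n a b) : root n a b ∈ posRoots n ↔ a < b := by
  constructor
  · intro hp
    obtain ⟨c, d, hcd, hlt, e⟩ := mem_posRoots_iff.1 hp
    rcases root_injective h hcd e with h | h <;> omega
  · exact fun hlt => mem_posRoots_iff.2 ⟨a, b, h, hlt, rfl⟩

/-- Coordinate form of the reflection formula `x ↦ x - (x, β) β`; no denominator appears because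
every root has squared norm 2. -/
theorem coord_pairRefl {a b : ℤ} (h : IsPair n a b) (x : Fin n → ℝ) (k : ℤ) (hk : Idx n k) :
    coord x (pairRefl a b k) = coord x k - (coord x b - coord x a) * coord (root n a b) k := by
  rw [coord_root_idx hk]
  have e1 := coord_neg_right x a
  have e2 := coord_neg_right x b
  unfold IsPair Idx at h
  obtain ⟨⟨ha, -⟩, ⟨hb, -⟩, h1, h2⟩ := h
  have hk0 := hk.1
  simp only [pairRefl, Perm.mul_apply]
  by_cases k1 : k = a
  · subst k1
    rw [swap_apply_of_ne_of_ne (x := k) (by omega) (by omega), swap_apply_left, if_neg (by omega),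
      if_neg (by omega), if_pos rfl]
    ring
  by_cases k2 : k = b
  · subst k2
    rw [swap_apply_of_ne_of_ne (x := k) (by omega) (by omega), swap_apply_right, if_pos rfl,
      if_neg (by omega), if_neg (by omega)]
    ring
  by_cases k3 : k = -a
  · subst k3
    rw [swap_apply_left, swap_apply_of_ne_of_ne (by omega) (by omega), e1, e2, if_neg (by omega),
      if_neg (by omega), if_neg (by omega), if_pos (by omega)]
    ring
  by_cases k4 : k = -b
  · subst k4
    rw [swap_apply_right, swap_apply_of_ne_of_ne (by omega) (by omega), e1, e2, if_neg (by omega),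
      if_pos (by omega), if_neg (by omega), if_neg (by omega)]
    ring
  rw [swap_apply_of_ne_of_ne k3 k4, swap_apply_of_ne_of_ne k1 k2, if_neg (by omega),
    if_neg (by omega), if_neg (by omega), if_neg (by omega)]
  ring

theorem dot_root (x : Fin n → ℝ) (a b : ℤ) : x ⬝ᵥ root n a b = coord x b - coord x a := by
  simp [root, coord, dotProduct_sub]

theorem pairRefl_mul_self {a b : ℤ} (h : IsPair n a b) : pairRefl a b * pairRefl a b = 1 := by
  obtain ⟨⟨ha, -⟩, ⟨hb, -⟩, h1, h2⟩ := h
  ext k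
  simp only [pairRefl, Perm.mul_apply, Perm.one_apply, swap_apply_def]
  grind

theorem act_pairRefl (hn : 2 ≤ n) {a b : ℤ} (h : IsPair n a b) (hw : pairRefl a b ∈ weylGroup n)
    (x : Fin n → ℝ) :
    act n (pairRefl a b) x = x - (x ⬝ᵥ root n a b) • root n a b := by
  refine coord_ext fun k h1 h2 => ?_
  rw [coord_act hn hw, inv_eq_of_mul_eq_one_left (pairRefl_mul_self h),
    coord_pairRefl h x k ⟨by omega, by omega, h2⟩, coord_sub, coord_smul, dot_root]

theorem act_simpleRefl (hn : 2 ≤ n) {i : ℤ} (h1 : 1 ≤ i) (h2 : i ≤ n) (x : Fin n → ℝ) :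
    act n (simpleRefl i) x = x - (x ⬝ᵥ simpleRoot n i) • simpleRoot n i := by
  have hm := simpleRefl_mem (n := n) h1 h2
  rw [simpleRefl_eq] at *
  rw [act_pairRefl hn (isPair_simple hn h1 h2) hm, simpleRoot_eq]

theorem conj_pairRefl {w : Perm ℤ} (hw : w ∈ weylGroup n) (a b : ℤ) :
    w * pairRefl a b * w⁻¹ = pairRefl (w a) (w b) := by
  simp only [pairRefl, ← weyl_neg hw]
  rw [swap_apply_apply, swap_apply_apply]
  group

/-! ### Length and the exchange property -/

theorem exists_word {w : Perm ℤ} (hw : w ∈ weylGroup n) :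
    ∃ l : List ℤ, l.length = length n w ∧ (∀ i ∈ l, 1 ≤ i ∧ i ≤ n) ∧
      (l.map simpleRefl).prod = w := by
  have : {k | ∃ l : List ℤ, l.length = k ∧ (∀ i ∈ l, 1 ≤ i ∧ i ≤ n) ∧
      (l.map simpleRefl).prod = w}.Nonempty := by
    refine weyl_induction (fun w => {k | ∃ l : List ℤ, l.length = k ∧
      (∀ i ∈ l, 1 ≤ i ∧ i ≤ n) ∧ (l.map simpleRefl).prod = w}.Nonempty)
      ⟨0, [], rfl, by simp, by simp⟩ ?_ hw
    rintro i w h1 h2 - ⟨_, l, rfl, hl, rfl⟩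
    exact ⟨_, i :: l, rfl, by simpa using ⟨⟨h1, h2⟩, hl⟩, by simp⟩
  exact Nat.sInf_mem this

theorem length_le_of_word {l : List ℤ} (hl : ∀ i ∈ l, 1 ≤ i ∧ i ≤ n) :
    length n (l.map simpleRefl).prod ≤ l.length :=
  Nat.sInf_le ⟨l, rfl, hl, rfl⟩

/-- A simple reflection permutes the positive roots other than its own simple root. -/
theorem simpleRefl_lt_or {i : ℤ} (hi : 1 ≤ i) {a b : ℤ} (h : IsPair n a b) (hab : a < b) :
    simpleRefl i a < simpleRefl i b ∨ (a = lo i ∧ b = TypeD.hi i) ∨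
      (a = -TypeD.hi i ∧ b = -lo i) := by
  unfold IsPair Idx at h
  unfold simpleRefl lo TypeD.hi
  split_ifs <;> simp only [Perm.mul_apply, swap_apply_def] <;> grind

theorem pairRefl_neg_neg {a b : ℤ} (h : IsPair n a b) : pairRefl (-b) (-a) = pairRefl a b := by
  unfold pairRefl
  unfold IsPair Idx at h
  rw [neg_neg, neg_neg, swap_comm b a, swap_comm (-b) (-a)]
  ext k
  simp only [Perm.mul_apply, swap_apply_def]
  split_ifs <;> grind

/-- The exchange property. -/
theorem exchange (hn : 2 ≤ n) (l : List ℤ) (hl : ∀ i ∈ l, 1 ≤ i ∧ i ≤ n) {a b : ℤ}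
    (h : IsPair n a b) (hab : a < b)
    (hinv : (l.map simpleRefl).prod⁻¹ b < (l.map simpleRefl).prod⁻¹ a) :
    ∃ l' : List ℤ, l'.length + 1 = l.length ∧ (∀ i ∈ l', 1 ≤ i ∧ i ≤ n) ∧
      (l'.map simpleRefl).prod = pairRefl a b * (l.map simpleRefl).prod := by
  induction l generalizing a b with
  | nil => simp at hinv; omega
  | cons i l ih =>
    have hi := hl i (by simp)
    have hl' : ∀ i ∈ l, 1 ≤ i ∧ i ≤ n := fun j hj => hl j (by simp [hj])
    have hm := simpleRefl_mem (n := n) hi.1 hi.2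
    -- If the first letter keeps the root positive, the exchange takes place further along the word.
    -- Otherwise the root is the simple root of that letter, and deleting the letter is the
    -- exchange.
    by_cases hlt : simpleRefl i a < simpleRefl i b
    · obtain ⟨l', h1, h2, h3⟩ := ih hl' (h.weyl hn hm) hlt (by
        simpa [mul_inv_rev, simpleRefl_inv hi.1] using hinv)
      refine ⟨i :: l', by simp [h1], by simpa using ⟨hi, h2⟩, ?_⟩
      rw [List.map_cons, List.prod_cons, List.map_cons, List.prod_cons, h3, ← conj_pairRefl hm,
        simpleRefl_inv hi.1]
      simp only [mul_assoc]
      rw [← mul_assoc (simpleRefl i) (simpleRefl i), simpleRefl_mul_self hi.1, one_mul]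
    · have e : pairRefl a b = simpleRefl i := by
        rcases (simpleRefl_lt_or hi.1 h hab).resolve_left hlt with ⟨rfl, rfl⟩ | ⟨rfl, rfl⟩
        · rw [simpleRefl_eq]
        · rw [simpleRefl_eq, pairRefl_neg_neg (isPair_simple hn hi.1 hi.2)]
      refine ⟨l, by simp, hl', ?_⟩
      rw [e, List.map_cons, List.prod_cons, ← mul_assoc, simpleRefl_mul_self hi.1, one_mul]

theorem length_pairRefl_mul_lt (hn : 2 ≤ n) {w : Perm ℤ} (hw : w ∈ weylGroup n) {a b : ℤ}
    (h : IsPair n a b) (hab : a < b) (hinv : w⁻¹ b < w⁻¹ a) :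
    length n (pairRefl a b * w) < length n w := by
  obtain ⟨l, h1, h2, rfl⟩ := exists_word hw
  obtain ⟨l', h3, h4, h5⟩ := exchange hn l h2 h hab hinv
  have := length_le_of_word h4
  rw [h5] at this
  omega

/-- The inverse of `s_i w` reverses `α_i` when that of `w` does not, so the exchange property
shortens `s_i w` back to `w`. -/
theorem length_lt_simpleRefl_mul (hn : 2 ≤ n) {w : Perm ℤ} (hw : w ∈ weylGroup n) {i : ℤ}
    (h1 : 1 ≤ i) (h2 : i ≤ n) (h : w⁻¹ (lo i) < w⁻¹ (hi i)) :
    length n w < length n (simpleRefl i * w) := by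
  have hs : simpleRefl i (lo i) = hi i ∧ simpleRefl i (hi i) = lo i := by
    unfold simpleRefl lo hi
    split_ifs <;> simp only [Perm.mul_apply, swap_apply_def] <;> grind
  have hp := isPair_simple hn h1 h2
  have := length_pairRefl_mul_lt hn (mul_mem (simpleRefl_mem h1 h2) hw) hp (lo_lt_hi i) (by
    rw [mul_inv_rev, simpleRefl_inv h1, Perm.mul_apply, Perm.mul_apply, hs.1, hs.2]
    exact h)
  rwa [← simpleRefl_eq, ← mul_assoc, simpleRefl_mul_self h1, one_mul] at this

theorem IsReflection.exists_pair (hn : 2 ≤ n) {t : Perm ℤ} (ht : IsReflection n t) :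
    t ∈ weylGroup n ∧ ∃ a b, IsPair n a b ∧ a < b ∧ t = pairRefl a b := by
  obtain ⟨w, hw, i, h1, h2, rfl⟩ := ht
  refine ⟨mul_mem (mul_mem hw (simpleRefl_mem h1 h2)) (inv_mem hw), ?_⟩
  have hp := (isPair_simple hn h1 h2).weyl hn hw
  rw [simpleRefl_eq, conj_pairRefl hw]
  rcases lt_or_gt_of_ne hp.2.2.1 with h | h
  · exact ⟨_, _, hp, h, rfl⟩
  · exact ⟨_, _, hp.swap, h, by simp only [pairRefl, swap_comm]⟩

/-! ### Fundamental weights, suffix sums and the nonnegative cone -/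

theorem coord_fundWeight (r : ℤ) {k : ℤ} (h1 : 1 ≤ k) (h2 : k ≤ n) :
    coord (fundWeight n r) k =
      if r = 1 then 1 / 2 else if r = 2 then (if k = 1 then -1 / 2 else 1 / 2)
      else if r ≤ k then 1 else 0 := by
  rw [coord_apply _ h1 h2, fundWeight]
  have e : ((k - 1).toNat = 0) ↔ k = 1 := by omega
  have e2 : (((k - 1).toNat : ℕ) : ℤ) + 1 = k := by omega
  simp only [e, e2]

theorem simpleRoot_dot_self (hn : 2 ≤ n) {i : ℤ} (h1 : 1 ≤ i) (h2 : i ≤ n) :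
    simpleRoot n i ⬝ᵥ simpleRoot n i = 2 := by
  have hp := isPair_simple hn h1 h2
  rw [simpleRoot_eq, dot_root, coord_root_idx hp.1, coord_root_idx hp.2.1]
  unfold IsPair at hp
  grind

theorem fundWeight_dot_simpleRoot (hn : 2 ≤ n) {i j : ℤ} (hi : 1 ≤ i) (hj : 1 ≤ j) (hjn : j ≤ n) :
    fundWeight n i ⬝ᵥ simpleRoot n j = if i = j then 1 else 0 := by
  have := fundWeight_pairing hn hi hj hjn
  rw [corootPairing, simpleRoot_dot_self hn hj hjn] at this
  rw [← this]; ring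

/-- The sum of the coordinates of `x` from the `k`-th on. -/
noncomputable def suffixSum (x : Fin n → ℝ) (k : ℤ) : ℝ := ∑ j ∈ Finset.Icc k (n : ℤ), coord x j

theorem suffixSum_eq (x : Fin n → ℝ) {k : ℤ} (hk : k ≤ n) :
    suffixSum x k = coord x k + suffixSum x (k + 1) := by
  unfold suffixSum
  rw [← Finset.insert_Icc_add_one_left_eq_Icc hk, Finset.sum_insert (by simp)]

theorem suffixSum_of_lt (x : Fin n → ℝ) {k : ℤ} (hk : n < k) : suffixSum x k = 0 := by
  unfold suffixSum
  rw [Finset.Icc_eq_empty (by omega), Finset.sum_empty]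

theorem dot_fundWeight_of_three_le (x : Fin n → ℝ) {k : ℤ} (hk : 3 ≤ k) :
    x ⬝ᵥ fundWeight n k = suffixSum x k := by
  rw [dot_eq_sum, suffixSum]
  symm
  refine Finset.sum_subset_zero_on_sdiff (Finset.Icc_subset_Icc (by omega) le_rfl) ?_ ?_
  · intro j hj
    simp only [Finset.mem_sdiff, Finset.mem_Icc] at hj
    rw [coord_fundWeight _ (by omega) (by omega)]
    grind
  · intro j hj
    simp only [Finset.mem_Icc] at hj
    rw [coord_fundWeight _ (by omega) (by omega), if_neg (by omega), if_neg (by omega),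
      if_pos hj.1, mul_one]

theorem dot_fundWeight_one (hn : 2 ≤ n) (x : Fin n → ℝ) :
    2 * (x ⬝ᵥ fundWeight n 1) = suffixSum x 2 + coord x 1 := by
  have : x ⬝ᵥ fundWeight n 1 = (1 / 2) * suffixSum x 1 := by
    rw [dot_eq_sum, suffixSum, Finset.mul_sum]
    refine Finset.sum_congr rfl fun j hj => ?_
    rw [Finset.mem_Icc] at hj
    rw [coord_fundWeight _ hj.1 hj.2, if_pos rfl, mul_comm]
  rw [this, suffixSum_eq x (k := 1) (by omega)]
  norm_num; ring

theorem dot_fundWeight_two (hn : 2 ≤ n) (x : Fin n → ℝ) :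
    2 * (x ⬝ᵥ fundWeight n 2) = suffixSum x 2 - coord x 1 := by
  have : x ⬝ᵥ fundWeight n 2 = -(1 / 2) * coord x 1 + (1 / 2) * suffixSum x 2 := by
    rw [dot_eq_sum, ← Finset.insert_Icc_add_one_left_eq_Icc (show (1 : ℤ) ≤ n by omega),
      Finset.sum_insert (by simp), coord_fundWeight _ le_rfl (by omega), suffixSum, Finset.mul_sum]
    norm_num
    congr 1
    · ring
    refine Finset.sum_congr rfl fun j hj => ?_
    rw [Finset.mem_Icc] at hj
    rw [coord_fundWeight _ (by omega) hj.2, if_neg (by omega), if_pos rfl, if_neg (by omega),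
      mul_comm]
  rw [this]; ring

/-- Consecutive suffix sums recover the coordinates from the third on, and the sum and difference of
the two spin pairings recover the first two. -/
theorem eq_zero_of_dot_fundWeight (hn : 2 ≤ n) {z : Fin n → ℝ}
    (h : ∀ k : ℤ, 1 ≤ k → k ≤ n → z ⬝ᵥ fundWeight n k = 0) : z = 0 := by
  have hS : ∀ k : ℤ, 3 ≤ k → suffixSum z k = 0 := by
    intro k hk
    by_cases hkn : k ≤ n
    · rw [← dot_fundWeight_of_three_le z hk, h k (by omega) hkn]
    · exact suffixSum_of_lt z (by omega)
  have h1 := dot_fundWeight_one hn z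
  have h2 := dot_fundWeight_two hn z
  rw [h 1 le_rfl (by omega)] at h1
  rw [h 2 (by omega) (by omega)] at h2
  refine coord_ext fun k hk1 hk2 => ?_
  rw [show coord (0 : Fin n → ℝ) k = 0 by simp [coord]]
  have hk := suffixSum_eq z hk2
  rcases (show k = 1 ∨ k = 2 ∨ 3 ≤ k by omega) with rfl | rfl | h3
  · linarith
  · rw [hS (2 + 1) (by norm_num)] at hk
    linarith
  · rw [hS k h3, hS (k + 1) (by omega)] at hk
    linarith

theorem eq_sum_dot_fundWeight (hn : 2 ≤ n) (x : Fin n → ℝ) :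
    x = ∑ i ∈ Finset.Icc (1 : ℤ) n, (x ⬝ᵥ fundWeight n i) • simpleRoot n i := by
  refine sub_eq_zero.1 (eq_zero_of_dot_fundWeight hn fun k h1 h2 => ?_)
  rw [sub_dotProduct, sub_eq_zero, sum_dotProduct, Finset.sum_eq_single k]
  · rw [smul_dotProduct, dotProduct_comm (simpleRoot n k),
      fundWeight_dot_simpleRoot hn h1 h1 h2, if_pos rfl, smul_eq_mul, mul_one]
  · intro b hb hbk
    rw [Finset.mem_Icc] at hb
    rw [smul_dotProduct, dotProduct_comm (simpleRoot n b),
      fundWeight_dot_simpleRoot hn h1 hb.1 hb.2, if_neg (Ne.symm hbk), smul_zero]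
  · intro h; exact absurd (Finset.mem_Icc.2 ⟨h1, h2⟩) h

/-- By duality, pairing with `ω_k` reads off the coefficient of `α_k`. -/
theorem nonnegWeight_iff_dot (hn : 2 ≤ n) {x : Fin n → ℝ} :
    NonnegWeight n x ↔ ∀ k : ℤ, 1 ≤ k → k ≤ n → 0 ≤ x ⬝ᵥ fundWeight n k := by
  constructor
  · rintro ⟨c, hc, rfl⟩ k h1 h2
    rw [sum_dotProduct]
    refine Finset.sum_nonneg fun j hj => ?_
    rw [Finset.mem_Icc] at hj
    rw [smul_dotProduct, dotProduct_comm, fundWeight_dot_simpleRoot hn h1 hj.1 hj.2, smul_eq_mul]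
    have := hc j
    split_ifs <;> simp [this]
  · intro h
    -- The coefficient function has to be nonnegative at all integers, including those outside `[1,
    -- n]`, hence the truncation at 0.
    refine ⟨fun k => max 0 (x ⬝ᵥ fundWeight n k), fun _ => le_max_left _ _, ?_⟩
    conv_lhs => rw [eq_sum_dot_fundWeight hn x]
    refine Finset.sum_congr rfl fun k hk => ?_
    rw [Finset.mem_Icc] at hk
    simp only [max_eq_right (h k hk.1 hk.2)]

theorem NonnegWeight.add {x y : Fin n → ℝ} (hx : NonnegWeight n x) (hy : NonnegWeight n y) :
    NonnegWeight n (x + y) := by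
  obtain ⟨c, hc, rfl⟩ := hx
  obtain ⟨d, hd, rfl⟩ := hy
  exact ⟨c + d, fun i => add_nonneg (hc i) (hd i), by
    simp [add_smul, Finset.sum_add_distrib]⟩

theorem NonnegWeight.smul {x : Fin n → ℝ} (hx : NonnegWeight n x) {c : ℝ} (hc : 0 ≤ c) :
    NonnegWeight n (c • x) := by
  obtain ⟨d, hd, rfl⟩ := hx
  exact ⟨c • d, fun i => mul_nonneg hc (hd i), by simp [Finset.smul_sum, smul_smul]⟩

theorem NonnegWeight.sum {ι : Type*} {s : Finset ι} {f : ι → Fin n → ℝ}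
    (h : ∀ i ∈ s, NonnegWeight n (f i)) : NonnegWeight n (∑ i ∈ s, f i) := by
  classical
  induction s using Finset.induction_on with
  | empty => exact ⟨0, fun _ => le_rfl, by simp⟩
  | insert a s ha ih =>
    rw [Finset.sum_insert ha]
    exact (h a (by simp)).add (ih fun i hi => h i (by simp [hi]))

theorem fundWeight_dot_root_nonneg (r : ℤ) {a b : ℤ} (h : IsPair n a b) (hab : a < b) :
    0 ≤ fundWeight n r ⬝ᵥ root n a b := by
  obtain ⟨i, j, h1, h2, h3, e⟩ := mem_posRoots_iff.2 ⟨a, b, h, hab, rfl⟩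
  have hi := coord_fundWeight r h1 (by omega : i ≤ n)
  have hj := coord_fundWeight r (by omega : 1 ≤ j) h3
  rcases e with e | e <;> rw [e]
  · rw [dotProduct_sub]
    change 0 ≤ coord _ j - coord _ i
    rw [hi, hj]
    split_ifs <;> first | omega | norm_num
  · rw [dotProduct_add]
    change 0 ≤ coord _ j + coord _ i
    rw [hi, hj]
    split_ifs <;> first | omega | norm_num

theorem root_dot_fundWeight_nonneg (r : ℤ) {a b : ℤ} (h : IsPair n a b) (hab : a < b) :
    0 ≤ root n a b ⬝ᵥ fundWeight n r := by
  rw [dotProduct_comm]; exact fundWeight_dot_root_nonneg r h hab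

theorem nonnegWeight_root (hn : 2 ≤ n) {a b : ℤ} (h : IsPair n a b) (hab : a < b) :
    NonnegWeight n (root n a b) :=
  (nonnegWeight_iff_dot hn).2 fun _ _ _ => root_dot_fundWeight_nonneg _ h hab

theorem not_nonnegWeight_neg_root (hn : 2 ≤ n) {a b : ℤ} (h : IsPair n a b) (hab : a < b) :
    ¬ NonnegWeight n (-root n a b) := by
  intro hneg
  have h0 : root n a b = 0 := by
    refine eq_zero_of_dot_fundWeight hn fun k h1 h2 => ?_
    have e1 := root_dot_fundWeight_nonneg k h hab
    have e2 := (nonnegWeight_iff_dot hn).1 hneg k h1 h2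
    rw [neg_dotProduct] at e2
    linarith
  have := coord_root_idx (a := a) (b := b) h.2.1
  rw [h0, if_pos rfl] at this
  unfold IsPair Idx at h
  simp [coord] at this
  grind

/-! ### Elements of `W^{I_r}` and their weights -/

theorem mem_minReps_iff (hn : 2 ≤ n) {r : ℤ} {v : Perm ℤ} : v ∈ minReps n r ↔ v ∈ weylGroup n ∧
    ∀ j : ℤ, 1 ≤ j → j ≤ n → j ≠ r → v (lo j) < v (hi j) := by
  refine and_congr_right fun hv => forall_congr' fun j => forall_congr' fun h1 =>
    forall_congr' fun h2 => forall_congr' fun _ => ?_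
  rw [simpleRoot_eq, act_root hn hv, root_mem_posRoots_iff ((isPair_simple hn h1 h2).weyl hn hv)]

theorem isPair_inv (hn : 2 ≤ n) {w : Perm ℤ} (hw : w ∈ weylGroup n) {a b : ℤ}
    (h : IsPair n a b) : IsPair n (w⁻¹ a) (w⁻¹ b) :=
  h.weyl hn (inv_mem hw)

theorem dot_root_eq (hn : 2 ≤ n) {w : Perm ℤ} (hw : w ∈ weylGroup n) (x : Fin n → ℝ) (a b : ℤ) :
    act n w x ⬝ᵥ root n a b = x ⬝ᵥ root n (w⁻¹ a) (w⁻¹ b) := by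
  rw [act_dot hn hw, act_root hn (inv_mem hw)]

theorem lt_of_dot_root_pos (hn : 2 ≤ n) (r : ℤ) {w : Perm ℤ} (hw : w ∈ weylGroup n)
    {a b : ℤ} (h : IsPair n a b) (hpos : 0 < act n w (fundWeight n r) ⬝ᵥ root n a b) :
    w⁻¹ a < w⁻¹ b := by
  rw [dot_root_eq hn hw] at hpos
  have hp := isPair_inv hn hw h
  by_contra hc
  have := fundWeight_dot_root_nonneg r hp.swap (by have := hp.2.2.1; omega)
  rw [root_swap, dotProduct_neg] at this
  linarith

theorem dot_root_nonneg_of_lt (hn : 2 ≤ n) (r : ℤ) {w : Perm ℤ} (hw : w ∈ weylGroup n)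
    {a b : ℤ} (h : IsPair n a b) (hlt : w⁻¹ a < w⁻¹ b) :
    0 ≤ act n w (fundWeight n r) ⬝ᵥ root n a b := by
  rw [dot_root_eq hn hw]
  exact fundWeight_dot_root_nonneg r (isPair_inv hn hw h) hlt

/-- A nontrivial element of `W` makes some simple root negative. -/
theorem exists_simple_descent (hn : 2 ≤ n) {x : Perm ℤ} (hx : x ∈ weylGroup n) (h1 : x ≠ 1) :
    ∃ i : ℤ, 1 ≤ i ∧ i ≤ n ∧ x (hi i) < x (lo i) := by
  obtain ⟨l, hlen, hl, hprod⟩ := exists_word (inv_mem hx)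
  cases l with
  | nil => simp at hprod; exact absurd hprod h1
  | cons i l =>
    have hi := hl i (by simp)
    have hl' : ∀ j ∈ l, 1 ≤ j ∧ j ≤ n := fun j hj => hl j (by simp [hj])
    refine ⟨i, hi.1, hi.2, ?_⟩
    -- If `x` kept `α_i` positive, then `s_i x⁻¹` would be longer than `x⁻¹`, yet removing the first
    -- letter `i` of a shortest word for `x⁻¹` makes it shorter.
    by_contra hc
    have hp := ((isPair_simple hn hi.1 hi.2).weyl hn hx).2.2.1
    have := length_lt_simpleRefl_mul hn (inv_mem hx) hi.1 hi.2 (by rw [inv_inv]; omega)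
    rw [List.map_cons, List.prod_cons] at hprod
    have h2 := length_le_of_word hl'
    rw [← hprod, ← mul_assoc, simpleRefl_mul_self hi.1, one_mul, hprod, ← hlen] at this
    simp at this
    omega

/-- An element of `W^{I_r}` makes every positive root orthogonal to `ω_r` nonnegative. -/
theorem nonnegWeight_act_root (hn : 2 ≤ n) {r : ℤ} {v : Perm ℤ} (hv : v ∈ minReps n r) {a b : ℤ}
    (h : IsPair n a b) (hab : a < b) (h0 : root n a b ⬝ᵥ fundWeight n r = 0) :
    NonnegWeight n (act n v (root n a b)) := by
  rw [eq_sum_dot_fundWeight hn (root n a b), act_sum]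
  refine NonnegWeight.sum fun k hk => ?_
  rw [Finset.mem_Icc] at hk
  rw [act_smul]
  -- The coefficient of `α_r` is the pairing with `ω_r`, which vanishes; the other simple roots stay
  -- positive under `v`.
  by_cases hkr : k = r
  · rw [hkr, h0, zero_smul]
    exact ⟨0, fun _ => le_rfl, by simp⟩
  · have hlt := ((mem_minReps_iff hn).1 hv).2 k hk.1 hk.2 hkr
    rw [simpleRoot_eq, act_root hn hv.1]
    exact (nonnegWeight_root hn ((isPair_simple hn hk.1 hk.2).weyl hn hv.1) hlt).smul
      (root_dot_fundWeight_nonneg k h hab)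

/-- The quotient `x = v⁻¹ u` fixes `ω_r`. If it is nontrivial, it makes some `α_i` negative. For `i
= r` this contradicts `(ω_r, α_r) = 1`. For `i ≠ r` the positive root `-x α_i` is orthogonal to
`ω_r`, so `v` keeps it nonnegative, although `v x α_i = u α_i` is positive. -/
theorem minReps_unique (hn : 2 ≤ n) {r : ℤ} (hr1 : 1 ≤ r) {u v : Perm ℤ}
    (hu : u ∈ minReps n r) (hv : v ∈ minReps n r)
    (h : act n u (fundWeight n r) = act n v (fundWeight n r)) : u = v := by
  have hxm : v⁻¹ * u ∈ weylGroup n := mul_mem (inv_mem hv.1) hu.1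
  by_contra hne
  obtain ⟨i, h1, h2, hdes⟩ := exists_simple_descent hn hxm (fun e => hne (by
    rw [inv_mul_eq_one] at e; exact e.symm))
  have hfix : act n (v⁻¹ * u) (fundWeight n r) = fundWeight n r := by
    rw [act_mul hn (inv_mem hv.1) hu.1, h, act_inv_act hn hv.1]
  have hp := isPair_simple hn h1 h2
  have hq := (hp.weyl hn hxm).swap
  have hdot : fundWeight n r ⬝ᵥ simpleRoot n i =
      -(fundWeight n r ⬝ᵥ root n ((v⁻¹ * u) (hi i)) ((v⁻¹ * u) (lo i))) := by
    rw [← act_dot_act hn hxm, hfix, simpleRoot_eq, act_root hn hxm, root_swap, dotProduct_neg]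
  have hge := fundWeight_dot_root_nonneg r hq hdes
  rw [fundWeight_dot_simpleRoot hn hr1 h1 h2] at hdot
  split_ifs at hdot with hri
  · linarith
  · have key := nonnegWeight_act_root hn hv hq hdes (by rw [dotProduct_comm]; linarith)
    have hlt := ((mem_minReps_iff hn).1 hu).2 i h1 h2 (Ne.symm hri)
    rw [root_swap, act_neg, ← act_root hn hxm, ← act_mul hn hv.1 hxm, mul_inv_cancel_left,
      act_root hn hu.1] at key
    exact not_nonnegWeight_neg_root hn (hp.weyl hn hu.1) hlt key

/-- If `w` makes `α_j` negative for some `j ≠ r`, then `w s_j` is shorter and has the same weight,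
since `s_j` fixes `ω_r`. -/
theorem exists_minReps (hn : 2 ≤ n) {r : ℤ} (hr1 : 1 ≤ r) {w : Perm ℤ} (hw : w ∈ weylGroup n) :
    ∃ v ∈ minReps n r, act n v (fundWeight n r) = act n w (fundWeight n r) := by
  induction hlen : length n w using Nat.strong_induction_on generalizing w with
  | _ N ih =>
    by_cases hm : w ∈ minReps n r
    · exact ⟨w, hm, rfl⟩
    rw [mem_minReps_iff hn] at hm
    push Not at hm
    obtain ⟨j, h1, h2, hjr, hlt⟩ := hm hw
    have hp := isPair_simple hn h1 h2
    have hq := (hp.weyl hn hw).swap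
    have hlt' : w (hi j) < w (lo j) := lt_of_le_of_ne hlt hq.2.2.1
    have hl := length_pairRefl_mul_lt hn hw hq hlt' (by simpa using lo_lt_hi j)
    have e : pairRefl (w (hi j)) (w (lo j)) * w = w * simpleRefl j := by
      have : pairRefl (w (hi j)) (w (lo j)) = pairRefl (w (lo j)) (w (hi j)) := by
        simp only [pairRefl, swap_comm]
      rw [this, ← conj_pairRefl hw, simpleRefl_eq, inv_mul_cancel_right]
    rw [e, hlen] at hl
    obtain ⟨v, hv, hv'⟩ := ih _ hl (mul_mem hw (simpleRefl_mem h1 h2)) rfl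
    refine ⟨v, hv, ?_⟩
    rw [hv', act_mul hn hw (simpleRefl_mem h1 h2), act_simpleRefl hn h1 h2,
      fundWeight_dot_simpleRoot hn hr1 h1 h2, if_neg (Ne.symm hjr), zero_smul, sub_zero]

/-! ### Bruhat order and weights -/

/-- A step in the Bruhat order lowers the weight. -/
theorem bruhat_step (hn : 2 ≤ n) (r : ℤ) {v t : Perm ℤ} (hv : v ∈ weylGroup n)
    (ht : IsReflection n t) (hlt : length n v < length n (t * v)) :
    ∃ a b, IsPair n a b ∧ a < b ∧ 0 ≤ act n v (fundWeight n r) ⬝ᵥ root n a b ∧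
      act n (t * v) (fundWeight n r) = act n v (fundWeight n r) -
        (act n v (fundWeight n r) ⬝ᵥ root n a b) • root n a b := by
  obtain ⟨htm, a, b, h, hab, rfl⟩ := ht.exists_pair hn
  refine ⟨a, b, h, hab, ?_, ?_⟩
  · refine dot_root_nonneg_of_lt hn r hv h ?_
    by_contra hc
    have hne := (isPair_inv hn hv h).2.2.1
    have := length_pairRefl_mul_lt hn hv h hab (by omega)
    omega
  · rw [act_mul hn htm hv, act_pairRefl hn h htm]

theorem bruhat_nonneg_sub (hn : 2 ≤ n) (r : ℤ) {v u : Perm ℤ} (h : BruhatLE n v u) :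
    NonnegWeight n (act n v (fundWeight n r) - act n u (fundWeight n r)) := by
  induction h using Relation.ReflTransGen.head_induction_on with
  | refl => exact ⟨0, fun _ => le_rfl, by simp⟩
  | head hstep _ ih =>
    obtain ⟨hv, t, ht, rfl, hlt⟩ := hstep
    obtain ⟨a, b, h, hab, hnn, e⟩ := bruhat_step hn r hv ht hlt
    rw [e] at ih
    have := ((nonnegWeight_root hn h hab).smul hnn).add ih
    convert this using 1
    abel

/-- `x ≥ 0`, and no reflection lowers `x` to another element `≥ 0`. -/
def LocMax (n : ℕ) (x : Fin n → ℝ) : Prop :=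
  NonnegWeight n x ∧ ∀ a b, IsPair n a b → a < b → 0 < x ⬝ᵥ root n a b →
    ¬ NonnegWeight n (x - (x ⬝ᵥ root n a b) • root n a b)

/-- `x ≥ 0`, and no simple reflection lowers `x` to another element `≥ 0`. -/
def SimpleMax (n : ℕ) (x : Fin n → ℝ) : Prop :=
  NonnegWeight n x ∧ ∀ i : ℤ, 1 ≤ i → i ≤ n → 0 < x ⬝ᵥ simpleRoot n i →
    ¬ NonnegWeight n (x - (x ⬝ᵥ simpleRoot n i) • simpleRoot n i)

/-- Along a Bruhat chain from `v` to `u` the weight can only descend. The first step that changes it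
would reach a weight lying above that of `u`, hence nonnegative, against local maximality. So `u`
and `v` have equal weights. -/
theorem mem_maximalSet_of_locMax (hn : 2 ≤ n) {r : ℤ} (hr1 : 1 ≤ r) {v : Perm ℤ}
    (hv : v ∈ minReps n r) (h : LocMax n (act n v (fundWeight n r))) : v ∈ maximalSet n r := by
  refine ⟨hv, h.1, fun u hu hun hle => ?_⟩
  refine minReps_unique hn hr1 hu hv ?_
  clear hv
  induction hle using Relation.ReflTransGen.head_induction_on with
  | refl => rfl
  | head hstep hrest ih =>
    obtain ⟨hv, t, ht, rfl, hlt⟩ := hstep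
    obtain ⟨a, b, hp, hab, hnn, e⟩ := bruhat_step hn r hv ht hlt
    rcases hnn.eq_or_lt with h0 | hpos
    · rw [← h0, zero_smul, sub_zero] at e
      rw [ih (e ▸ h), e]
    · refine absurd ?_ (h.2 a b hp hab hpos)
      rw [← e]
      simpa using (bruhat_nonneg_sub hn r hrest).add hun

/-- A simple reflection that strictly lowers the weight stays inside `W^{I_r}` and goes up in the
Bruhat order, so it would contradict maximality if the new weight were nonnegative. -/
theorem simpleMax_of_mem_maximalSet (hn : 2 ≤ n) {r : ℤ} (hr1 : 1 ≤ r) {v : Perm ℤ}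
    (h : v ∈ maximalSet n r) : SimpleMax n (act n v (fundWeight n r)) := by
  obtain ⟨hv, hnn, hmax⟩ := h
  refine ⟨hnn, fun i h1 h2 hpos hnn' => ?_⟩
  have hs := simpleRefl_mem (n := n) h1 h2
  have e : act n (simpleRefl i * v) (fundWeight n r) = act n v (fundWeight n r) -
      (act n v (fundWeight n r) ⬝ᵥ simpleRoot n i) • simpleRoot n i := by
    rw [act_mul hn hs hv.1, act_simpleRefl hn h1 h2]
  have hp := isPair_simple hn h1 h2
  have hpos' := hpos
  rw [simpleRoot_eq] at hpos'
  have hlen := length_lt_simpleRefl_mul hn hv.1 h1 h2 (lt_of_dot_root_pos hn r hv.1 hp hpos')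
  have hu : simpleRefl i * v ∈ minReps n r := by
    refine (mem_minReps_iff hn).2 ⟨mul_mem hs hv.1, fun j j1 j2 hj => ?_⟩
    have hpj := isPair_simple hn j1 j2
    have hlt := ((mem_minReps_iff hn).1 hv).2 j j1 j2 hj
    rw [Perm.mul_apply, Perm.mul_apply]
    refine (simpleRefl_lt_or h1 (hpj.weyl hn hv.1) hlt).resolve_right fun hc => ?_
    -- The only positive root that `s_i` makes negative is `α_i`. If `v(α_j)` were `α_i`, then
    -- `(v(ω_r), α_i) = (ω_r, α_j) = 0`, against the strict lowering.
    have : act n v (simpleRoot n j) = simpleRoot n i := by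
      rw [simpleRoot_eq, simpleRoot_eq, act_root hn hv.1]
      rcases hc with ⟨e1, e2⟩ | ⟨e1, e2⟩
      · rw [e1, e2]
      · rw [e1, e2, root_neg_neg]
    rw [← this, act_dot_act hn hv.1, fundWeight_dot_simpleRoot hn hr1 j1 j2,
      if_neg (Ne.symm hj)] at hpos
    exact lt_irrefl _ hpos
  have := hmax _ hu (e ▸ hnn') (Relation.ReflTransGen.single
    ⟨hv.1, simpleRefl i, ⟨1, one_mem _, i, h1, h2, by simp⟩, rfl, hlen⟩)
  rw [this] at hlen
  exact lt_irrefl _ hlen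

theorem NonnegWeight.of_smul {x : Fin n → ℝ} {c : ℝ} (hc : 0 < c) (h : NonnegWeight n (c • x)) :
    NonnegWeight n x := by
  have := h.smul (inv_nonneg.2 hc.le)
  rwa [inv_smul_smul₀ hc.ne'] at this

/-- For `r = 1, 2` the weight has half-integral coordinates; the scaling lemmas allow the passage to
`2ω_r`, whose coordinates are `±1`. -/
theorem LocMax.of_smul {x : Fin n → ℝ} {c : ℝ} (hc : 0 < c) (h : LocMax n (c • x)) :
    LocMax n x := by
  refine ⟨h.1.of_smul hc, fun a b hp hab hpos hnn => h.2 a b hp hab ?_ ?_⟩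
  · rw [smul_dotProduct]; exact mul_pos hc hpos
  · have := hnn.smul hc.le
    rwa [smul_sub, smul_smul, ← smul_eq_mul, ← smul_dotProduct] at this

theorem SimpleMax.smul {x : Fin n → ℝ} {c : ℝ} (hc : 0 < c) (h : SimpleMax n x) :
    SimpleMax n (c • x) := by
  refine ⟨h.1.smul hc.le, fun i h1 h2 hpos hnn => h.2 i h1 h2 ?_ (NonnegWeight.of_smul hc ?_)⟩
  · rw [smul_dotProduct] at hpos; exact (mul_pos_iff_of_pos_left hc).1 hpos
  · rwa [smul_sub, smul_smul, ← smul_eq_mul, ← smul_dotProduct]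

/-! ### Ternary vectors that no simple reflection can lower -/

/-- `i` is a sequence in `[s, t]` with gaps at least `2`. -/
def Sparse (s t : ℤ) (i : List ℤ) : Prop :=
  (∀ x ∈ i, s ≤ x ∧ x ≤ t) ∧ i.Pairwise fun a b => a + 2 ≤ b

theorem mem_J_iff {p : ℕ} {s t : ℤ} {i : List ℤ} :
    i ∈ J p s t ↔ i.length = p ∧ Sparse s t i := by
  have : IsTrans ℤ fun a b => b - a ≥ 2 := ⟨fun a b c h1 h2 => by omega⟩
  have h : (i.IsChain fun a b => b - a ≥ 2) ↔ i.Pairwise fun a b => a + 2 ≤ b := by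
    rw [List.isChain_iff_pairwise]
    exact List.Pairwise.iff fun {a b} => by omega
  simp only [J, Sparse, Set.mem_ofPred_eq, h]

theorem Sparse.not_mem_succ {s t : ℤ} {i : List ℤ} (h : Sparse s t i) {k : ℤ} (hk : k ∈ i) :
    k + 1 ∉ i := by
  obtain ⟨-, h⟩ := h
  induction h with
  | nil => simp at hk
  | cons hx _ ih =>
    simp only [List.mem_cons] at hk ⊢
    grind

theorem Sparse.nodup {s t : ℤ} {i : List ℤ} (h : Sparse s t i) : i.Nodup :=
  h.2.imp fun h => by omega

theorem Sparse.tail {s t x : ℤ} {i : List ℤ} (h : Sparse s t (x :: i)) : Sparse (x + 2) t i :=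
  ⟨fun y hy => ⟨(List.pairwise_cons.1 h.2).1 y hy, (h.1 y (by simp [hy])).2⟩,
    (List.pairwise_cons.1 h.2).2⟩

theorem Sparse.mono {s s' t : ℤ} {i : List ℤ} (h : Sparse s t i) (hs : s' ≤ s) : Sparse s' t i :=
  ⟨fun y hy => ⟨hs.trans (h.1 y hy).1, (h.1 y hy).2⟩, h.2⟩

/-- The coordinates of `α_{i_1} + ⋯ + α_{i_p}`. -/
def pairCoord (i : List ℤ) (k : ℤ) : ℤ := (if k ∈ i then 1 else 0) - (if k + 1 ∈ i then 1 else 0)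

theorem coord_simpleRoot {x k : ℤ} (hx : 2 ≤ x) (h1 : 1 ≤ k) (h2 : k ≤ n) :
    coord (simpleRoot n x) k = (if k = x then 1 else 0) - (if k + 1 = x then 1 else 0) := by
  rw [simpleRoot_eq, coord_root_idx ⟨by omega, by omega, h2⟩]
  unfold lo hi
  grind

theorem coord_rootSum {s : ℤ} (hs : 2 ≤ s) {i : List ℤ} (hi : Sparse s n i) {k : ℤ}
    (h1 : 1 ≤ k) (h2 : k ≤ n) : coord (rootSum n i) k = pairCoord i k := by
  induction i generalizing s with
  | nil => simp [rootSum, coord, pairCoord]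
  | cons x i ih =>
    have hx := hi.1 x (by simp)
    have hn1 : x ∉ i := (List.nodup_cons.1 hi.nodup).1
    have h := ih (by omega) hi.tail
    rw [rootSum] at h ⊢
    rw [List.map_cons, List.sum_cons, coord_add, h, coord_simpleRoot (by omega) h1 h2]
    simp only [pairCoord, List.mem_cons]
    push_cast
    by_cases e1 : k = x
    · subst e1; simp [hn1]; ring
    · by_cases e2 : k + 1 = x
      · subst e2; simp [hn1]; ring
      · simp [e1, e2]

/-- All coordinates of `x` lie in `{-1, 0, 1}`. -/
def IsTernary (x : Fin n → ℝ) : Prop := ∀ k : ℤ, ∃ c : ℤ, coord x k = c ∧ -1 ≤ c ∧ c ≤ 1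

theorem nonnegWeight_iff_suffixSum (hn : 2 ≤ n) {x : Fin n → ℝ} :
    NonnegWeight n x ↔ (∀ k : ℤ, 3 ≤ k → k ≤ n → 0 ≤ suffixSum x k) ∧
      0 ≤ suffixSum x 2 + coord x 1 ∧ 0 ≤ suffixSum x 2 - coord x 1 := by
  rw [nonnegWeight_iff_dot hn, ← dot_fundWeight_one hn, ← dot_fundWeight_two hn]
  constructor
  · intro h
    refine ⟨fun k h1 h2 => ?_, ?_, ?_⟩
    · rw [← dot_fundWeight_of_three_le x h1]; exact h k (by omega) h2
    · have := h 1 le_rfl (by omega); linarith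
    · have := h 2 (by omega) (by omega); linarith
  · rintro ⟨h3, h1, h2⟩ k hk1 hk2
    rcases (show k = 1 ∨ k = 2 ∨ 3 ≤ k by omega) with rfl | rfl | hk
    · linarith
    · linarith
    · rw [dot_fundWeight_of_three_le x hk]; exact h3 k hk hk2

/-- Reflecting in `α_i` changes only the coefficient of `α_i`, so that coefficient must be the one
that becomes negative. -/
theorem SimpleMax.dot_lt (hn : 2 ≤ n) {x : Fin n → ℝ} (h : SimpleMax n x) {i : ℤ} (h1 : 1 ≤ i)
    (h2 : i ≤ n) (hpos : 0 < x ⬝ᵥ simpleRoot n i) :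
    x ⬝ᵥ fundWeight n i < x ⬝ᵥ simpleRoot n i := by
  by_contra hc
  refine h.2 i h1 h2 hpos ((nonnegWeight_iff_dot hn).2 fun k hk1 hk2 => ?_)
  have := (nonnegWeight_iff_dot hn).1 h.1 k hk1 hk2
  rw [sub_dotProduct, smul_dotProduct, dotProduct_comm (simpleRoot n i),
    fundWeight_dot_simpleRoot hn hk1 h1 h2, smul_eq_mul]
  split_ifs with e
  · subst e; linarith
  · linarith

/-- The coordinates `(e, 1, …, 1, …)`, with ones up to position `t`, and then those of
`α_{i_1} + ⋯ + α_{i_p}`. -/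
def stdCoord (t e : ℤ) (i : List ℤ) (k : ℤ) : ℤ :=
  if k = 1 then e else if k ≤ t then 1 else pairCoord i k

/-- `x` is one of the weights of the maximal elements: `t = 1` stands for `∑ α_{i_k}`, `t = 2` for
`e_2 + e • e_1 + ∑ α_{i_k}`, and `t = 3` for `e_3 + e_2 + e • e_1 + ∑ α_{i_k}`. -/
structure IsStd (n : ℕ) (x : Fin n → ℝ) (t e : ℤ) (i : List ℤ) : Prop where
  sparse : Sparse (t + 2) n i
  le_n : t ≤ n
  valid : (t = 1 ∧ e = 0) ∨ (t = 2 ∧ (e = -1 ∨ e = 0 ∨ e = 1)) ∨ (t = 3 ∧ (e = -1 ∨ e = 1))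
  coord_eq : ∀ k : ℤ, 1 ≤ k → k ≤ n → coord x k = stdCoord t e i k

/-- A downward scan over the coordinates `f` with suffix sums `F`: beyond position `k` there is a run
of ones, up to position `t`, followed by adjacent pairs `(-1, 1)` and zeros. -/
theorem scan {N : ℤ} {f F : ℤ → ℤ} (hf : ∀ k, -1 ≤ f k ∧ f k ≤ 1)
    (hF : ∀ k ≤ N, F k = f k + F (k + 1)) (hF0 : F (N + 1) = 0)
    (hnn : ∀ k, 2 ≤ k → k ≤ N → 0 ≤ F k)
    (hasc : ∀ k, 3 ≤ k → k ≤ N → f (k - 1) < f k → F k < f k - f (k - 1)) (d : ℕ) (k : ℤ)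
    (hk : k = N - d) (hk1 : 1 ≤ k) :
    ∃ t i, k ≤ t ∧ t ≤ N ∧ Sparse (t + 2) N i ∧ (∀ j, t < j → j ≤ N → f j = pairCoord i j) ∧
      (∀ j, k < j → j ≤ t → f j = 1) ∧ F (t + 1) = 0 ∧ F (k + 1) = t - k := by
  induction d generalizing k with
  | zero =>
    refine ⟨N, [], by omega, le_rfl, ⟨by simp, List.Pairwise.nil⟩, by omega, by omega, hF0, ?_⟩
    rw [hk]; simpa using hF0
  | succ d ih =>
    obtain ⟨t, i, h1, h2, h3, h4, h5, h6, h7⟩ := ih (k + 1) (by omega) (by omega)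
    have e := hF (k + 1) (by omega)
    have hk2 := hnn (k + 1) (by omega) (by omega)
    have hfk := hf (k + 1)
    by_cases c1 : f (k + 1) = 1
    · refine ⟨t, i, by omega, h2, h3, h4, fun j j1 j2 => ?_, h6, by omega⟩
      rcases (show j = k + 1 ∨ k + 1 < j by omega) with rfl | h
      · exact c1
      · exact h5 j h j2
    -- With no pending ones, a coordinate other than 1 must be 0, because `F (k + 1)` is
    -- nonnegative.
    rcases h1.eq_or_lt with rfl | hlt
    · have c0 : f (k + 1) = 0 := by omega
      refine ⟨k, i, le_rfl, by omega, h3.mono (by omega), fun j j1 j2 => ?_, by omega, by omega,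
        by omega⟩
      rcases (show j = k + 1 ∨ k + 1 < j by omega) with rfl | h
      · have a1 : k + 1 ∉ i := fun h => by have := (h3.1 _ h).1; omega
        have a2 : k + 1 + 1 ∉ i := fun h => by have := (h3.1 _ h).1; omega
        simp [pairCoord, a1, a2, c0]
      · exact h4 j h j2
    -- With pending ones there is an ascent at `k + 2`, where the suffix sum is the number of
    -- pending ones. This number is less than `1 - f (k + 1) ≤ 2`, so it is 1 and `f (k + 1) = -1`:
    -- a pair closes and the run becomes empty.
    · have hs := h5 (k + 1 + 1) (by omega) (by omega)
      have ha := hasc (k + 1 + 1) (by omega) (by omega)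
      rw [show k + 1 + 1 - 1 = k + 1 by omega, hs, h7] at ha
      have ha := ha (by omega)
      have ht : t = k + 2 := by omega
      subst ht
      have hi : ∀ j ∈ i, k + 4 ≤ j := fun j hj => by have := (h3.1 j hj).1; omega
      refine ⟨k, (k + 2) :: i, le_rfl, by omega, ⟨?_, ?_⟩, fun j j1 j2 => ?_, by omega, by omega,
        by omega⟩
      · intro x hx
        rcases List.mem_cons.1 hx with rfl | hx
        · omega
        · have := h3.1 x hx; omega
      · exact List.pairwise_cons.2 ⟨fun j hj => by have := hi j hj; omega, h3.2⟩
      · have a1 : k + 1 ∉ i := fun h => by have := hi _ h; omega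
        have a2 : k + 2 ∉ i := fun h => by have := hi _ h; omega
        have a3 : k + 3 ∉ i := fun h => by have := hi _ h; omega
        rcases (show j = k + 1 ∨ j = k + 2 ∨ k + 2 < j by omega) with rfl | rfl | h
        · have : f (k + 1) = -1 := by omega
          simp only [pairCoord, List.mem_cons]
          grind
        · have : f (k + 2) = 1 := by rw [← hs]; congr 1; ring
          simp only [pairCoord, List.mem_cons]
          grind
        · rw [h4 j h j2]
          simp only [pairCoord, List.mem_cons]
          grind

/-- The scan settles everything from position 2 on; the nonnegativity conditions and the simple
reflections at the two end nodes `α_1`, `α_2` then bound the run of ones and the first coordinate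
together. -/
theorem exists_isStd (hn : 3 ≤ n) {x : Fin n → ℝ} (hx : IsTernary x) (h : SimpleMax n x) :
    ∃ t e i, IsStd n x t e i := by
  choose f hf hf1 hf2 using hx
  set F : ℤ → ℤ := fun k => ∑ j ∈ Finset.Icc k (n : ℤ), f j with hFdef
  have hS : ∀ k, suffixSum x k = F k := by
    intro k
    rw [hFdef, suffixSum]
    push_cast
    exact Finset.sum_congr rfl fun j _ => hf j
  have hF : ∀ k ≤ (n : ℤ), F k = f k + F (k + 1) := by
    intro k hk
    have := suffixSum_eq x hk
    rw [hS, hS, hf] at this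
    exact_mod_cast this
  have hF0 : F (n + 1) = 0 := by
    have := suffixSum_of_lt x (k := n + 1) (by omega)
    rw [hS] at this
    exact_mod_cast this
  obtain ⟨hn3, hn1, hn2⟩ := (nonnegWeight_iff_suffixSum (by omega)).1 h.1
  rw [hS, hf] at hn1 hn2
  norm_cast at hn1 hn2
  have hnn : ∀ k, 2 ≤ k → k ≤ (n : ℤ) → 0 ≤ F k := by
    intro k h1 h2
    rcases h1.eq_or_lt with rfl | h1
    · omega
    · have := hn3 k (by omega) h2
      rw [hS] at this
      exact_mod_cast this
  have hdot : ∀ k, 2 ≤ k → x ⬝ᵥ simpleRoot n k = ((f k - f (k - 1) : ℤ) : ℝ) := by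
    intro k hk
    rw [simpleRoot_eq, dot_root, hf, hf]
    unfold lo hi
    rw [if_neg (by omega), if_neg (by omega)]
    push_cast; rfl
  have hasc : ∀ k, 3 ≤ k → k ≤ (n : ℤ) → f (k - 1) < f k → F k < f k - f (k - 1) := by
    intro k h1 h2 hlt
    have := h.dot_lt (by omega) (by omega) h2 (by
      rw [hdot k (by omega)]; exact_mod_cast (by omega : 0 < f k - f (k - 1)))
    rw [hdot k (by omega), dot_fundWeight_of_three_le x h1, hS] at this
    exact_mod_cast this
  have hasc2 : f 1 < f 2 → F 2 - f 1 < 2 * (f 2 - f 1) := by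
    intro hlt
    have := h.dot_lt (i := 2) (by omega) (by omega) (by omega) (by
      rw [hdot 2 (by omega)]; exact_mod_cast sub_pos.2 hlt)
    have e := dot_fundWeight_two (by omega) x
    rw [hdot 2 (by omega)] at this
    rw [hS, hf] at e
    have : ((F 2 : ℝ) - f 1) < 2 * ((f 2 - f (2 - 1) : ℤ) : ℝ) := by linarith
    exact_mod_cast this
  have hasc1 : 0 < f 1 + f 2 → F 2 + f 1 < 2 * (f 1 + f 2) := by
    intro hlt
    have hd : x ⬝ᵥ simpleRoot n 1 = ((f 1 + f 2 : ℤ) : ℝ) := by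
      rw [simpleRoot_eq, dot_root, lo, hi, if_pos rfl, if_pos rfl, coord_neg_right, hf, hf]
      push_cast; ring
    have := h.dot_lt (i := 1) (by omega) (by omega) (by omega) (by
      rw [hd]; exact_mod_cast hlt)
    have e := dot_fundWeight_one (by omega) x
    rw [hd] at this
    rw [hS, hf] at e
    have : ((F 2 : ℝ) + f 1) < 2 * ((f 1 + f 2 : ℤ) : ℝ) := by linarith
    exact_mod_cast this
  obtain ⟨t, i, h1, h2, h3, h4, h5, h6, h7⟩ := scan (fun k => ⟨hf1 k, hf2 k⟩) hF hF0 hnn hasc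
    (n - 1) 1 (by omega) le_rfl
  norm_num at h7
  have b1 := hf1 1
  have b2 := hf2 1
  refine ⟨t, f 1, i, h3, h2, ?_, fun k k1 k2 => ?_⟩
  -- For `t = 1` the suffix sum at 2 is 0, so `S_2 ± x_1 ≥ 0` gives `x_1 = 0`. For `t ≥ 2` one has
  -- `f 2 = 1`, and the conditions at `α_1` and `α_2` read `t < 3 + f 1` if `f 1 > -1` and `t < 3 -
  -- f 1` if `f 1 < 1`, which excludes in particular `t = 3`, `f 1 = 0`.
  · rcases h1.eq_or_lt with rfl | hlt
    · left; omega
    · have := h5 2 (by omega) (by omega)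
      omega
  · rw [hf, stdCoord]
    split_ifs with e1 e2
    · rw [e1]
    · rw [h5 k (by omega) e2]
    · rw [h4 k (by omega) k2]

/-! ### Standard vectors cannot be lowered by any reflection -/

/-- Beyond the run each coordinate is a difference of consecutive values of the indicator of `i`, so
the suffix sums telescope to that indicator. -/
theorem IsStd.suffixSum_eq_of_lt {x : Fin n → ℝ} {t e : ℤ} {i : List ℤ} (h : IsStd n x t e i)
    {k : ℤ} (hk : t < k) : suffixSum x k = if k ∈ i then 1 else 0 := by
  have ht : 1 ≤ t := by rcases h.valid with h | h | h <;> omega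
  have hout : ∀ k : ℤ, n < k → suffixSum x k = if k ∈ i then 1 else 0 := by
    intro k hk
    rw [suffixSum_of_lt x hk, if_neg fun hm => ?_]
    have := (h.sparse.1 k hm).2
    omega
  by_cases hkn : n < k
  · exact hout k hkn
  obtain ⟨d, rfl⟩ : ∃ d : ℕ, k = n - d := ⟨(n - k).toNat, by omega⟩
  induction d with
  | zero =>
    rw [suffixSum_eq x (by omega), hout _ (by omega), h.coord_eq _ (by omega) (by omega), stdCoord,
      if_neg (by omega), if_neg (by omega), pairCoord]
    push_cast; ring
  | succ d ih =>
    rw [suffixSum_eq x (by omega), h.coord_eq _ (by omega) (by omega), stdCoord, if_neg (by omega),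
      if_neg (by omega), pairCoord]
    have e1 : (n : ℤ) - (d + 1 : ℕ) + 1 = n - d := by push_cast; ring
    rw [e1, ih (by omega) (by omega)]
    push_cast; ring

theorem IsStd.one_le {x : Fin n → ℝ} {t e : ℤ} {i : List ℤ} (h : IsStd n x t e i) : 1 ≤ t := by
  rcases h.valid with h | h | h <;> omega

theorem IsStd.suffixSum_eq_of_le {x : Fin n → ℝ} {t e : ℤ} {i : List ℤ} (h : IsStd n x t e i)
    {k : ℤ} (h2 : 2 ≤ k) (hk : k ≤ t + 1) : suffixSum x k = ((t + 1 - k : ℤ) : ℝ) := by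
  obtain ⟨d, rfl⟩ : ∃ d : ℕ, k = t + 1 - d := ⟨(t + 1 - k).toNat, by omega⟩
  induction d with
  | zero =>
    rw [h.suffixSum_eq_of_lt (by omega), if_neg fun hm => ?_]
    · simp
    · have := (h.sparse.1 _ hm).1
      push_cast at this
      omega
  | succ d ih =>
    have := h.le_n
    rw [suffixSum_eq x (by omega), h.coord_eq _ (by omega) (by omega), stdCoord, if_neg (by omega),
      if_pos (by omega)]
    have e1 : t + 1 - (d + 1 : ℕ) + 1 = t + 1 - d := by push_cast; ring
    rw [e1, ih (by omega) (by omega)]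
    push_cast; ring

/-- The suffix sums of `stdCoord`, from position `2` on. -/
def stdSum (t : ℤ) (i : List ℤ) (k : ℤ) : ℤ := if k ≤ t then t + 1 - k else if k ∈ i then 1 else 0

theorem IsStd.suffixSum_eq_stdSum {x : Fin n → ℝ} {t e : ℤ} {i : List ℤ} (h : IsStd n x t e i)
    {k : ℤ} (h2 : 2 ≤ k) : suffixSum x k = stdSum t i k := by
  unfold stdSum
  split_ifs with h1 h3
  · exact h.suffixSum_eq_of_le h2 (by omega)
  · rw [h.suffixSum_eq_of_lt (by omega), if_pos h3]; simp
  · rw [h.suffixSum_eq_of_lt (by omega), if_neg h3]; simp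

theorem IsStd.nonnegWeight (hn : 2 ≤ n) {x : Fin n → ℝ} {t e : ℤ} {i : List ℤ}
    (h : IsStd n x t e i) : NonnegWeight n x := by
  have hS : ∀ k : ℤ, 0 ≤ stdSum t i k := fun k => by unfold stdSum; split_ifs <;> omega
  have ht : t = 1 ∨ 2 ≤ t := by have := h.one_le; omega
  have h2 : |e| ≤ stdSum t i 2 := by
    unfold stdSum
    have := h.valid
    grind
  rw [abs_le] at h2
  rw [nonnegWeight_iff_suffixSum hn, h.suffixSum_eq_stdSum le_rfl,
    h.coord_eq 1 le_rfl (by omega), stdCoord, if_pos rfl]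
  refine ⟨fun k h1 _ => ?_, ?_, ?_⟩
  · rw [h.suffixSum_eq_stdSum (by omega)]; exact_mod_cast hS k
  · exact_mod_cast (by omega : 0 ≤ stdSum t i 2 + e)
  · exact_mod_cast (by omega : 0 ≤ stdSum t i 2 - e)

/-- The root is `e_b - s e_a`, and `c` is its pairing with the vector. The last three hypotheses say
that subtracting `c` times the root keeps the pairings with `ω_k` (`3 ≤ k ≤ b`), `2ω_1` and `2ω_2`
nonnegative. Past the run the suffix sums are 0 or 1, and they vanish just before the top of a pair,
which leaves no room for the subtraction; near the start the two spin inequalities prevent it. -/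
theorem stdCoord_no_move {N t e : ℤ} {i : List ℤ} (hsp : Sparse (t + 2) N i)
    (hv : (t = 1 ∧ e = 0) ∨ (t = 2 ∧ (e = -1 ∨ e = 0 ∨ e = 1)) ∨ (t = 3 ∧ (e = -1 ∨ e = 1)))
    {a b s c : ℤ} (h1 : 1 ≤ a) (hab : a < b) (hs : s = 1 ∨ s = -1)
    (hc : c = stdCoord t e i b - s * stdCoord t e i a) (hpos : 0 < c)
    (hsum : ∀ k, 3 ≤ k → k ≤ b → c * (1 - if k ≤ a then s else 0) ≤ stdSum t i k)
    (hone : c * (1 - s) ≤ stdSum t i 2 + e)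
    (htwo : c * (1 - if a = 1 then -s else s) ≤ stdSum t i 2 - e) : False := by
  have hge : ∀ k ∈ i, t + 2 ≤ k := fun k hk => (hsp.1 k hk).1
  have hb := hsum b
  rw [if_neg (by omega), sub_zero, mul_one] at hb
  -- Three regions: the root lies within the run; it involves `e_1` and `e_2` or `e_3` when the run
  -- is empty, where only the spin inequalities are available; or `b` lies beyond the run and suffix
  -- sums suffice.
  rcases (show b ≤ t ∨ (t = 1 ∧ a = 1 ∧ b ≤ 3) ∨ (t < b ∧ 3 ≤ b ∧ (3 < b ∨ a = 2 ∨ 2 ≤ t)) by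
    omega) with hbt | ⟨rfl, rfl, hb3⟩ | ⟨hbt, hb3, hb4⟩
  · have ht : t = 2 ∨ t = 3 := by omega
    have hS2 : stdSum t i 2 = t - 1 := by unfold stdSum; rw [if_pos (by omega)]; ring
    have hSb : stdSum t i b = t + 1 - b := by unfold stdSum; rw [if_pos hbt]
    have h3 : stdCoord t e i b = 1 := by
      unfold stdCoord; rw [if_neg (by omega), if_pos hbt]
    have h4 : stdCoord t e i a = if a = 1 then e else 1 := by
      unfold stdCoord
      split_ifs <;> first | rfl | omega
    rw [hSb] at hb
    rw [hS2] at hone htwo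
    rw [h3, h4] at hc
    rcases hs with rfl | rfl <;> split_ifs at hc htwo <;> omega
  · have hS2 : stdSum 1 i 2 = 0 := by
      unfold stdSum
      rw [if_neg (by omega), if_neg fun hm => by have := hge _ hm; omega]
    rw [hS2] at hone htwo
    rcases hs with rfl | rfl <;> simp at hone htwo <;> omega
  · have hSb : stdSum t i b = if b ∈ i then 1 else 0 := by unfold stdSum; rw [if_neg (by omega)]
    have hb := hb hb3 le_rfl
    rw [hSb] at hb
    have hbi : b ∈ i := by
      by_contra hm
      rw [if_neg hm] at hb
      omega
    have hb1 := hge b hbi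
    have hb2 : b - 1 ∉ i := fun hm => by
      have := hsp.not_mem_succ hm
      rw [sub_add_cancel] at this
      exact this hbi
    have hb3 := hsp.not_mem_succ hbi
    have h3 : stdCoord t e i b = 1 := by
      unfold stdCoord pairCoord
      rw [if_neg (by omega), if_neg (by omega), if_pos hbi, if_neg hb3]; rfl
    have h4 : stdCoord t e i (b - 1) = -1 := by
      unfold stdCoord pairCoord
      rw [if_neg (by omega), if_neg (by omega), if_neg hb2, sub_add_cancel, if_pos hbi]; rfl
    rw [if_pos hbi] at hb
    rw [h3] at hc
    -- At `a = b - 1` the pairing is 2 for `s = 1`, exceeding the suffix sum 1 at `b`, and 0 for `s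
    -- = -1`.
    have hab' : a ≠ b - 1 := by
      rintro rfl
      rw [h4] at hc
      rcases hs with rfl | rfl <;> omega
    -- Now `a < b - 1`, so the full amount `c` would be subtracted from the suffix sum at `b - 1`,
    -- which is 0.
    have h5 := hsum (b - 1) (by omega) (by omega)
    rw [if_neg (by omega), stdSum, if_neg (by omega), if_neg hb2] at h5
    omega

theorem IsStd.locMax (hn : 2 ≤ n) {x : Fin n → ℝ} {t e : ℤ} {i : List ℤ}
    (h : IsStd n x t e i) : LocMax n x := by
  refine ⟨h.nonnegWeight hn, fun a' b' hp hab hpos hnn => ?_⟩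
  obtain ⟨a, b, h1, h2, h3, hβ⟩ := mem_posRoots_iff.2 ⟨a', b', hp, hab, rfl⟩
  obtain ⟨s, hs, hβ⟩ : ∃ s : ℤ, (s = 1 ∨ s = -1) ∧ root n a' b' = vec n b - (s : ℝ) • vec n a := by
    rcases hβ with hβ | hβ
    · exact ⟨1, Or.inl rfl, by rw [hβ]; simp⟩
    · exact ⟨-1, Or.inr rfl, by rw [hβ]; simp⟩
  have hc : x ⬝ᵥ root n a' b' = ((stdCoord t e i b - s * stdCoord t e i a : ℤ) : ℝ) := by
    rw [hβ, dotProduct_sub, dotProduct_smul]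
    change coord x b - s * coord x a = _
    rw [h.coord_eq b (by omega) h3, h.coord_eq a h1 (by omega)]
    push_cast; rfl
  rw [hc] at hpos hnn
  set c := stdCoord t e i b - s * stdCoord t e i a with hcdef
  have hdot : ∀ k : ℤ, root n a' b' ⬝ᵥ fundWeight n k =
      coord (fundWeight n k) b - s * coord (fundWeight n k) a := by
    intro k
    rw [hβ, dotProduct_comm, dotProduct_sub, dotProduct_smul]; rfl
  have key : ∀ k : ℤ, 1 ≤ k → k ≤ n →
      c * (coord (fundWeight n k) b - s * coord (fundWeight n k) a) ≤ x ⬝ᵥ fundWeight n k := by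
    intro k k1 k2
    have := (nonnegWeight_iff_dot hn).1 hnn k k1 k2
    rw [sub_dotProduct, smul_dotProduct, hdot, smul_eq_mul] at this
    linarith
  have hx1 : coord x 1 = e := by rw [h.coord_eq 1 le_rfl (by omega), stdCoord, if_pos rfl]
  refine stdCoord_no_move h.sparse h.valid h1 h2 hs hcdef (by exact_mod_cast hpos) ?_ ?_ ?_
  · intro k k1 k2
    have := key k (by omega) (by omega)
    rw [dot_fundWeight_of_three_le x k1, h.suffixSum_eq_stdSum (by omega),
      coord_fundWeight _ (by omega) h3, coord_fundWeight _ h1 (by omega), if_neg (by omega),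
      if_neg (by omega), if_pos k2, if_neg (by omega), if_neg (by omega)] at this
    have : (c : ℝ) * (1 - if k ≤ a then (s : ℝ) else 0) ≤ stdSum t i k := by
      refine le_trans (le_of_eq ?_) this
      split_ifs <;> ring
    exact_mod_cast this
  · have := key 1 le_rfl (by omega)
    have e1 := dot_fundWeight_one hn x
    rw [h.suffixSum_eq_stdSum le_rfl, hx1] at e1
    rw [coord_fundWeight _ (by omega) h3, coord_fundWeight _ h1 (by omega), if_pos rfl,
      if_pos rfl] at this
    have : (c : ℝ) * (1 - s) ≤ stdSum t i 2 + e := by linarith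
    exact_mod_cast this
  · have := key 2 (by omega) (by omega)
    have e1 := dot_fundWeight_two hn x
    rw [h.suffixSum_eq_stdSum le_rfl, hx1] at e1
    rw [coord_fundWeight _ (by omega) h3, coord_fundWeight _ h1 (by omega), if_neg (by omega),
      if_pos rfl, if_neg (by omega), if_neg (by omega), if_pos rfl] at this
    have : (c : ℝ) * (1 - if a = 1 then -(s : ℝ) else s) ≤ stdSum t i 2 - e := by
      split_ifs at this ⊢ <;> linarith
    exact_mod_cast this

/-! ### Norms of standard vectors -/

theorem sum_indicator_mem {s : ℤ} {N : ℤ} {i : List ℤ} (hnd : i.Nodup)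
    (h : ∀ x ∈ i, s ≤ x ∧ x ≤ N) :
    ∑ k ∈ Finset.Icc s N, (if k ∈ i then (1 : ℤ) else 0) = i.length := by
  have e : ∀ k, (k ∈ i) = (k ∈ i.toFinset) := fun k => by simp
  simp only [e]
  rw [Finset.sum_ite_mem, Finset.inter_eq_right.2 fun x hx => ?_]
  · simp [List.toFinset_card_of_nodup hnd]
  · exact Finset.mem_Icc.2 (h x (List.mem_toFinset.1 hx))

theorem mem_primed {i : List ℤ} {k : ℤ} : k ∈ primed i ↔ k + 1 ∈ i := by
  simp only [primed, List.mem_map]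
  constructor
  · rintro ⟨x, hx, rfl⟩; simpa using hx
  · exact fun h => ⟨_, h, by simp⟩

/-- Positions `2, …, t` contribute 1 each, the first contributes `e ^ 2`, and each pair contributes
2. As `W` preserves norms, this count ties the shape `(t, e, i)` to `r`. -/
theorem sum_sq_stdCoord {t e : ℤ} {i : List ℤ} (ht : 1 ≤ t) (htn : t ≤ n)
    (hsp : Sparse (t + 2) n i) :
    ∑ k ∈ Finset.Icc (1 : ℤ) n, stdCoord t e i k ^ 2 = (t - 1) + e ^ 2 + 2 * i.length := by
  have hge : ∀ k ∈ i, t + 2 ≤ k := fun k hk => (hsp.1 k hk).1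
  have hterm : ∀ k ∈ Finset.Icc (1 : ℤ) n, stdCoord t e i k ^ 2 =
      (if k = 1 then e ^ 2 else 0) + (if k ∈ Finset.Icc 2 t then 1 else 0) +
        ((if k ∈ i then 1 else 0) + (if k ∈ primed i then 1 else 0)) := by
    intro k hk
    rw [Finset.mem_Icc] at hk
    have h1 := fun hm : k ∈ i => hsp.not_mem_succ hm
    have h2 := hge k
    have h3 := hge (k + 1)
    simp only [stdCoord, pairCoord, mem_primed, Finset.mem_Icc]
    by_cases a1 : k = 1
    · have b1 : k ∉ i := fun h => by have := h2 h; omega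
      have b2 : k + 1 ∉ i := fun h => by have := h3 h; omega
      rw [if_pos a1, if_pos a1, if_neg (by omega), if_neg b1, if_neg b2]; ring
    by_cases a2 : k ≤ t
    · have b1 : k ∉ i := fun h => by have := h2 h; omega
      have b2 : k + 1 ∉ i := fun h => by have := h3 h; omega
      rw [if_neg a1, if_neg a1, if_pos a2, if_pos (by omega), if_neg b1, if_neg b2]; ring
    · rw [if_neg a1, if_neg a1, if_neg a2, if_neg (show ¬(2 ≤ k ∧ k ≤ t) by omega)]
      split_ifs <;> first | rfl | (exact absurd ‹_› (h1 ‹_›))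
  rw [Finset.sum_congr rfl hterm, Finset.sum_add_distrib, Finset.sum_add_distrib,
    Finset.sum_add_distrib, sum_indicator_mem hsp.nodup fun x hx => ⟨by have := hge x hx; omega,
      (hsp.1 x hx).2⟩, sum_indicator_mem (i := primed i) (hsp.nodup.map fun a b h => by simpa using h)
      fun x hx => ?_, Finset.sum_ite_mem, Finset.inter_eq_right.2 (Finset.Icc_subset_Icc (by omega) htn),
      Finset.sum_ite_eq', if_pos (Finset.mem_Icc.2 ⟨le_rfl, by omega⟩)]
  · simp only [Finset.sum_const, Int.card_Icc, primed, List.length_map]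
    simp
    omega
  · rw [mem_primed] at hx
    have := hge _ hx
    have := (hsp.1 _ hx).2
    omega

theorem IsStd.dot_self {x : Fin n → ℝ} {t e : ℤ} {i : List ℤ} (h : IsStd n x t e i) :
    x ⬝ᵥ x = ((t - 1 + e ^ 2 + 2 * i.length : ℤ) : ℝ) := by
  rw [← sum_sq_stdCoord h.one_le h.le_n h.sparse, dot_eq_sum]
  push_cast
  refine Finset.sum_congr rfl fun k hk => ?_
  rw [Finset.mem_Icc] at hk
  rw [h.coord_eq k hk.1 hk.2, sq]

theorem stdCoord_bounds {t e : ℤ} {i : List ℤ} (he : -1 ≤ e ∧ e ≤ 1) (k : ℤ) :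
    -1 ≤ stdCoord t e i k ∧ stdCoord t e i k ≤ 1 := by
  unfold stdCoord pairCoord
  split_ifs <;> omega

theorem isTernary_of {x : Fin n → ℝ}
    (h : ∀ k : ℤ, 1 ≤ k → k ≤ n → ∃ c : ℤ, coord x k = c ∧ -1 ≤ c ∧ c ≤ 1) : IsTernary x := by
  intro k
  by_cases hk : Idx n k
  · obtain ⟨h0, h1, h2⟩ := hk
    rcases lt_or_gt_of_ne h0 with hneg | hpos
    · obtain ⟨c, hc, c1, c2⟩ := h (-k) (by omega) (by omega)
      refine ⟨-c, ?_, by omega, by omega⟩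
      rw [coord_neg_right] at hc
      push_cast; linarith
    · exact h k (by omega) h2
  · exact ⟨0, by rw [coord_eq_zero x hk]; simp, by omega, by omega⟩

theorem IsStd.isTernary {x : Fin n → ℝ} {t e : ℤ} {i : List ℤ} (h : IsStd n x t e i) :
    IsTernary x :=
  isTernary_of fun k h1 h2 => ⟨_, h.coord_eq k h1 h2,
    stdCoord_bounds (by have := h.valid; omega) k⟩

theorem IsTernary.act (hn : 2 ≤ n) {x : Fin n → ℝ} (hx : IsTernary x) {w : Perm ℤ}
    (hw : w ∈ weylGroup n) : IsTernary (act n w x) := fun k => by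
  rw [coord_act hn hw]; exact hx _

theorem finite_isTernary : {x : Fin n → ℝ | IsTernary x}.Finite := by
  refine (Set.Finite.pi' (t := fun _ : Fin n => ({-1, 0, 1} : Set ℝ)) fun _ => by simp).subset ?_
  intro x hx j
  obtain ⟨c, hc, c1, c2⟩ := hx ((j : ℤ) + 1)
  rw [coord_fin] at hc
  rw [hc]
  rcases (show c = -1 ∨ c = 0 ∨ c = 1 by omega) with rfl | rfl | rfl <;> simp

/-! ### Ternary vectors as weights: reduction to dominant ones -/

/-- A ternary vector is conjugate to a dominant one. -/
theorem IsTernary.exists_dominant (hn : 2 ≤ n) {x : Fin n → ℝ} (hx : IsTernary x) :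
    ∃ w ∈ weylGroup n, ∀ i : ℤ, 1 ≤ i → i ≤ n → 0 ≤ TypeD.act n w x ⬝ᵥ simpleRoot n i := by
  set ρ : Fin n → ℝ := ∑ k ∈ Finset.Icc (1 : ℤ) n, fundWeight n k with hρ
  have hρi : ∀ i : ℤ, 1 ≤ i → i ≤ n → simpleRoot n i ⬝ᵥ ρ = 1 := by
    intro i h1 h2
    rw [hρ, dotProduct_sum, Finset.sum_eq_single i]
    · rw [dotProduct_comm, fundWeight_dot_simpleRoot hn h1 h1 h2, if_pos rfl]
    · intro k hk hki
      rw [Finset.mem_Icc] at hk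
      rw [dotProduct_comm, fundWeight_dot_simpleRoot hn hk.1 h1 h2, if_neg hki]
    · intro h; exact absurd (Finset.mem_Icc.2 ⟨h1, h2⟩) h
  set O : Set (Fin n → ℝ) := {y | ∃ w ∈ weylGroup n, TypeD.act n w x = y} with hO
  have hfin : O.Finite := finite_isTernary.subset (by
    rintro _ ⟨w, hw, rfl⟩; exact hx.act hn hw)
  -- The orbit is finite, so some member maximises the pairing with `ρ`, the sum of the fundamental
  -- weights. If `α_i` paired negatively with it, then `s_i` would increase this pairing, since
  -- `(α_i, ρ) = 1`.
  obtain ⟨y, ⟨w, hw, rfl⟩, hy⟩ := hfin.exists_maximalFor (fun y => y ⬝ᵥ ρ) O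
    ⟨x, 1, one_mem _, act_one hn x⟩
  refine ⟨w, hw, fun i h1 h2 => ?_⟩
  by_contra hc
  push Not at hc
  have hs := simpleRefl_mem (n := n) h1 h2
  have hm : TypeD.act n w x - (TypeD.act n w x ⬝ᵥ simpleRoot n i) • simpleRoot n i ∈ O :=
    ⟨simpleRefl i * w, mul_mem hs hw, by rw [act_mul hn hs hw, act_simpleRefl hn h1 h2]⟩
  have := hy hm
  simp only [sub_dotProduct, smul_dotProduct, hρi i h1 h2, smul_eq_mul] at this
  have := this (by linarith)
  linarith

/-- A product of values of an odd function over `1, …, n` is invariant under `W`. -/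
theorem prod_odd_weyl {R : Type*} [CommRing R] (hn : 2 ≤ n) {w : Perm ℤ} (hw : w ∈ weylGroup n)
    (f : ℤ → R) (hf : ∀ k, f (-k) = -f k) :
    ∏ k ∈ Finset.Icc (1 : ℤ) n, f (w k) = ∏ k ∈ Finset.Icc (1 : ℤ) n, f k := by
  revert f
  refine weyl_induction (fun w => ∀ f : ℤ → R, (∀ k, f (-k) = -f k) →
    ∏ k ∈ Finset.Icc (1 : ℤ) n, f (w k) = ∏ k ∈ Finset.Icc (1 : ℤ) n, f k) (by simp) ?_ hw
  intro i w h1 h2 _ ih f hf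
  simp only [Perm.mul_apply]
  rw [ih (fun k => f (simpleRefl i k)) fun k => by rw [simpleRefl_neg h1, hf]]
  by_cases hi : i = 1
  · subst hi
    rw [← Finset.insert_Icc_add_one_left_eq_Icc (show (1 : ℤ) ≤ n by omega),
      ← Finset.insert_Icc_add_one_left_eq_Icc (show (1 : ℤ) + 1 ≤ n by omega),
      Finset.prod_insert (by simp), Finset.prod_insert (by simp), Finset.prod_insert (by simp),
      Finset.prod_insert (by simp)]
    have e1 : simpleRefl 1 1 = -2 := by simp [simpleRefl, swap_apply_def]
    have e2 : simpleRefl 1 (1 + 1) = -1 := by norm_num [simpleRefl, swap_apply_def]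
    rw [e1, e2, hf, hf, Finset.prod_congr rfl fun k hk => ?_]
    · norm_num; ring
    · rw [Finset.mem_Icc] at hk
      congr 1
      simp only [simpleRefl, if_pos, Perm.mul_apply, swap_apply_def]
      grind
  · have hmem : ∀ k ∈ Finset.Icc (1 : ℤ) n, simpleRefl i k ∈ Finset.Icc (1 : ℤ) n := by
      intro k hk
      rw [Finset.mem_Icc] at hk ⊢
      simp only [simpleRefl, if_neg hi, Perm.mul_apply, swap_apply_def]
      grind
    have hinv : ∀ k, simpleRefl i (simpleRefl i k) = k := fun k => by
      rw [← Perm.mul_apply, simpleRefl_mul_self h1, Perm.one_apply]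
    exact Finset.prod_nbij' (simpleRefl i) (simpleRefl i) hmem hmem (fun k _ => hinv k)
      (fun k _ => hinv k) fun k _ => rfl

theorem IsTernary.dominant_coords (hn : 2 ≤ n) {x : Fin n → ℝ} (hx : IsTernary x)
    (hd : ∀ i : ℤ, 1 ≤ i → i ≤ n → 0 ≤ x ⬝ᵥ simpleRoot n i) :
    ∃ f : ℤ → ℤ, (∀ k, coord x k = f k) ∧ (∀ k, -1 ≤ f k ∧ f k ≤ 1) ∧ 0 ≤ f 1 + f 2 ∧
      ∀ k l : ℤ, 1 ≤ k → k ≤ l → l ≤ n → f k ≤ f l := by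
  choose f hf hf1 hf2 using hx
  refine ⟨f, hf, fun k => ⟨hf1 k, hf2 k⟩, ?_, ?_⟩
  · have := hd 1 le_rfl (by omega)
    rw [simpleRoot_eq, dot_root, lo, hi, if_pos rfl, if_pos rfl, coord_neg_right, hf, hf] at this
    have : (0 : ℝ) ≤ f 1 + f 2 := by linarith
    exact_mod_cast this
  · intro k l hk hkl
    induction l, hkl using Int.leInduction with
    | base => intro _; rfl
    | succ l hl ih =>
      intro hln
      have := hd (l + 1) (by omega) hln
      rw [simpleRoot_eq, dot_root, lo, hi, if_neg (by omega), if_neg (by omega), hf, hf,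
        add_sub_cancel_right] at this
      have : (f l : ℝ) ≤ f (l + 1) := by linarith
      exact (ih (by omega)).trans (by exact_mod_cast this)

/-- Dominance makes the coordinates weakly increasing with `f 1 + f 2 ≥ 0`. The norm allows only `n
+ 1 - r ≤ n - 2` nonzero coordinates, which forces `f 2 ≤ 0`, hence `f 1 = f 2 = 0`: the vector
consists of zeros followed by ones. -/
theorem eq_fundWeight_of_dominant (hn : 2 ≤ n) {x : Fin n → ℝ} (hx : IsTernary x)
    (hd : ∀ i : ℤ, 1 ≤ i → i ≤ n → 0 ≤ x ⬝ᵥ simpleRoot n i) {r : ℤ} (hr : 3 ≤ r) (hrn : r ≤ n)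
    (hdot : x ⬝ᵥ x = ((n + 1 - r : ℤ) : ℝ)) : x = fundWeight n r := by
  obtain ⟨f, hf, hf1, hf2, hf3⟩ := hx.dominant_coords hn hd
  have hsum : ∑ k ∈ Finset.Icc (1 : ℤ) n, f k ^ 2 = n + 1 - r := by
    rw [dot_eq_sum] at hdot
    simp only [hf, ← sq] at hdot
    exact_mod_cast hdot
  have hcard : ((Finset.Icc (1 : ℤ) n).filter fun k => f k ≠ 0).card = (n + 1 - r).toNat := by
    have : ((((Finset.Icc (1 : ℤ) n).filter fun k => f k ≠ 0).card : ℕ) : ℤ) = n + 1 - r := by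
      rw [← hsum, Finset.card_filter]
      push_cast
      refine Finset.sum_congr rfl fun k _ => ?_
      have := hf1 k
      rcases (show f k = -1 ∨ f k = 0 ∨ f k = 1 by omega) with h | h | h <;> simp [h]
    omega
  -- If all coordinates from `a` on are nonzero, there are `n + 1 - a` of them, which cannot exceed
  -- `n + 1 - r`.
  have hsub : ∀ (a : ℤ), 1 ≤ a → (∀ k, a ≤ k → k ≤ n → f k ≠ 0) → r ≤ a := by
    intro a ha h
    have : Finset.Icc a (n : ℤ) ⊆ (Finset.Icc (1 : ℤ) n).filter fun k => f k ≠ 0 := by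
      intro k hk
      rw [Finset.mem_Icc] at hk
      exact Finset.mem_filter.2 ⟨Finset.mem_Icc.2 ⟨by omega, hk.2⟩, h k hk.1 hk.2⟩
    have := Finset.card_le_card this
    rw [hcard, Int.card_Icc] at this
    omega
  have h2 : f 2 ≤ 0 := by
    by_contra hc
    have := hsub 2 (by omega) fun k h1 h2 h0 => by
      have := hf3 2 k (by omega) h1 h2
      omega
    omega
  have h12 := hf3 1 2 le_rfl (by omega) (by omega)
  have hnn : ∀ k : ℤ, 1 ≤ k → k ≤ n → 0 ≤ f k := fun k h1 h2 => by
    have := hf3 1 k le_rfl h1 h2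
    omega
  have hset : (Finset.Icc (1 : ℤ) n).filter (fun k => f k ≠ 0) = Finset.Icc r n := by
    refine Finset.eq_of_subset_of_card_le (fun a ha => ?_) ?_
    · obtain ⟨ha, hne⟩ := Finset.mem_filter.1 ha
      rw [Finset.mem_Icc] at ha ⊢
      refine ⟨hsub a ha.1 fun k h1 h2 h0 => ?_, ha.2⟩
      have e1 := hf3 a k ha.1 h1 h2
      have e2 := hnn a ha.1 ha.2
      omega
    · rw [hcard, Int.card_Icc]
  refine coord_ext fun k h1 h2 => ?_
  rw [hf, coord_fundWeight _ h1 h2, if_neg (by omega), if_neg (by omega)]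
  have := Finset.ext_iff.1 hset k
  simp only [Finset.mem_filter, Finset.mem_Icc] at this
  have e1 := hf1 k
  have e2 := hnn k h1 h2
  split_ifs with hrk
  · have : f k = 1 := by have := this.2 ⟨hrk, h2⟩; omega
    rw [this]; simp
  · have : f k = 0 := by
      by_contra h0
      exact hrk (this.1 ⟨⟨h1, h2⟩, h0⟩).1
    rw [this]; simp

theorem coord_two_fundWeight_one {k : ℤ} (h1 : 1 ≤ k) (h2 : k ≤ n) :
    coord ((2 : ℝ) • fundWeight n 1) k = 1 := by
  rw [coord_smul, coord_fundWeight _ h1 h2, if_pos rfl]; norm_num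

theorem coord_two_fundWeight_two {k : ℤ} (h1 : 1 ≤ k) (h2 : k ≤ n) :
    coord ((2 : ℝ) • fundWeight n 2) k = if k = 1 then -1 else 1 := by
  rw [coord_smul, coord_fundWeight _ h1 h2, if_neg (by norm_num), if_pos rfl]
  split_ifs <;> norm_num

theorem eq_two_fundWeight_of_dominant (hn : 2 ≤ n) {x : Fin n → ℝ} (hx : IsTernary x)
    (hd : ∀ i : ℤ, 1 ≤ i → i ≤ n → 0 ≤ x ⬝ᵥ simpleRoot n i)
    (hne : ∀ k : ℤ, 1 ≤ k → k ≤ n → coord x k ≠ 0) :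
    x = (2 : ℝ) • fundWeight n 1 ∨ x = (2 : ℝ) • fundWeight n 2 := by
  obtain ⟨f, hf, hf1, hf2, hf3⟩ := hx.dominant_coords hn hd
  have hne' : ∀ k : ℤ, 1 ≤ k → k ≤ n → f k ≠ 0 := fun k h1 h2 h0 => by
    have := hne k h1 h2
    rw [hf, h0] at this
    simp at this
  have e1 := hne' 1 le_rfl (by omega)
  have e2 := hne' 2 (by omega) (by omega)
  have e3 := hf1 1
  have e4 := hf1 2
  have e5 := hf3 1 2 le_rfl (by omega) (by omega)
  have hk : ∀ k : ℤ, 2 ≤ k → k ≤ n → f k = 1 := fun k h1 h2 => by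
    have := hf3 2 k (by omega) h1 h2
    have := hf1 k
    omega
  rcases (show f 1 = 1 ∨ f 1 = -1 by omega) with h | h
  · left
    refine coord_ext fun k h1 h2 => ?_
    rw [coord_two_fundWeight_one h1 h2, hf]
    rcases h1.eq_or_lt with rfl | h1
    · rw [h]; simp
    · rw [hk k (by omega) h2]; simp
  · right
    refine coord_ext fun k h1 h2 => ?_
    rw [coord_two_fundWeight_two h1 h2, hf]
    rcases h1.eq_or_lt with rfl | h1
    · rw [h]; simp
    · rw [hk k (by omega) h2, if_neg (by omega)]; simp

theorem IsTernary.exists_minReps (hn : 2 ≤ n) {x : Fin n → ℝ} (hx : IsTernary x) {r : ℤ}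
    (hr : 3 ≤ r) (hrn : r ≤ n) (hdot : x ⬝ᵥ x = ((n + 1 - r : ℤ) : ℝ)) :
    ∃ v ∈ minReps n r, TypeD.act n v (fundWeight n r) = x := by
  obtain ⟨w, hw, hd⟩ := hx.exists_dominant hn
  have e := eq_fundWeight_of_dominant hn (hx.act hn hw) hd hr hrn (by rw [act_dot_act hn hw, hdot])
  obtain ⟨v, hv, hve⟩ := TypeD.exists_minReps hn (r := r) (by omega) (inv_mem hw)
  exact ⟨v, hv, by rw [hve, ← e, act_inv_act hn hw]⟩

/-- A vector with all coordinates `±1` lies in the orbit of `2ω_1` or of `2ω_2`; the parity of its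
minus signs decides later which one. -/
theorem IsTernary.exists_minReps_spin (hn : 2 ≤ n) {x : Fin n → ℝ} (hx : IsTernary x)
    (hne : ∀ k : ℤ, 1 ≤ k → k ≤ n → coord x k ≠ 0) :
    (∃ v ∈ minReps n 1, TypeD.act n v ((2 : ℝ) • fundWeight n 1) = x) ∨
      ∃ v ∈ minReps n 2, TypeD.act n v ((2 : ℝ) • fundWeight n 2) = x := by
  obtain ⟨w, hw, hd⟩ := hx.exists_dominant hn
  have hne' : ∀ k : ℤ, 1 ≤ k → k ≤ n → coord (TypeD.act n w x) k ≠ 0 := fun k h1 h2 h0 => by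
    rw [coord_act hn hw] at h0
    obtain ⟨k0, k1, k2⟩ := weyl_idx hn (inv_mem hw) (k := k) ⟨by omega, by omega, h2⟩
    rcases lt_or_gt_of_ne k0 with hneg | hpos
    · refine hne (-w⁻¹ k) (by omega) (by omega) ?_
      rw [coord_neg_right, h0, neg_zero]
    · exact hne _ hpos k2 h0
  have key : ∀ r : ℤ, 1 ≤ r → TypeD.act n w x = (2 : ℝ) • fundWeight n r →
      ∃ v ∈ minReps n r, TypeD.act n v ((2 : ℝ) • fundWeight n r) = x := by
    intro r hr e
    obtain ⟨v, hv, hve⟩ := TypeD.exists_minReps hn hr (inv_mem hw)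
    refine ⟨v, hv, ?_⟩
    rw [act_smul, hve, ← act_smul, ← e, act_inv_act hn hw]
  exact (eq_two_fundWeight_of_dominant hn (hx.act hn hw) hd hne').imp (key 1 le_rfl)
    (key 2 (by norm_num))

/-! ### From weights to one-line notation -/

theorem eq_of_pairwise_lt {l₁ l₂ : List ℤ} (h₁ : l₁.Pairwise (· < ·)) (h₂ : l₂.Pairwise (· < ·))
    (h : ∀ x, x ∈ l₁ ↔ x ∈ l₂) : l₁ = l₂ :=
  List.Perm.eq_of_pairwise (le := fun a b : ℤ => a < b) (fun a b _ _ h1 h2 => by omega) h₁ h₂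
    ((List.perm_ext_iff_of_nodup (h₁.imp fun h => h.ne) (h₂.imp fun h => h.ne)).2 h)

theorem mem_up {S : Finset ℤ} {x : ℤ} : x ∈ up S ↔ x ∈ S := by simp [up]

theorem pairwise_up (S : Finset ℤ) : (up S).Pairwise (· < ·) := by
  have h := S.sortedLT_sort
  exact h.pairwise

theorem least_eq {S : Finset ℤ} {a : ℤ} (ha : a ∈ S) (h : ∀ b ∈ S, a ≤ b) : least S = a := by
  have : S.min = a := le_antisymm (Finset.min_le ha) (Finset.le_min fun b hb => by exact_mod_cast h b hb)
  rw [least, this]; rfl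

theorem up_eq_cons {S : Finset ℤ} {a : ℤ} (ha : a ∈ S) (h : ∀ b ∈ S, a ≤ b) :
    up S = a :: up (S.erase a) := by
  refine eq_of_pairwise_lt (pairwise_up S) (List.pairwise_cons.2 ⟨fun b hb => ?_, pairwise_up _⟩) ?_
  · rw [mem_up, Finset.mem_erase] at hb
    exact lt_of_le_of_ne (h b hb.2) hb.1.symm
  · intro x
    rw [mem_up, List.mem_cons, mem_up, Finset.mem_erase]
    by_cases hx : x = a <;> simp [hx, ha]

theorem upNeg_eq_cons {S : Finset ℤ} {a : ℤ} (ha : a ∈ S) (h : ∀ b ∈ S, a ≤ b) :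
    upNeg S = -a :: up (S.erase a) := by
  rw [upNeg, least_eq ha h]

theorem perm_apply_inv (v : Perm ℤ) (x : ℤ) : v (v⁻¹ x) = x := by simp

theorem perm_inv_apply (v : Perm ℤ) (x : ℤ) : v⁻¹ (v x) = x := by simp

theorem oneLine_eq (v : Perm ℤ) :
    oneLine n v = (List.range n).map fun k : ℕ => v ((k : ℤ) + 1) := by
  simp [oneLine, List.map_eq_flatMap, List.flatMap_assoc]

theorem oneLine_append (v : Perm ℤ) {a b : ℕ} (h : n = a + b) :
    oneLine n v = (List.range a).map (fun k : ℕ => v ((k : ℤ) + 1)) ++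
      (List.range b).map (fun k : ℕ => v ((k : ℤ) + 1 + a)) := by
  subst h
  rw [oneLine_eq, List.range_add, List.map_append, List.map_map]
  congr 1
  refine List.map_congr_left fun k _ => ?_
  simp only [Function.comp_apply]
  congr 1
  push_cast; ring

theorem pairwise_map_range {g : ℕ → ℤ} {m : ℕ} (h : ∀ k, k + 1 < m → g k < g (k + 1)) :
    ((List.range m).map g).Pairwise (· < ·) := by
  rw [List.pairwise_map, List.pairwise_iff_getElem]
  intro i j hi hj hij
  rw [List.length_range] at hi hj
  rw [List.getElem_range, List.getElem_range]
  induction j, hij using Nat.le_induction with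
  | base => exact h i (by omega)
  | succ j hj' ih => exact (ih (by omega) (by omega)).trans (h j (by omega))

/-- This is the evenness of the number of negative entries, from the invariance of products of odd
functions applied to the sign. -/
theorem prod_sign_oneLine (hn : 2 ≤ n) {v : Perm ℤ} (hv : v ∈ weylGroup n) :
    ((oneLine n v).map Int.sign).prod = 1 := by
  have h1 : ∏ k ∈ Finset.Icc (1 : ℤ) n, (v k).sign = 1 := by
    rw [prod_odd_weyl hn hv Int.sign Int.sign_neg]
    refine Finset.prod_eq_one fun k hk => ?_
    rw [Finset.mem_Icc] at hk
    exact Int.sign_eq_one_of_pos (by omega)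
  rw [← h1, oneLine_eq, List.map_map]
  have h2 : ∏ j ∈ Finset.range n, (v ((j : ℤ) + 1)).sign = ∏ k ∈ Finset.Icc (1 : ℤ) n, (v k).sign := by
    refine Finset.prod_bij (fun j _ => (j : ℤ) + 1) ?_ ?_ ?_ ?_
    · intro j hj
      rw [Finset.mem_range] at hj
      rw [Finset.mem_Icc]; omega
    · intro a _ b _ h; simpa using h
    · intro k hk
      rw [Finset.mem_Icc] at hk
      exact ⟨(k - 1).toNat, Finset.mem_range.2 (by omega), by omega⟩
    · intro j _; rfl
  rw [← h2]
  rfl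

theorem prod_sign_eq {l : List ℤ} (h : ∀ x ∈ l, x ≠ 0) :
    (l.map Int.sign).prod = (-1) ^ l.countP (· < 0) := by
  induction l with
  | nil => rfl
  | cons a l ih =>
    rw [List.map_cons, List.prod_cons, ih fun x hx => h x (by simp [hx]), List.countP_cons]
    have := h a (by simp)
    rcases lt_or_gt_of_ne this with h | h
    · simp [Int.sign_eq_neg_one_of_neg h, h, pow_succ]
    · simp [Int.sign_eq_one_of_pos h, not_lt.2 h.le]

theorem coord_act_apply (hn : 2 ≤ n) {w : Perm ℤ} (hw : w ∈ weylGroup n) (x : Fin n → ℝ) (k : ℤ) :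
    coord (act n w x) (w k) = coord x k := by
  rw [coord_act hn hw]; simp

theorem minReps_lt (hn : 2 ≤ n) {r : ℤ} {v : Perm ℤ} (hv : v ∈ minReps n r) {k : ℤ} (h1 : 1 ≤ k)
    (h2 : k + 1 ≤ n) (hk : k + 1 ≠ r) : v k < v (k + 1) := by
  have := ((mem_minReps_iff hn).1 hv).2 (k + 1) (by omega) h2 hk
  rw [lo, hi, if_neg (by omega), if_neg (by omega)] at this
  simpa using this

theorem minReps_neg_lt (hn : 2 ≤ n) {r : ℤ} {v : Perm ℤ} (hv : v ∈ minReps n r) (hr : r ≠ 1) :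
    -v 1 < v 2 := by
  have := ((mem_minReps_iff hn).1 hv).2 1 le_rfl (by omega) hr.symm
  rw [lo, hi, if_pos rfl, if_pos rfl, weyl_neg hv.1] at this
  omega

theorem coord_fundWeight_eq_one_iff {r : ℤ} (hr : 3 ≤ r) (k : ℤ) :
    coord (fundWeight n r) k = 1 ↔ r ≤ k ∧ k ≤ n := by
  by_cases hk : Idx n k
  · obtain ⟨h0, h1, h2⟩ := hk
    rcases lt_or_gt_of_ne h0 with h | h
    · have : coord (fundWeight n r) k = -coord (fundWeight n r) (-k) := by
        rw [coord_neg_right, neg_neg]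
      rw [this, coord_fundWeight _ (by omega) (by omega), if_neg (by omega), if_neg (by omega)]
      constructor
      · intro h; split_ifs at h <;> norm_num at h
      · omega
    · rw [coord_fundWeight _ (by omega) h2, if_neg (by omega), if_neg (by omega)]
      split_ifs with hrk
      · simp [hrk, h2]
      · simp [hrk]
  · rw [coord_eq_zero _ hk]
    unfold Idx at hk
    constructor
    · intro h; norm_num at h
    · omega

/-- Since `ω_r` is the indicator of `[r, n]`, the last entries of `v` enumerate increasingly the
signed indices where the weight is 1. The earlier entries satisfy `|v 1| < v 2 < ⋯` and exhaust the
zeros of the weight, so only the sign of `v 1` is open, and parity fixes it. -/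
theorem oneLine_of_three_le (hn : 2 ≤ n) {r : ℤ} (hr : 3 ≤ r) (hrn : r ≤ n) {v : Perm ℤ}
    (hv : v ∈ minReps n r) {T : List ℤ} (hT : T.Pairwise (· < ·))
    (hmem : ∀ j, j ∈ T ↔ coord (act n v (fundWeight n r)) j = 1) {C : Finset ℤ}
    (hC : ∀ j : ℤ, j ∈ C ↔ 1 ≤ j ∧ j ≤ n ∧ coord (act n v (fundWeight n r)) j = 0) :
    oneLine n v = (if Even (T.countP (· < 0)) then up C else upNeg C) ++ T := by
  have hlow : ∀ k, 1 ≤ k → k < r → coord (fundWeight n r) k = 0 := fun k h1 h2 => by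
    rw [coord_fundWeight _ h1 (by omega), if_neg (by omega), if_neg (by omega), if_neg (by omega)]
  -- With `r = b + 3` the block before position `r` has `b + 2 ≥ 2` entries, so that `v 2` belongs
  -- to it and bounds `|v 1|`.
  obtain ⟨b, rfl⟩ : ∃ b : ℕ, r = b + 3 := ⟨(r - 3).toNat, by omega⟩
  obtain ⟨m, rfl⟩ : ∃ m : ℕ, n = (b + 2) + m := ⟨n - (b + 2), by omega⟩
  have hsplit := oneLine_append v (n := b + 2 + m) (a := b + 2) (b := m) rfl
  have hTeq : (List.range m).map (fun k : ℕ => v ((k : ℤ) + 1 + ((b + 2 : ℕ) : ℤ))) = T := by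
    refine eq_of_pairwise_lt (pairwise_map_range fun k hk => ?_) hT fun x => ?_
    · have := minReps_lt hn hv (k := (k : ℤ) + 1 + ((b + 2 : ℕ) : ℤ)) (by omega)
        (by push_cast; omega) (by push_cast; omega)
      convert this using 2
      push_cast; ring
    · rw [hmem, coord_act hn hv.1, coord_fundWeight_eq_one_iff hr, List.mem_map]
      constructor
      · rintro ⟨k, hk, rfl⟩
        rw [List.mem_range] at hk
        rw [perm_inv_apply]
        push_cast; omega
      · rintro ⟨h1, h2⟩
        refine ⟨(v⁻¹ x - b - 3).toNat, List.mem_range.2 (by push_cast at h2; omega), ?_⟩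
        rw [show (((v⁻¹ x - b - 3).toNat : ℕ) : ℤ) + 1 + ((b + 2 : ℕ) : ℤ) = v⁻¹ x by
          push_cast; omega, perm_apply_inv]
  set g : ℕ → ℤ := fun k => v ((k : ℤ) + 2) with hg
  have hfirst : (List.range (b + 2)).map (fun k : ℕ => v ((k : ℤ) + 1)) =
      v 1 :: (List.range (b + 1)).map g := by
    rw [List.range_succ_eq_map, List.map_cons, List.map_map]
    congr 1
  have hgpw : ((List.range (b + 1)).map g).Pairwise (· < ·) := by
    refine pairwise_map_range fun k hk => ?_
    have := minReps_lt hn hv (k := (k : ℤ) + 2) (by omega) (by push_cast; omega) (by omega)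
    convert this using 2
    push_cast; ring
  have h12 : v 1 < v 2 := minReps_lt hn hv (k := 1) le_rfl (by push_cast; omega) (by omega)
  have h12' := minReps_neg_lt hn hv (by omega)
  have habs : |v 1| < v 2 := abs_lt.2 ⟨by omega, h12⟩
  have hgt : ∀ y ∈ (List.range (b + 1)).map g, |v 1| < y := by
    rw [List.range_succ_eq_map, List.map_cons, List.pairwise_cons] at hgpw
    rw [List.range_succ_eq_map, List.map_cons]
    intro y hy
    have h0 : g 0 = v 2 := by simp [hg]
    rcases List.mem_cons.1 hy with rfl | hy
    · rwa [h0]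
    · exact habs.trans (h0 ▸ hgpw.1 y hy)
  have hv1 : v 1 ≠ 0 := (weyl_idx hn hv.1 (k := 1) ⟨by omega, by omega, by omega⟩).1
  have hcabs : ∀ y, coord (act (b + 2 + m) v (fundWeight (b + 2 + m) (b + 3))) |y| = 0 ↔
      coord (act (b + 2 + m) v (fundWeight (b + 2 + m) (b + 3))) y = 0 := by
    intro y
    rcases abs_choice y with h | h <;> rw [h]
    rw [coord_neg_right, neg_eq_zero]
  have hup : |v 1| :: (List.range (b + 1)).map g = up C := by
    refine eq_of_pairwise_lt (List.pairwise_cons.2 ⟨hgt, hgpw⟩) (pairwise_up C) fun x => ?_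
    rw [mem_up, hC, List.mem_cons]
    constructor
    · intro h
      have hpos : 1 ≤ x := by
        rcases h with rfl | h
        · have := abs_pos.2 hv1; omega
        · have := hgt x h
          have := abs_nonneg (v 1); omega
      obtain ⟨k, k1, k2, hx⟩ : ∃ k : ℤ, 1 ≤ k ∧ k < b + 3 ∧ x = |v k| := by
        rcases h with rfl | h
        · exact ⟨1, le_rfl, by omega, rfl⟩
        · obtain ⟨k, hk, rfl⟩ := List.mem_map.1 h
          rw [List.mem_range] at hk
          refine ⟨k + 2, by omega, by omega, ?_⟩
          rw [abs_of_pos (by simp only [hg] at hpos; omega)]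
      have hidx := weyl_idx hn hv.1 (k := k) ⟨by omega, by omega, by push_cast; omega⟩
      refine ⟨hpos, ?_, ?_⟩
      · rw [hx]; exact abs_le.2 ⟨hidx.2.1, hidx.2.2⟩
      · rw [hx, hcabs, coord_act_apply hn hv.1, hlow k k1 k2]
    · rintro ⟨h1, h2, h0⟩
      rw [coord_act hn hv.1, ← neg_eq_zero] at h0
      have hidx := weyl_idx hn (inv_mem hv.1) (k := x) ⟨by omega, by omega, h2⟩
      set y := v⁻¹ x with hy
      have hvy : v y = x := by rw [hy, perm_apply_inv]
      have hhi : ∀ k : ℤ, ((b + 3 : ℤ) ≤ k ∧ k ≤ ((b + 2 + m : ℕ) : ℤ)) →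
          coord (fundWeight (b + 2 + m) (b + 3)) k = 1 :=
        fun k => (coord_fundWeight_eq_one_iff hr k).2
      obtain ⟨y0, y1, y2⟩ := hidx
      have hy3 : y < b + 3 := by
        by_contra hc
        rw [hhi y ⟨by omega, y2⟩] at h0
        norm_num at h0
      have hy4 : -y < b + 3 := by
        by_contra hc
        rw [← coord_neg_right, hhi (-y) ⟨by omega, by omega⟩] at h0
        norm_num at h0
      have hin : ∀ k : ℤ, 2 ≤ k → k < b + 3 → v k ∈ (List.range (b + 1)).map g := fun k k1 k2 =>
        List.mem_map.2 ⟨(k - 2).toNat, List.mem_range.2 (by omega), by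
          simp only [hg]; congr 1; omega⟩
      have hpos : ∀ k : ℤ, 2 ≤ k → k < b + 3 → 0 < v k := fun k k1 k2 =>
        (abs_nonneg (v 1)).trans_lt (hgt _ (hin k k1 k2))
      rcases (show y = 1 ∨ y = -1 ∨ 2 ≤ y ∨ 2 ≤ -y by omega) with e | e | e | e
      · left; rw [← e, hvy, abs_of_pos (by omega)]
      · left
        have : v 1 = -x := by rw [← hvy, e, weyl_neg hv.1]; simp
        rw [this, abs_neg, abs_of_pos (by omega)]
      · right; rw [← hvy]; exact hin y e hy3
      · have := hpos (-y) e hy4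
        rw [weyl_neg hv.1, hvy] at this
        omega
  have hmemC : |v 1| ∈ C := by rw [← mem_up, ← hup]; simp
  have hleC : ∀ y ∈ C, |v 1| ≤ y := by
    intro y hy
    rw [← mem_up, ← hup, List.mem_cons] at hy
    rcases hy with rfl | hy
    · rfl
    · exact (hgt y hy).le
  have hpar := prod_sign_oneLine hn hv.1
  have hTne : ∀ x ∈ T, x ≠ 0 := by
    rintro x hx rfl
    rw [hmem, coord_eq_zero _ (by simp)] at hx
    norm_num at hx
  have hgprod : (((List.range (b + 1)).map g).map Int.sign).prod = 1 := by
    refine List.prod_eq_one fun s hs => ?_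
    obtain ⟨y, hy, rfl⟩ := List.mem_map.1 hs
    exact Int.sign_eq_one_of_pos ((abs_nonneg _).trans_lt (hgt y hy))
  rw [hsplit, hTeq, hfirst, List.map_append, List.prod_append, List.map_cons, List.prod_cons,
    hgprod, mul_one, prod_sign_eq hTne] at hpar
  rw [hsplit, hTeq, hfirst]
  congr 1
  have herase := up_eq_cons hmemC hleC
  rw [← hup, List.cons.injEq] at herase
  -- All other entries of the first block are positive, so `v 1` is negative exactly when `T` has an
  -- odd number of negative entries.
  rcases lt_or_gt_of_ne hv1 with h | h
  · rw [Int.sign_eq_neg_one_of_neg h] at hpar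
    rw [if_neg, upNeg_eq_cons hmemC hleC, ← herase.2, abs_of_neg h, neg_neg]
    intro he
    rw [he.neg_one_pow] at hpar
    norm_num at hpar
  · rw [Int.sign_eq_one_of_pos h, one_mul] at hpar
    rw [if_pos, ← hup, abs_of_pos h]
    by_contra he
    rw [(Nat.not_even_iff_odd.1 he).neg_one_pow] at hpar
    norm_num at hpar

theorem oneLine_spin_one (hn : 2 ≤ n) {v : Perm ℤ} (hv : v ∈ minReps n 1) {T : List ℤ}
    (hT : T.Pairwise (· < ·))
    (hmem : ∀ j, j ∈ T ↔ coord (act n v ((2 : ℝ) • fundWeight n 1)) j = 1) :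
    oneLine n v = T := by
  rw [oneLine_eq]
  refine eq_of_pairwise_lt (pairwise_map_range fun k hk => ?_) hT fun x => ?_
  · have := minReps_lt hn hv (k := (k : ℤ) + 1) (by omega) (by omega) (by omega)
    simpa using this
  · rw [hmem, coord_act hn hv.1, List.mem_map]
    constructor
    · rintro ⟨k, hk, rfl⟩
      rw [List.mem_range] at hk
      rw [perm_inv_apply, coord_two_fundWeight_one (by omega) (by omega)]
    · intro h
      by_cases hidx : Idx n (v⁻¹ x)
      · obtain ⟨h0, h1, h2⟩ := hidx
        rcases lt_or_gt_of_ne h0 with hneg | hpos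
        · have e := coord_two_fundWeight_one (n := n) (k := -v⁻¹ x) (by omega) (by omega)
          rw [coord_neg_right, h] at e
          norm_num at e
        · refine ⟨(v⁻¹ x - 1).toNat, List.mem_range.2 (by omega), ?_⟩
          rw [show (((v⁻¹ x - 1).toNat : ℕ) : ℤ) + 1 = v⁻¹ x by omega, perm_apply_inv]
      · rw [coord_eq_zero _ hidx] at h
        norm_num at h

/-- As `2ω_2` is `-1` at position 1 and 1 elsewhere, the list `-v 1, v 2, …, v n` enumerates the
signed indices of value 1; the condition at `α_1` makes it increasing. -/
theorem oneLine_spin_two (hn : 2 ≤ n) {v : Perm ℤ} (hv : v ∈ minReps n 2) {a : ℤ} {T : List ℤ}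
    (hT : (a :: T).Pairwise (· < ·))
    (hmem : ∀ j, j ∈ a :: T ↔ coord (act n v ((2 : ℝ) • fundWeight n 2)) j = 1) :
    oneLine n v = -a :: T := by
  obtain ⟨m, rfl⟩ : ∃ m : ℕ, n = (m + 1) + 1 := ⟨n - 2, by omega⟩
  set g : ℕ → ℤ := fun k => v ((k : ℤ) + 2) with hg
  have hfirst : oneLine (m + 1 + 1) v = v 1 :: (List.range (m + 1)).map g := by
    rw [oneLine_eq, List.range_succ_eq_map, List.map_cons, List.map_map]
    congr 1
  have hgpw : ((List.range (m + 1)).map g).Pairwise (· < ·) := by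
    refine pairwise_map_range fun k hk => ?_
    have := minReps_lt hn hv (k := (k : ℤ) + 2) (by omega) (by push_cast; omega) (by omega)
    convert this using 2
    push_cast; ring
  have h12' := minReps_neg_lt hn hv (by omega)
  have hgt : ∀ y ∈ (List.range (m + 1)).map g, -v 1 < y := by
    rw [List.range_succ_eq_map, List.map_cons, List.pairwise_cons] at hgpw
    rw [List.range_succ_eq_map, List.map_cons]
    intro y hy
    have h0 : g 0 = v 2 := by simp [hg]
    rcases List.mem_cons.1 hy with rfl | hy
    · rwa [h0]
    · exact h12'.trans (h0 ▸ hgpw.1 y hy)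
  have key : -v 1 :: (List.range (m + 1)).map g = a :: T := by
    refine eq_of_pairwise_lt (List.pairwise_cons.2 ⟨hgt, hgpw⟩) hT fun x => ?_
    rw [hmem, coord_act hn hv.1, List.mem_cons, List.mem_map]
    constructor
    · rintro (rfl | ⟨k, hk, rfl⟩)
      · rw [weyl_neg (inv_mem hv.1), perm_inv_apply, coord_neg_right,
          coord_two_fundWeight_two le_rfl (by omega)]
        norm_num
      · rw [List.mem_range] at hk
        simp only [hg]
        rw [perm_inv_apply, coord_two_fundWeight_two (by omega) (by push_cast; omega),
          if_neg (by omega)]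
    · intro h
      by_cases hidx : Idx (m + 1 + 1) (v⁻¹ x)
      · set y := v⁻¹ x with hy
        have hvy : v y = x := by rw [hy, perm_apply_inv]
        obtain ⟨h0, h1, h2⟩ := hidx
        rcases lt_or_gt_of_ne h0 with hneg | hpos
        · have e := coord_two_fundWeight_two (n := m + 1 + 1) (k := -y) (by omega) (by omega)
          rw [coord_neg_right, h] at e
          split_ifs at e with hy1
          · left
            rw [← hvy, show y = -1 by omega, weyl_neg hv.1]
          · norm_num at e
        · have e := coord_two_fundWeight_two (n := m + 1 + 1) (k := y) (by omega) h2
          rw [h] at e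
          split_ifs at e with hy1
          · norm_num at e
          · right
            refine ⟨(y - 2).toNat, List.mem_range.2 (by push_cast at h2; omega), ?_⟩
            simp only [hg]
            rw [show (((y - 2).toNat : ℕ) : ℤ) + 2 = y by omega, hvy]
      · rw [coord_eq_zero _ hidx] at h
        norm_num at h
  rw [List.cons.injEq] at key
  rw [hfirst, key.2, ← key.1, neg_neg]

/-! ### Signed indices and zeros of a standard vector -/

/-- The positions `≤ t` of `stdCoord t e i` with value `1`, as a list of signed indices. -/
def mid (t e : ℤ) : List ℤ :=
  if t = 1 then [] else if t = 2 then (if e = 0 then [2] else [e, 2]) else [e, 2, 3]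

/-- The signed indices at which `stdCoord t e i` takes the value `1`, in increasing order. -/
def stdList (t e : ℤ) (i : List ℤ) : List ℤ := negRev (primed i) ++ mid t e ++ i

theorem mem_negRev_primed {i : List ℤ} {k : ℤ} : k ∈ negRev (primed i) ↔ -k + 1 ∈ i := by
  simp only [negRev, List.mem_reverse, List.mem_map, mem_primed]
  constructor
  · rintro ⟨x, hx, rfl⟩; simpa using hx
  · exact fun h => ⟨-k, h, by simp⟩

theorem IsStd.pairwise_stdList {x : Fin n → ℝ} {t e : ℤ} {i : List ℤ} (h : IsStd n x t e i) :
    (stdList t e i).Pairwise (· < ·) := by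
  have hge : ∀ k ∈ i, t + 2 ≤ k := fun k hk => (h.sparse.1 k hk).1
  have hge' : ∀ k ∈ negRev (primed i), k ≤ -t - 1 := fun k hk => by
    have := hge _ (mem_negRev_primed.1 hk); omega
  have hmid : (mid t e).Pairwise (· < ·) ∧ ∀ k ∈ mid t e, -t ≤ k ∧ k ≤ t := by
    rcases h.valid with ⟨rfl, rfl⟩ | ⟨rfl, rfl | rfl | rfl⟩ | ⟨rfl, rfl | rfl⟩ <;> simp [mid]
  have ht := h.one_le
  refine List.pairwise_append.2 ⟨List.pairwise_append.2 ⟨?_, hmid.1, ?_⟩, ?_, ?_⟩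
  · rw [negRev, List.pairwise_reverse, primed, List.pairwise_map, List.pairwise_map]
    exact h.sparse.2.imp fun h => by omega
  · intro a ha b hb
    have := hge' a ha
    have := (hmid.2 b hb).1
    omega
  · exact h.sparse.2.imp fun h => by omega
  · intro a ha b hb
    have := hge b hb
    rcases List.mem_append.1 ha with ha | ha
    · have := hge' a ha; omega
    · have := (hmid.2 a ha).2; omega

theorem IsStd.coord_of_lt {x : Fin n → ℝ} {t e : ℤ} {i : List ℤ} (h : IsStd n x t e i) {k : ℤ}
    (hk : t < k) (hkn : k ≤ n) : coord x k = pairCoord i k := by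
  have := h.one_le
  rw [h.coord_eq k (by omega) hkn, stdCoord, if_neg (by omega), if_neg (by omega)]

theorem Sparse.pairCoord_eq_one_iff {s t : ℤ} {i : List ℤ} (h : Sparse s t i) (k : ℤ) :
    pairCoord i k = 1 ↔ k ∈ i := by
  have := fun hk : k ∈ i => h.not_mem_succ hk
  unfold pairCoord
  split_ifs <;> simp_all

theorem Sparse.pairCoord_eq_neg_one_iff {s t : ℤ} {i : List ℤ} (h : Sparse s t i) (k : ℤ) :
    pairCoord i k = -1 ↔ k + 1 ∈ i := by
  have := fun hk : k ∈ i => h.not_mem_succ hk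
  unfold pairCoord
  split_ifs <;> simp_all

/-- A pair `(-1, 1)` at positions `k - 1, k` contributes the signed indices `-(k - 1)` and `k`,
which produces the blocks `-i'` and `i`; the run and the first coordinate give the middle block. -/
theorem IsStd.mem_stdList {x : Fin n → ℝ} {t e : ℤ} {i : List ℤ} (h : IsStd n x t e i) (j : ℤ) :
    j ∈ stdList t e i ↔ coord x j = 1 := by
  have hge : ∀ k ∈ i, t + 2 ≤ k ∧ k ≤ n := fun k hk => h.sparse.1 k hk
  have ht := h.one_le
  have htn := h.le_n
  simp only [stdList, List.mem_append, mem_negRev_primed]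
  rcases (show (t < j ∨ j < -t) ∨ (-t ≤ j ∧ j ≤ t) by omega) with hj | hj
  · have hm : j ∉ mid t e := by
      rcases h.valid with ⟨rfl, rfl⟩ | ⟨rfl, rfl | rfl | rfl⟩ | ⟨rfl, rfl | rfl⟩ <;>
        simp [mid] <;> omega
    rcases hj with hj | hj
    · have h1 : -j + 1 ∉ i := fun hh => by have := hge _ hh; omega
      by_cases hjn : j ≤ n
      · rw [h.coord_of_lt hj hjn]
        have := h.sparse.pairCoord_eq_one_iff j
        simp only [h1, hm, or_self, false_or]
        rw [← this]; norm_cast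
      · rw [coord_eq_zero _ (by omega)]
        have h2 : j ∉ i := fun hh => by have := hge _ hh; omega
        simp [h1, h2, hm]
    · have h1 : j ∉ i := fun hh => by have := hge _ hh; omega
      by_cases hjn : -j ≤ n
      · have e1 : coord x j = -coord x (-j) := by rw [coord_neg_right, neg_neg]
        rw [e1, h.coord_of_lt (by omega) hjn]
        have := h.sparse.pairCoord_eq_neg_one_iff (-j)
        simp only [h1, hm, or_false]
        rw [← this, neg_eq_iff_eq_neg]; norm_cast
      · rw [coord_eq_zero _ (by omega)]
        have h2 : -j + 1 ∉ i := fun hh => by have := hge _ hh; omega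
        simp [h1, h2, hm]
  · have h1 : j ∉ i := fun hh => by have := hge _ hh; omega
    have h2 : -j + 1 ∉ i := fun hh => by have := hge _ hh; omega
    simp only [h1, h2, or_false, false_or]
    have c1 := h.coord_eq 1 le_rfl (by omega)
    have hc : ∀ k : ℤ, 2 ≤ k → k ≤ t → coord x k = 1 := fun k k1 k2 => by
      rw [h.coord_eq k (by omega) (by omega), stdCoord, if_neg (by omega), if_pos k2]; simp
    have c0 : coord x 0 = 0 := coord_eq_zero _ (by simp)
    rw [stdCoord, if_pos rfl] at c1
    obtain ⟨hj1, hj2⟩ := hj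
    rcases h.valid with ⟨rfl, rfl⟩ | ⟨rfl, he⟩ | ⟨rfl, he⟩
    · interval_cases j <;> simp [mid, coord_neg_right, c0, c1]
    · have c2 := hc 2 le_rfl le_rfl
      rcases he with rfl | rfl | rfl <;> interval_cases j <;>
        simp [mid, coord_neg_right, c0, c1, c2] <;> norm_num
    · have c2 := hc 2 le_rfl (by omega)
      have c3 := hc 3 (by omega) le_rfl
      rcases he with rfl | rfl <;> interval_cases j <;>
        simp [mid, coord_neg_right, c0, c1, c2, c3] <;> norm_num

theorem IsStd.countP_stdList {x : Fin n → ℝ} {t e : ℤ} {i : List ℤ} (h : IsStd n x t e i) :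
    (stdList t e i).countP (· < 0) = i.length + if e = -1 then 1 else 0 := by
  have hge : ∀ k ∈ i, t + 2 ≤ k ∧ k ≤ n := fun k hk => h.sparse.1 k hk
  have ht := h.one_le
  have h1 : (negRev (primed i)).countP (· < 0) = i.length := by
    have : (negRev (primed i)).length = i.length := by simp [negRev, primed]
    rw [← this, List.countP_eq_length]
    intro k hk
    have := hge _ (mem_negRev_primed.1 hk)
    simp; omega
  have h2 : i.countP (· < 0) = 0 := by
    rw [List.countP_eq_zero]
    intro k hk
    have := hge k hk
    simp; omega
  have h3 : (mid t e).countP (· < 0) = if e = -1 then 1 else 0 := by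
    rcases h.valid with ⟨rfl, rfl⟩ | ⟨rfl, rfl | rfl | rfl⟩ | ⟨rfl, rfl | rfl⟩ <;> rfl
  rw [stdList, List.countP_append, List.countP_append, h1, h2, h3]
  omega

theorem IsStd.ext {x y : Fin n → ℝ} {t e : ℤ} {i : List ℤ} (h : IsStd n x t e i)
    (h' : IsStd n y t e i) : x = y :=
  coord_ext fun k h1 h2 => by rw [h.coord_eq k h1 h2, h'.coord_eq k h1 h2]

/-! ### The listed weights are standard vectors -/

theorem coord_simpleRoot_one {k : ℤ} (h1 : 1 ≤ k) (h2 : k ≤ n) :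
    coord (simpleRoot n 1) k = if k ≤ 2 then 1 else 0 := by
  rw [simpleRoot_eq, coord_root_idx ⟨by omega, by omega, h2⟩]
  unfold lo hi
  grind

theorem Sparse.pairCoord_of_lt {s t : ℤ} {i : List ℤ} (h : Sparse s t i) {k : ℤ} (hk : k + 1 < s) :
    pairCoord i k = 0 := by
  rw [pairCoord, if_neg fun hm => ?_, if_neg fun hm => ?_]
  · rfl
  · have := (h.1 _ hm).1; omega
  · have := (h.1 _ hm).1; omega

theorem isStd_zero (hn : 3 ≤ n) {i : List ℤ} (hi : Sparse 3 n i) :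
    IsStd n (rootSum n i) 1 0 i := by
  refine ⟨hi, by omega, by omega, fun k h1 h2 => ?_⟩
  rw [coord_rootSum (by norm_num) hi h1 h2, stdCoord]
  split_ifs with h3 h4
  · rw [hi.pairCoord_of_lt (by omega)]
  · omega
  · rfl

/-- The initial coordinates and the tail `α_{i_1} + ⋯ + α_{i_p}` have disjoint supports, so each
listed weight only requires identifying its head. The heads are `e_2 ± e_1`, `e_2` and `e_3 + e_2 ±
e_1`. -/
theorem isStd_add (hn : 3 ≤ n) {t e : ℤ} {b : Fin n → ℝ} {i : List ℤ}
    (he : (t = 2 ∧ (e = -1 ∨ e = 0 ∨ e = 1)) ∨ (t = 3 ∧ (e = -1 ∨ e = 1)))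
    (hi : Sparse (t + 2) n i)
    (hb : ∀ k : ℤ, 1 ≤ k → k ≤ n → coord b k = if k = 1 then (e : ℝ) else if k ≤ t then 1 else 0) :
    IsStd n (b + rootSum n i) t e i := by
  refine ⟨hi, by omega, Or.inr he, fun k h1 h2 => ?_⟩
  rw [coord_add, hb k h1 h2, coord_rootSum (by omega) hi h1 h2, stdCoord]
  split_ifs with h3 h4
  · rw [hi.pairCoord_of_lt (by omega)]; simp
  · rw [hi.pairCoord_of_lt (by omega)]; simp
  · simp

theorem isStd_root_one (hn : 3 ≤ n) {i : List ℤ} (hi : Sparse 4 n i) :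
    IsStd n (simpleRoot n 1 + rootSum n i) 2 1 i := by
  refine isStd_add hn (by omega) hi fun k h1 h2 => ?_
  rw [coord_simpleRoot_one h1 h2]
  split_ifs <;> first | omega | simp

theorem isStd_root_two (hn : 3 ≤ n) {i : List ℤ} (hi : Sparse 4 n i) :
    IsStd n (simpleRoot n 2 + rootSum n i) 2 (-1) i := by
  refine isStd_add hn (by omega) hi fun k h1 h2 => ?_
  rw [coord_simpleRoot (by norm_num) h1 h2]
  split_ifs <;> first | omega | simp

theorem isStd_half (hn : 3 ≤ n) {i : List ℤ} (hi : Sparse 4 n i) :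
    IsStd n ((1 / 2 : ℝ) • simpleRoot n 1 + (1 / 2 : ℝ) • simpleRoot n 2 + rootSum n i) 2 0 i := by
  refine isStd_add hn (by omega) hi fun k h1 h2 => ?_
  rw [coord_add, coord_smul, coord_smul, coord_simpleRoot_one h1 h2,
    coord_simpleRoot (by norm_num) h1 h2]
  split_ifs <;> first | omega | norm_num

theorem isStd_three_one (hn : 3 ≤ n) {i : List ℤ} (hi : Sparse 5 n i) :
    IsStd n ((3 / 2 : ℝ) • simpleRoot n 1 + (1 / 2 : ℝ) • simpleRoot n 2 + simpleRoot n 3 +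
      rootSum n i) 3 1 i := by
  refine isStd_add hn (by omega) hi fun k h1 h2 => ?_
  rw [coord_add, coord_add, coord_smul, coord_smul, coord_simpleRoot_one h1 h2,
    coord_simpleRoot (by norm_num) h1 h2, coord_simpleRoot (by norm_num) h1 h2]
  split_ifs <;> first | omega | norm_num

theorem isStd_one_three (hn : 3 ≤ n) {i : List ℤ} (hi : Sparse 5 n i) :
    IsStd n ((1 / 2 : ℝ) • simpleRoot n 1 + (3 / 2 : ℝ) • simpleRoot n 2 + simpleRoot n 3 +
      rootSum n i) 3 (-1) i := by
  refine isStd_add hn (by omega) hi fun k h1 h2 => ?_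
  rw [coord_add, coord_add, coord_smul, coord_smul, coord_simpleRoot_one h1 h2,
    coord_simpleRoot (by norm_num) h1 h2, coord_simpleRoot (by norm_num) h1 h2]
  split_ifs <;> first | omega | norm_num

theorem mem_gaps {s : ℤ} {i : List ℤ} {k : ℤ} :
    k ∈ gaps s n i ↔ s ≤ k ∧ k ≤ n ∧ k ∉ i ∧ k + 1 ∉ i := by
  simp only [gaps, Finset.mem_sdiff, Finset.mem_Icc, Finset.mem_union, List.mem_toFinset,
    mem_primed, not_or, and_assoc]

/-- The positions at which `stdCoord t e i` vanishes. -/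
noncomputable def stdZeros (n : ℕ) (t e : ℤ) (i : List ℤ) : Finset ℤ :=
  if e = 0 then insert 1 (gaps (t + 1) n i) else gaps (t + 1) n i

theorem IsStd.mem_stdZeros {x : Fin n → ℝ} {t e : ℤ} {i : List ℤ} (h : IsStd n x t e i) (j : ℤ) :
    j ∈ stdZeros n t e i ↔ 1 ≤ j ∧ j ≤ n ∧ coord x j = 0 := by
  have ht := h.one_le
  have htn := h.le_n
  by_cases hj : 1 ≤ j ∧ j ≤ n
  swap
  · constructor
    · intro hm
      unfold stdZeros at hm
      split_ifs at hm
      · rcases Finset.mem_insert.1 hm with rfl | hm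
        · omega
        · rw [mem_gaps] at hm; omega
      · rw [mem_gaps] at hm; omega
    · exact fun hh => absurd ⟨hh.1, hh.2.1⟩ hj
  rw [h.coord_eq j hj.1 hj.2]
  simp only [hj, true_and, Int.cast_eq_zero]
  have hs : ∀ k ∈ i, k + 1 ∉ i := fun k hk => h.sparse.not_mem_succ hk
  unfold stdZeros stdCoord pairCoord
  split_ifs with h1 h2 h3 h4 h5 h6 h7 h8 h9 <;> simp only [Finset.mem_insert, mem_gaps] <;> grind

/-! ### Maximal elements for `3 ≤ r ≤ n` -/

theorem IsStd.exists_unique_maximal (hn : 3 ≤ n) {x : Fin n → ℝ} {t e : ℤ} {i : List ℤ}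
    (h : IsStd n x t e i) {r : ℤ} (hr : 3 ≤ r) (hrn : r ≤ n)
    (hdot : t - 1 + e ^ 2 + 2 * i.length = n + 1 - r) :
    ∃ v, IsUniqueOfWeight n r x v ∧ v ∈ maximalSet n r ∧
      oneLine n v = (if Even (i.length + if e = -1 then 1 else 0) then up (stdZeros n t e i)
        else upNeg (stdZeros n t e i)) ++ stdList t e i := by
  obtain ⟨v, hv, hvx⟩ := h.isTernary.exists_minReps (by omega) hr hrn (by rw [h.dot_self, hdot])
  refine ⟨v, ⟨hv, hvx, fun u hu hux => ?_⟩, ?_, ?_⟩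
  · exact minReps_unique (by omega) (by omega) hu hv (hux.trans hvx.symm)
  · exact mem_maximalSet_of_locMax (by omega) (by omega) hv (hvx ▸ h.locMax (by omega))
  · rw [oneLine_of_three_le (by omega) hr hrn hv h.pairwise_stdList (C := stdZeros n t e i),
      h.countP_stdList]
    · intro j; rw [hvx, h.mem_stdList]
    · intro j; rw [hvx, h.mem_stdZeros]

theorem isTernary_fundWeight {r : ℤ} (hr : 3 ≤ r) : IsTernary (fundWeight n r) :=
  isTernary_of fun k h1 h2 => by
    rw [coord_fundWeight _ h1 h2, if_neg (by omega), if_neg (by omega)]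
    split_ifs
    · exact ⟨1, by simp⟩
    · exact ⟨0, by simp⟩

theorem fundWeight_dot_self {r : ℤ} (hr : 3 ≤ r) (hrn : r ≤ n) :
    fundWeight n r ⬝ᵥ fundWeight n r = ((n + 1 - r : ℤ) : ℝ) := by
  rw [dot_fundWeight_of_three_le _ hr, suffixSum, Finset.sum_congr rfl fun j hj => ?_,
    Finset.sum_const (1 : ℝ), Int.card_Icc, nsmul_eq_mul, mul_one]
  · have : (((n + 1 - r : ℤ).toNat : ℕ) : ℤ) = n + 1 - r := by omega
    exact_mod_cast this
  · rw [Finset.mem_Icc] at hj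
    exact (coord_fundWeight_eq_one_iff hr j).2 hj

/-- Comparing norms attaches to the standard form the equation that selects its possible shapes for
the given `r`. -/
theorem exists_isStd_of_mem_maximalSet (hn : 3 ≤ n) {r : ℤ} (hr : 3 ≤ r) (hrn : r ≤ n)
    {v : Perm ℤ} (hv : v ∈ maximalSet n r) :
    ∃ t e i, IsStd n (act n v (fundWeight n r)) t e i ∧
      t - 1 + e ^ 2 + 2 * (i.length : ℤ) = n + 1 - r := by
  obtain ⟨t, e, i, h⟩ := exists_isStd hn ((isTernary_fundWeight hr).act (by omega) hv.1.1)
    (simpleMax_of_mem_maximalSet (by omega) (by omega) hv)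
  refine ⟨t, e, i, h, ?_⟩
  have := h.dot_self
  rw [act_dot_act (by omega) hv.1.1, fundWeight_dot_self hr hrn] at this
  exact_mod_cast this.symm

/-! ### Arithmetic progressions and the spin weights -/

theorem steps_eq (a : ℤ) (k : ℕ) : steps a k = (List.range k).map fun j : ℕ => a + 2 * (j : ℤ) := by
  simp [steps, List.map_eq_flatMap, List.flatMap_assoc]

theorem steps_zero (a : ℤ) : steps a 0 = [] := by simp [steps_eq]

theorem steps_succ (a : ℤ) (k : ℕ) : steps a (k + 1) = a :: steps (a + 2) k := by
  rw [steps_eq, steps_eq, List.range_succ_eq_map, List.map_cons, List.map_map]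
  simp only [List.cons.injEq]
  refine ⟨by simp, List.map_congr_left fun j _ => ?_⟩
  simp only [Function.comp_apply]
  push_cast; ring

theorem steps_succ_last (a : ℤ) (k : ℕ) : steps a (k + 1) = steps a k ++ [a + 2 * k] := by
  rw [steps_eq, steps_eq, List.range_succ, List.map_append, List.map_singleton]

theorem length_steps (a : ℤ) (k : ℕ) : (steps a k).length = k := by simp [steps_eq]

theorem sparse_steps {a t : ℤ} {k : ℕ} (h : a + 2 * k ≤ t + 2) : Sparse a t (steps a k) := by
  induction k generalizing a with
  | zero => rw [steps_zero]; exact ⟨by simp, List.Pairwise.nil⟩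
  | succ k ih =>
    push_cast at h
    have ih := ih (a := a + 2) (by omega)
    rw [steps_succ]
    refine ⟨fun x hx => ?_, List.pairwise_cons.2 ⟨fun x hx => (ih.1 x hx).1, ih.2⟩⟩
    rcases List.mem_cons.1 hx with rfl | hx
    · omega
    · have := ih.1 x hx; omega

/-- The length is the largest that gaps of 2 permit in `[a, t]`, and no further shift by 1 fits, so
every entry is forced. -/
theorem Sparse.eq_steps {a t : ℤ} {i : List ℤ} (h : Sparse a t i) (ht : t + 1 < a + 2 * i.length) :
    i = steps a i.length := by
  induction i generalizing a with
  | nil => rw [List.length_nil, steps_zero]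
  | cons x i ih =>
    have hx := h.1 x (by simp)
    rw [List.length_cons] at ht
    push_cast at ht
    have h2 := h.tail.mono (s' := a + 2) (by omega)
    have e := ih h2 (by omega)
    have hxa : x = a := by
      cases i with
      | nil => simp at ht; omega
      | cons y i =>
        have h3 := (List.pairwise_cons.1 h.2).1 y (by simp)
        rw [List.length_cons, steps_succ, List.cons.injEq] at e
        omega
    rw [List.length_cons, steps_succ, ← e, hxa]

theorem negRev_primed_steps (a : ℤ) (k : ℕ) :
    negRev (primed (steps a k)) = steps (-(a + 2 * k - 3)) k := by
  induction k generalizing a with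
  | zero => rw [steps_zero, steps_zero]; rfl
  | succ k ih =>
    rw [steps_succ, steps_succ_last]
    have : negRev (primed (a :: steps (a + 2) k)) =
        negRev (primed (steps (a + 2) k)) ++ [-(a - 1)] := by simp [negRev, primed]
    rw [this, ih]
    push_cast
    congr 2
    · ring
    · ring

theorem rootSum_append (i j : List ℤ) : rootSum n (i ++ j) = rootSum n i + rootSum n j := by
  simp [rootSum]

theorem rootSum_steps_even (q : ℕ) :
    rootSum n (steps 4 q) = ∑ i ∈ Finset.Icc 2 (q + 1), simpleRoot n (2 * (i : ℤ)) := by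
  induction q with
  | zero => simp [steps_zero, rootSum]
  | succ q ih =>
    rw [steps_succ_last, rootSum_append, ih, Finset.sum_Icc_succ_top (b := q + 1) (by omega)]
    simp only [rootSum, List.map_cons, List.map_nil, List.sum_cons, List.sum_nil, add_zero]
    rw [show (4 : ℤ) + 2 * q = 2 * ((q + 1 + 1 : ℕ) : ℤ) by push_cast; ring]

theorem rootSum_steps_odd (q : ℕ) :
    rootSum n (steps 5 q) = ∑ i ∈ Finset.Icc 2 (q + 1), simpleRoot n (2 * (i : ℤ) + 1) := by
  induction q with
  | zero => simp [steps_zero, rootSum]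
  | succ q ih =>
    rw [steps_succ_last, rootSum_append, ih, Finset.sum_Icc_succ_top (b := q + 1) (by omega)]
    simp only [rootSum, List.map_cons, List.map_nil, List.sum_cons, List.sum_nil, add_zero]
    rw [show (5 : ℤ) + 2 * q = 2 * ((q + 1 + 1 : ℕ) : ℤ) + 1 by push_cast; ring]

theorem coord_two_fundWeight_sq {r : ℤ} (hr : r = 1 ∨ r = 2) {k : ℤ} (h1 : 1 ≤ k) (h2 : k ≤ n) :
    coord ((2 : ℝ) • fundWeight n r) k * coord ((2 : ℝ) • fundWeight n r) k = 1 := by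
  rcases hr with rfl | rfl
  · rw [coord_two_fundWeight_one h1 h2]; norm_num
  · rw [coord_two_fundWeight_two h1 h2]; split_ifs <;> norm_num

theorem isTernary_two_fundWeight {r : ℤ} (hr : r = 1 ∨ r = 2) :
    IsTernary ((2 : ℝ) • fundWeight n r) :=
  isTernary_of fun k h1 h2 => by
    rcases mul_self_eq_one_iff.1 (coord_two_fundWeight_sq hr h1 h2) with e | e
    · exact ⟨1, by simp [e]⟩
    · exact ⟨-1, by simp [e]⟩

theorem two_fundWeight_dot_self {r : ℤ} (hr : r = 1 ∨ r = 2) :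
    ((2 : ℝ) • fundWeight n r) ⬝ᵥ ((2 : ℝ) • fundWeight n r) = n := by
  rw [dot_eq_sum, Finset.sum_congr rfl fun k hk => ?_, Finset.sum_const (1 : ℝ)]
  · simp
  · rw [Finset.mem_Icc] at hk
    exact coord_two_fundWeight_sq hr hk.1 hk.2

theorem IsTernary.ne_zero_of_dot_self {x : Fin n → ℝ} (hx : IsTernary x) (hdot : x ⬝ᵥ x = n)
    {k : ℤ} (h1 : 1 ≤ k) (h2 : k ≤ n) : coord x k ≠ 0 := by
  intro h0
  have hsum : ∑ k ∈ Finset.Icc (1 : ℤ) n, (1 - coord x k * coord x k) = 0 := by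
    rw [Finset.sum_sub_distrib, ← dot_eq_sum, hdot]
    simp
  have hnn : ∀ k ∈ Finset.Icc (1 : ℤ) n, 0 ≤ 1 - coord x k * coord x k := by
    intro k _
    obtain ⟨c, hc, c1, c2⟩ := hx k
    rw [hc]
    rcases (show c = -1 ∨ c = 0 ∨ c = 1 by omega) with rfl | rfl | rfl <;> norm_num
  have := (Finset.sum_eq_zero_iff_of_nonneg hnn).1 hsum k (Finset.mem_Icc.2 ⟨h1, h2⟩)
  rw [h0] at this
  norm_num at this

/-- The one-line notation of the maximal element for `r = 1` and `r = 2`, from the increasing list of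
signed indices: for `r = 2` the first entry changes its sign. -/
def flipHead (r : ℤ) (l : List ℤ) : List ℤ :=
  if r = 1 then l else match l with
    | [] => []
    | a :: l => -a :: l

/-- The number of negative signed indices is `i.length`, plus 1 if `e = -1`. For `r = 1` the list
itself is the one-line notation, so this number is even; for `r = 2` the head changes sign, so it is
odd. -/
theorem IsStd.oneLine_spin (hn : 2 ≤ n) {r : ℤ} (hr : r = 1 ∨ r = 2) {v : Perm ℤ}
    (hv : v ∈ minReps n r) {t e : ℤ} {i : List ℤ}
    (h : IsStd n (act n v ((2 : ℝ) • fundWeight n r)) t e i) :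
    oneLine n v = flipHead r (stdList t e i) ∧
      (r = 1 ↔ Even (i.length + if e = -1 then 1 else 0)) := by
  have hne : ∀ x ∈ stdList t e i, x ≠ 0 := by
    rintro x hx rfl
    rw [h.mem_stdList, coord_eq_zero _ (by simp)] at hx
    norm_num at hx
  have hpar := prod_sign_oneLine hn hv.1
  have hs := prod_sign_eq hne
  rw [h.countP_stdList] at hs
  rcases hr with rfl | rfl
  · have e1 := oneLine_spin_one hn hv h.pairwise_stdList h.mem_stdList
    refine ⟨by simp [e1, flipHead], iff_of_true rfl ?_⟩
    rw [e1, hs] at hpar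
    by_contra hc
    rw [(Nat.not_even_iff_odd.1 hc).neg_one_pow] at hpar
    norm_num at hpar
  · cases hl : stdList t e i with
    | nil =>
      -- The list is never empty: `2ω_2` has value 1 at the signed index `-1`, so `v (-1)` belongs
      -- to the list.
      have h1 := weyl_idx hn (inv_mem hv.1) (k := -1) ⟨by omega, by omega, by omega⟩
      have h2 : v (-1) ∈ stdList t e i := by
        rw [h.mem_stdList, coord_act_apply hn hv.1, coord_neg_right,
          coord_two_fundWeight_two le_rfl (by omega)]
        norm_num
      rw [hl] at h2
      simp at h2
    | cons a l =>
      have hp := h.pairwise_stdList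
      have hm := h.mem_stdList
      rw [hl] at hp hm hs hne
      have e1 := oneLine_spin_two hn hv hp hm
      refine ⟨by rw [e1]; rfl, iff_of_false (by norm_num) fun he => ?_⟩
      rw [he.neg_one_pow, List.map_cons, List.prod_cons] at hs
      rw [e1, List.map_cons, List.prod_cons, Int.sign_neg, neg_mul, hs] at hpar
      norm_num at hpar

/-- Norm `n` leaves no zero coordinate; thus `e = ±1`, the pairs fill everything after the run, and
`t` is 2 or 3 according to the parity of `n`. -/
theorem IsStd.spin {x : Fin n → ℝ} {t e : ℤ} {i : List ℤ} (h : IsStd n x t e i)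
    (hdot : x ⬝ᵥ x = n) : (t = 2 ∨ t = 3) ∧ (e = -1 ∨ e = 1) ∧ (n : ℤ) = t + 2 * i.length ∧
      i = steps (t + 2) i.length := by
  have hd := h.dot_self
  rw [hdot] at hd
  have hd : (n : ℤ) = t - 1 + e ^ 2 + 2 * i.length := by exact_mod_cast hd
  have hn1 : 1 ≤ (n : ℤ) := by have := h.one_le; have := h.le_n; omega
  have he : e ≠ 0 := fun h0 => by
    have := h.isTernary.ne_zero_of_dot_self hdot le_rfl hn1
    rw [h.coord_eq 1 le_rfl hn1, stdCoord, if_pos rfl, h0] at this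
    simp at this
  have he' : e = -1 ∨ e = 1 := by have := h.valid; omega
  have hsq : e ^ 2 = 1 := by rcases he' with rfl | rfl <;> norm_num
  refine ⟨by have := h.valid; omega, he', by omega, h.sparse.eq_steps (by omega)⟩

/-- The parity condition places `x` in the orbit of `2ω_r` rather than of the other spin weight. It
also gives uniqueness: another maximal element has the same `t` and the same progression by its
norm, and the same `e` by parity. -/
theorem IsStd.maximalSet_spin (hn : 3 ≤ n) {r : ℤ} (hr : r = 1 ∨ r = 2) {x : Fin n → ℝ} {t e : ℤ}
    {q : ℕ} (h : IsStd n x t e (steps (t + 2) q)) (hq : (n : ℤ) = t + 2 * q)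
    (he : e = -1 ∨ e = 1) (hpar : r = 1 ↔ Even (q + if e = -1 then 1 else 0)) :
    ∃ v, maximalSet n r = {v} ∧ act n v ((2 : ℝ) • fundWeight n r) = x ∧
      oneLine n v = flipHead r (stdList t e (steps (t + 2) q)) := by
  have hn2 : 2 ≤ n := by omega
  have hr1 : 1 ≤ r := by omega
  have hdot : x ⬝ᵥ x = n := by
    have hsq : e ^ 2 = 1 := by rcases he with rfl | rfl <;> norm_num
    rw [h.dot_self, hsq, length_steps]
    exact_mod_cast (by omega : t - 1 + 1 + 2 * (q : ℤ) = n)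
  have hex : ∃ v ∈ minReps n r, act n v ((2 : ℝ) • fundWeight n r) = x := by
    rcases h.isTernary.exists_minReps_spin hn2
      (fun k h1 h2 => h.isTernary.ne_zero_of_dot_self hdot h1 h2) with ⟨v, hv, hvx⟩ | ⟨v, hv, hvx⟩
    · have := ((hvx.symm ▸ h).oneLine_spin hn2 (Or.inl rfl) hv).2
      rw [length_steps] at this
      have hr' : r = 1 := hpar.2 (this.1 rfl)
      rw [hr']; exact ⟨v, hv, hvx⟩
    · have := ((hvx.symm ▸ h).oneLine_spin hn2 (Or.inr rfl) hv).2
      rw [length_steps] at this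
      have hr' : r = 2 := hr.resolve_left fun h1 => absurd (this.2 (hpar.1 h1)) (by norm_num)
      rw [hr']; exact ⟨v, hv, hvx⟩
  obtain ⟨v, hv, hvx⟩ := hex
  have hvx' : (2 : ℝ) • act n v (fundWeight n r) = x := by rw [← act_smul, hvx]
  refine ⟨v, Set.eq_singleton_iff_unique_mem.2 ⟨?_, fun u hu => ?_⟩, hvx,
    ((hvx.symm ▸ h).oneLine_spin hn2 hr hv).1⟩
  · exact mem_maximalSet_of_locMax hn2 hr1 hv
      (LocMax.of_smul (c := 2) (by norm_num) (hvx' ▸ h.locMax hn2))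
  · have hsm := (simpleMax_of_mem_maximalSet hn2 hr1 hu).smul (c := 2) (by norm_num)
    rw [← act_smul] at hsm
    obtain ⟨t', e', i', h'⟩ := exists_isStd hn ((isTernary_two_fundWeight hr).act hn2 hu.1.1) hsm
    obtain ⟨ht', he', hn', hi'⟩ := h'.spin (by
      rw [act_dot_act hn2 hu.1.1, two_fundWeight_dot_self hr])
    obtain ⟨ht, -⟩ := h.spin hdot
    have hp' := (h'.oneLine_spin hn2 hr hu.1).2
    have htt : t' = t := by omega
    have hlen : i'.length = q := by omega
    rw [hlen] at hp' hi'
    -- For fixed `q` and `r`, changing the sign of `e` changes the parity of the number of minus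
    -- signs.
    have hee : e' = e := by
      rw [hpar] at hp'
      rcases he with rfl | rfl <;> rcases he' with rfl | rfl <;>
        simp only [if_pos, reduceCtorEq, Nat.even_add_one] at hp' ⊢ <;> tauto
    subst htt hee hi'
    have := h'.ext h
    rw [← hvx, act_smul, act_smul] at this
    exact minReps_unique hn2 hr1 hu.1 hv (smul_right_injective _ (two_ne_zero' ℝ) this)

theorem up_insert_one {S : Finset ℤ} (h : ∀ k ∈ S, 2 ≤ k) : up (insert 1 S) = 1 :: up S := by
  have h1 : (1 : ℤ) ∉ S := fun hm => by have := h 1 hm; omega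
  rw [up_eq_cons (Finset.mem_insert_self 1 S) fun b hb => ?_, Finset.erase_insert h1]
  rcases Finset.mem_insert.1 hb with rfl | hb
  · rfl
  · have := h b hb; omega

theorem upNeg_insert_one {S : Finset ℤ} (h : ∀ k ∈ S, 2 ≤ k) :
    upNeg (insert 1 S) = -1 :: up S := by
  have h1 : (1 : ℤ) ∉ S := fun hm => by have := h 1 hm; omega
  rw [upNeg_eq_cons (Finset.mem_insert_self 1 S) fun b hb => ?_, Finset.erase_insert h1]
  rcases Finset.mem_insert.1 hb with rfl | hb
  · rfl
  · have := h b hb; omega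

theorem two_le_of_mem_gaps {s : ℤ} (hs : 2 ≤ s) (i : List ℤ) : ∀ k ∈ gaps s n i, 2 ≤ k :=
  fun _ hk => hs.trans (mem_gaps.1 hk).1

theorem sign_up_insert_one {m : ℕ} {S : Finset ℤ} (h : ∀ k ∈ S, 2 ≤ k) :
    (if Even m then up (insert 1 S) else upNeg (insert 1 S)) =
      [if Odd m then (-1 : ℤ) else 1] ++ up S := by
  rw [up_insert_one h, upNeg_insert_one h]
  rcases Nat.even_or_odd m with hm | hm
  · rw [if_pos hm, if_neg (Nat.not_odd_iff_even.2 hm)]; rfl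
  · rw [if_neg (Nat.not_even_iff_odd.2 hm), if_pos hm]; rfl

theorem sign_up_pred {m : ℕ} (hm : 1 ≤ m) (a b : List ℤ) :
    (if Even (m - 1 + 0) then a else b) = if Odd m then a else b := by
  obtain ⟨k, rfl⟩ := Nat.exists_eq_add_of_le' hm
  rw [Nat.add_sub_cancel, add_zero]
  simp only [Nat.odd_add_one, Nat.not_odd_iff_even]

theorem sign_up_pred_succ {m : ℕ} (hm : 1 ≤ m) (a b : List ℤ) :
    (if Even (m - 1 + 1) then a else b) = if Odd m then b else a := by
  rw [Nat.sub_add_cancel hm]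
  rcases Nat.even_or_odd m with hm | hm
  · rw [if_pos hm, if_neg (Nat.not_odd_iff_even.2 hm)]
  · rw [if_neg (Nat.not_even_iff_odd.2 hm), if_pos hm]

theorem locMax_of_isStd_eq (hn : 3 ≤ n) {r : ℤ} (hr : 3 ≤ r) {v : Perm ℤ} (hv : v ∈ minReps n r)
    {x : Fin n → ℝ} (hx : act n v (fundWeight n r) = x) {t e : ℤ} {i : List ℤ}
    (h : IsStd n x t e i) : v ∈ maximalSet n r :=
  mem_maximalSet_of_locMax (by omega) (by omega) hv (hx ▸ h.locMax (by omega))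

/-! ### The families for `n + 1 - r` even -/

section Even

variable {r : ℤ} {m : ℕ}

theorem even_zero (hn : 3 ≤ n) (hr : 3 ≤ r) (hrn : r ≤ n) (hm : (n : ℤ) + 1 - r = 2 * m)
    {i : List ℤ} (hi : i ∈ J m 3 n) :
    ∃ v, IsUniqueOfWeight n r (rootSum n i) v ∧ v ∈ maximalSet n r ∧
      oneLine n v = [if Odd m then -1 else 1] ++ up (gaps 2 n i) ++ negRev (primed i) ++ i := by
  obtain ⟨hlen, hs⟩ := mem_J_iff.1 hi
  obtain ⟨v, h1, h2, h3⟩ := (isStd_zero hn hs).exists_unique_maximal hn hr hrn (by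
    rw [hlen, hm]; ring)
  refine ⟨v, h1, h2, ?_⟩
  rw [h3, stdZeros, if_pos rfl, if_neg (show ¬(0 : ℤ) = -1 by norm_num), add_zero, hlen, stdList, mid, if_pos rfl,
    sign_up_insert_one (two_le_of_mem_gaps (by norm_num) i)]
  simp

theorem even_one (hn : 3 ≤ n) (hr : 3 ≤ r) (hrn : r ≤ n) (hm : (n : ℤ) + 1 - r = 2 * m)
    {i : List ℤ} (hi : i ∈ J (m - 1) 4 n) :
    ∃ v, IsUniqueOfWeight n r (simpleRoot n 1 + rootSum n i) v ∧ v ∈ maximalSet n r ∧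
      oneLine n v = (if Odd m then up (gaps 3 n i) else upNeg (gaps 3 n i)) ++
        negRev (primed i) ++ [1, 2] ++ i := by
  obtain ⟨hlen, hs⟩ := mem_J_iff.1 hi
  obtain ⟨v, h1, h2, h3⟩ := (isStd_root_one hn hs).exists_unique_maximal hn hr hrn (by
    rw [hlen, hm]; omega)
  refine ⟨v, h1, h2, ?_⟩
  rw [h3, stdZeros, if_neg one_ne_zero, if_neg (show ¬(1 : ℤ) = -1 by norm_num), hlen, sign_up_pred (by omega),
    stdList]
  simp [mid]

theorem even_two (hn : 3 ≤ n) (hr : 3 ≤ r) (hrn : r ≤ n) (hm : (n : ℤ) + 1 - r = 2 * m)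
    {i : List ℤ} (hi : i ∈ J (m - 1) 4 n) :
    ∃ v, IsUniqueOfWeight n r (simpleRoot n 2 + rootSum n i) v ∧ v ∈ maximalSet n r ∧
      oneLine n v = (if Odd m then upNeg (gaps 3 n i) else up (gaps 3 n i)) ++
        negRev (primed i) ++ [-1, 2] ++ i := by
  obtain ⟨hlen, hs⟩ := mem_J_iff.1 hi
  obtain ⟨v, h1, h2, h3⟩ := (isStd_root_two hn hs).exists_unique_maximal hn hr hrn (by
    rw [hlen, hm]; omega)
  refine ⟨v, h1, h2, ?_⟩
  rw [h3, stdZeros, if_neg (show ¬(-1 : ℤ) = 0 by norm_num), if_pos rfl, hlen, sign_up_pred_succ (by omega), stdList]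
  simp [mid]

theorem rootSum_cons (x : ℤ) (i : List ℤ) : rootSum n (x :: i) = simpleRoot n x + rootSum n i := by
  simp [rootSum]

theorem even_all (hn : 3 ≤ n) (hr : 3 ≤ r) (hrn : r ≤ n) (hm : (n : ℤ) + 1 - r = 2 * m)
    {i : List ℤ} (hi : i ∈ J m 1 n \ Z m n) :
    ∃ v, IsUniqueOfWeight n r (rootSum n i) v ∧ v ∈ maximalSet n r := by
  obtain ⟨hJ, hZ⟩ := hi
  obtain ⟨hlen, hs⟩ := mem_J_iff.1 hJ
  cases i with
  | nil => simp at hlen; omega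
  | cons x i =>
    have hx := hs.1 x (by simp)
    have hlen' : i.length = m - 1 := by simp at hlen; omega
    rcases (show x = 1 ∨ x = 2 ∨ 3 ≤ x by omega) with rfl | rfl | hx3
    · have hs4 : Sparse 4 n i := by
        have h3 := hs.tail
        refine ⟨fun y hy => ⟨?_, (h3.1 y hy).2⟩, h3.2⟩
        cases i with
        | nil => simp at hy
        | cons z i =>
          have hz := (h3.1 z (by simp)).1
          -- `α_1` and `α_3` are adjacent in the Dynkin diagram despite the index gap 2; the
          -- sequences beginning with `1, 3` are exactly those of `Z`. Otherwise the tail starts at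
          -- 4 or later.
          have hz3 : z ≠ 3 := by
            rintro rfl
            exact hZ ⟨i, by simpa using hlen, mem_J_iff.2 ⟨rfl, h3.tail⟩, rfl⟩
          rcases List.mem_cons.1 hy with rfl | hy
          · omega
          · have := (h3.tail.1 y hy).1; omega
      obtain ⟨v, h1, h2, -⟩ := even_one hn hr hrn hm (mem_J_iff.2 ⟨hlen', hs4⟩)
      exact ⟨v, by rwa [rootSum_cons], h2⟩
    · obtain ⟨v, h1, h2, -⟩ := even_two hn hr hrn hm (mem_J_iff.2 ⟨hlen', hs.tail⟩)
      exact ⟨v, by rwa [rootSum_cons], h2⟩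
    · have hs3 : Sparse 3 n (x :: i) := by
        refine ⟨fun y hy => ⟨?_, (hs.1 y hy).2⟩, hs.2⟩
        rcases List.mem_cons.1 hy with rfl | hy
        · exact hx3
        · have := (hs.tail.1 y hy).1; omega
      obtain ⟨v, h1, h2, -⟩ := even_zero hn hr hrn hm (mem_J_iff.2 ⟨hlen, hs3⟩)
      exact ⟨v, h1, h2⟩

theorem even_iff (hn : 3 ≤ n) (hr : 3 ≤ r) (hrn : r ≤ n) (hm : (n : ℤ) + 1 - r = 2 * m)
    (v : Perm ℤ) : v ∈ maximalSet n r ↔ v ∈ minReps n r ∧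
      ((∃ i ∈ J m 3 n, act n v (fundWeight n r) = rootSum n i) ∨
      (∃ i ∈ J (m - 1) 4 n, act n v (fundWeight n r) = simpleRoot n 1 + rootSum n i) ∨
      (∃ i ∈ J (m - 1) 4 n, act n v (fundWeight n r) = simpleRoot n 2 + rootSum n i)) := by
  constructor
  · intro hv
    refine ⟨hv.1, ?_⟩
    obtain ⟨t, e, i, h, hd⟩ := exists_isStd_of_mem_maximalSet hn hr hrn hv
    rw [hm] at hd
    rcases h.valid with ⟨rfl, rfl⟩ | ⟨rfl, rfl | rfl | rfl⟩ | ⟨rfl, rfl | rfl⟩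
    · exact Or.inl ⟨i, mem_J_iff.2 ⟨by omega, h.sparse⟩, h.ext (isStd_zero hn h.sparse)⟩
    · exact Or.inr (Or.inr ⟨i, mem_J_iff.2 ⟨by omega, h.sparse⟩,
        h.ext (isStd_root_two hn h.sparse)⟩)
    · omega
    · exact Or.inr (Or.inl ⟨i, mem_J_iff.2 ⟨by omega, h.sparse⟩,
        h.ext (isStd_root_one hn h.sparse)⟩)
    · omega
    · omega
  · rintro ⟨hv, ⟨i, hi, e⟩ | ⟨i, hi, e⟩ | ⟨i, hi, e⟩⟩
    · exact locMax_of_isStd_eq hn hr hv e (isStd_zero hn (mem_J_iff.1 hi).2)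
    · exact locMax_of_isStd_eq hn hr hv e (isStd_root_one hn (mem_J_iff.1 hi).2)
    · exact locMax_of_isStd_eq hn hr hv e (isStd_root_two hn (mem_J_iff.1 hi).2)

end Even

/-! ### The families for `n + 1 - r` odd -/

section Odd

variable {r : ℤ} {m : ℕ}

theorem odd_zero (hn : 3 ≤ n) (hr : 3 ≤ r) (hrn : r ≤ n) (hm : (n : ℤ) + 1 - r = 2 * m + 1)
    {i : List ℤ} (hi : i ∈ J m 4 n) :
    ∃ v, IsUniqueOfWeight n r ((1 / 2 : ℝ) • simpleRoot n 1 + (1 / 2 : ℝ) • simpleRoot n 2 +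
        rootSum n i) v ∧ v ∈ maximalSet n r ∧
      oneLine n v = [if Odd m then -1 else 1] ++ up (gaps 3 n i) ++ negRev (primed i) ++ [2] ++ i := by
  obtain ⟨hlen, hs⟩ := mem_J_iff.1 hi
  obtain ⟨v, h1, h2, h3⟩ := (isStd_half hn hs).exists_unique_maximal hn hr hrn (by
    rw [hlen, hm]; ring)
  refine ⟨v, h1, h2, ?_⟩
  rw [h3, stdZeros, if_pos rfl, if_neg (show ¬(0 : ℤ) = -1 by norm_num), add_zero, hlen, stdList,
    sign_up_insert_one (two_le_of_mem_gaps (by norm_num) i)]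
  simp [mid]

theorem odd_one (hn : 3 ≤ n) (hr : 3 ≤ r) (hrn : r ≤ n) (hm : (n : ℤ) + 1 - r = 2 * m + 1)
    (hm1 : 1 ≤ m) {i : List ℤ} (hi : i ∈ J (m - 1) 5 n) :
    ∃ v, IsUniqueOfWeight n r ((3 / 2 : ℝ) • simpleRoot n 1 + (1 / 2 : ℝ) • simpleRoot n 2 +
        simpleRoot n 3 + rootSum n i) v ∧ v ∈ maximalSet n r ∧
      oneLine n v = (if Odd m then up (gaps 4 n i) else upNeg (gaps 4 n i)) ++
        negRev (primed i) ++ [1, 2, 3] ++ i := by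
  obtain ⟨hlen, hs⟩ := mem_J_iff.1 hi
  obtain ⟨v, h1, h2, h3⟩ := (isStd_three_one hn hs).exists_unique_maximal hn hr hrn (by
    rw [hlen, hm]; omega)
  refine ⟨v, h1, h2, ?_⟩
  rw [h3, stdZeros, if_neg one_ne_zero, if_neg (show ¬(1 : ℤ) = -1 by norm_num), hlen, sign_up_pred hm1, stdList]
  simp [mid]

theorem odd_two (hn : 3 ≤ n) (hr : 3 ≤ r) (hrn : r ≤ n) (hm : (n : ℤ) + 1 - r = 2 * m + 1)
    (hm1 : 1 ≤ m) {i : List ℤ} (hi : i ∈ J (m - 1) 5 n) :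
    ∃ v, IsUniqueOfWeight n r ((1 / 2 : ℝ) • simpleRoot n 1 + (3 / 2 : ℝ) • simpleRoot n 2 +
        simpleRoot n 3 + rootSum n i) v ∧ v ∈ maximalSet n r ∧
      oneLine n v = (if Odd m then upNeg (gaps 4 n i) else up (gaps 4 n i)) ++
        negRev (primed i) ++ [-1, 2, 3] ++ i := by
  obtain ⟨hlen, hs⟩ := mem_J_iff.1 hi
  obtain ⟨v, h1, h2, h3⟩ := (isStd_one_three hn hs).exists_unique_maximal hn hr hrn (by
    rw [hlen, hm]; omega)
  refine ⟨v, h1, h2, ?_⟩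
  rw [h3, stdZeros, if_neg (show ¬(-1 : ℤ) = 0 by norm_num), if_pos rfl, hlen, sign_up_pred_succ hm1, stdList]
  simp [mid]

theorem odd_iff (hn : 3 ≤ n) (hr : 3 ≤ r) (hrn : r ≤ n) (hm : (n : ℤ) + 1 - r = 2 * m + 1)
    (v : Perm ℤ) : v ∈ maximalSet n r ↔ v ∈ minReps n r ∧
      ((∃ i ∈ J m 4 n, act n v (fundWeight n r) =
        (1 / 2 : ℝ) • simpleRoot n 1 + (1 / 2 : ℝ) • simpleRoot n 2 + rootSum n i) ∨
      (∃ i ∈ J (m - 1) 5 n, act n v (fundWeight n r) =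
        (3 / 2 : ℝ) • simpleRoot n 1 + (1 / 2 : ℝ) • simpleRoot n 2 + simpleRoot n 3 +
          rootSum n i) ∨
      (∃ i ∈ J (m - 1) 5 n, act n v (fundWeight n r) =
        (1 / 2 : ℝ) • simpleRoot n 1 + (3 / 2 : ℝ) • simpleRoot n 2 + simpleRoot n 3 +
          rootSum n i)) := by
  constructor
  · intro hv
    refine ⟨hv.1, ?_⟩
    obtain ⟨t, e, i, h, hd⟩ := exists_isStd_of_mem_maximalSet hn hr hrn hv
    rw [hm] at hd
    rcases h.valid with ⟨rfl, rfl⟩ | ⟨rfl, rfl | rfl | rfl⟩ | ⟨rfl, rfl | rfl⟩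
    · omega
    · omega
    · exact Or.inl ⟨i, mem_J_iff.2 ⟨by omega, h.sparse⟩, h.ext (isStd_half hn h.sparse)⟩
    · omega
    · exact Or.inr (Or.inr ⟨i, mem_J_iff.2 ⟨by omega, h.sparse⟩,
        h.ext (isStd_one_three hn h.sparse)⟩)
    · exact Or.inr (Or.inl ⟨i, mem_J_iff.2 ⟨by omega, h.sparse⟩,
        h.ext (isStd_three_one hn h.sparse)⟩)
  · rintro ⟨hv, ⟨i, hi, e⟩ | ⟨i, hi, e⟩ | ⟨i, hi, e⟩⟩
    · exact locMax_of_isStd_eq hn hr hv e (isStd_half hn (mem_J_iff.1 hi).2)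
    · exact locMax_of_isStd_eq hn hr hv e (isStd_three_one hn (mem_J_iff.1 hi).2)
    · exact locMax_of_isStd_eq hn hr hv e (isStd_one_three hn (mem_J_iff.1 hi).2)

end Odd

/-! ### The case `r = n` -/

theorem last_case (hn : 4 ≤ n) : ∃ v, maximalSet n n = {v} ∧
      oneLine n v = [1] ++ up (Finset.Icc 3 (n : ℤ)) ++ [2] ∧
      act n v (fundWeight n n) =
        (1 / 2 : ℝ) • simpleRoot n 1 + (1 / 2 : ℝ) • simpleRoot n 2 := by
  have hnil : ([] : List ℤ) ∈ J 0 4 n := mem_J_iff.2 ⟨rfl, by simp, List.Pairwise.nil⟩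
  obtain ⟨v, ⟨h1, h2, h3⟩, h4, h5⟩ := odd_zero (n := n) (r := n) (m := 0) (by omega) (by omega)
    le_rfl (by push_cast; ring) hnil
  have hg : gaps 3 n [] = Finset.Icc 3 (n : ℤ) := by
    ext k; rw [mem_gaps, Finset.mem_Icc]; simp
  refine ⟨v, Set.eq_singleton_iff_unique_mem.2 ⟨h4, fun u hu => h3 u hu.1 ?_⟩, ?_, ?_⟩
  · obtain ⟨t, e, i, h, hd⟩ := exists_isStd_of_mem_maximalSet (by omega) (by omega) le_rfl hu
    -- Squared norm 1 leaves only the vector `e_2`.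
    have hi : t = 2 ∧ e = 0 ∧ i.length = 0 := by
      rcases h.valid with ⟨rfl, rfl⟩ | ⟨rfl, rfl | rfl | rfl⟩ | ⟨rfl, rfl | rfl⟩ <;> omega
    obtain ⟨rfl, rfl, hi⟩ := hi
    rw [List.length_eq_zero_iff] at hi
    subst hi
    exact h.ext (isStd_half (by omega) h.sparse)
  · rw [h5, hg]; simp [negRev, primed]
  · rw [h2]; simp [rootSum]

/-! ### The spin cases `r = 1` and `r = 2` -/

section Spin

variable {r : ℤ}

theorem spin_even {q : ℕ} (hn : 4 ≤ n) (hq : n = 2 + 2 * q) (hr : r = 1 ∨ r = 2) {e : ℤ}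
    (he : e = -1 ∨ e = 1) (hpar : r = 1 ↔ Even (q + if e = -1 then 1 else 0)) :
    ∃ v, maximalSet n r = {v} ∧
      oneLine n v = flipHead r (steps (-((n : ℤ) - 1)) q ++ [e] ++ steps 2 (q + 1)) ∧
      act n v ((4 : ℝ) • fundWeight n r) = (2 : ℝ) • simpleRoot n (if e = 1 then 1 else 2) +
        (2 : ℝ) • ∑ i ∈ Finset.Icc 2 (q + 1), simpleRoot n (2 * (i : ℤ)) := by
  have hs : Sparse 4 n (steps 4 q) := sparse_steps (by omega)
  have hstd : IsStd n (simpleRoot n (if e = 1 then 1 else 2) + rootSum n (steps 4 q)) 2 e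
      (steps 4 q) := by
    rcases he with rfl | rfl
    · exact isStd_root_two (by omega) hs
    · exact isStd_root_one (by omega) hs
  obtain ⟨v, h1, h2, h3⟩ := hstd.maximalSet_spin (by omega) hr (q := q) (by omega) he hpar
  refine ⟨v, h1, ?_, ?_⟩
  · rw [h3, stdList, mid, if_neg (by norm_num), if_pos rfl, if_neg (by omega),
      show (2 : ℤ) + 2 = 4 by norm_num, negRev_primed_steps, steps_succ 2 q,
      show -((4 : ℤ) + 2 * q - 3) = -((n : ℤ) - 1) by omega]
    simp
  · rw [show (4 : ℝ) • fundWeight n r = (2 : ℝ) • ((2 : ℝ) • fundWeight n r) by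
      rw [smul_smul]; norm_num, act_smul, h2, rootSum_steps_even, smul_add]

theorem spin_odd {q : ℕ} (hn : 4 ≤ n) (hq : n = 3 + 2 * q) (hr : r = 1 ∨ r = 2) {e : ℤ}
    (he : e = -1 ∨ e = 1) (hpar : r = 1 ↔ Even (q + if e = -1 then 1 else 0)) :
    ∃ v, maximalSet n r = {v} ∧
      oneLine n v = flipHead r (steps (-((n : ℤ) - 1)) q ++ [e, 2] ++ steps 3 (q + 1)) ∧
      act n v ((4 : ℝ) • fundWeight n r) = (2 + e : ℝ) • simpleRoot n 1 +
        (2 - e : ℝ) • simpleRoot n 2 + (2 : ℝ) • simpleRoot n 3 +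
        (2 : ℝ) • ∑ i ∈ Finset.Icc 2 (q + 1), simpleRoot n (2 * (i : ℤ) + 1) := by
  -- The coefficients `1 ± e / 2` treat both signs at once: they are `3/2, 1/2` for `e = 1` and
  -- `1/2, 3/2` for `e = -1`.
  have hs : Sparse 5 n (steps 5 q) := sparse_steps (by omega)
  have hstd : IsStd n ((1 + e / 2 : ℝ) • simpleRoot n 1 + (1 - e / 2 : ℝ) • simpleRoot n 2 +
      simpleRoot n 3 + rootSum n (steps 5 q)) 3 e (steps 5 q) := by
    rcases he with rfl | rfl
    · have := isStd_one_three (by omega) hs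
      norm_num at this ⊢; exact this
    · have := isStd_three_one (by omega) hs
      norm_num at this ⊢; exact this
  obtain ⟨v, h1, h2, h3⟩ := hstd.maximalSet_spin (by omega) hr (q := q) (by omega) he hpar
  refine ⟨v, h1, ?_, ?_⟩
  · rw [h3, stdList, mid, if_neg (by norm_num), if_neg (by norm_num),
      show (3 : ℤ) + 2 = 5 by norm_num, negRev_primed_steps, steps_succ 3 q,
      show -((5 : ℤ) + 2 * q - 3) = -((n : ℤ) - 1) by omega]
    simp
  · rw [show (4 : ℝ) • fundWeight n r = (2 : ℝ) • ((2 : ℝ) • fundWeight n r) by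
      rw [smul_smul]; norm_num, act_smul, h2, rootSum_steps_odd]
    module

theorem flipHead_one (l : List ℤ) : flipHead 1 l = l := by simp [flipHead]

theorem flipHead_two_steps (a : ℤ) {q : ℕ} (hq : 1 ≤ q) (l : List ℤ) :
    flipHead 2 (steps (-(a - 1)) q ++ l) = [a - 1] ++ steps (-(a - 3)) (q - 1) ++ l := by
  obtain ⟨k, rfl⟩ := Nat.exists_eq_add_of_le' hq
  rw [steps_succ, Nat.add_sub_cancel, show -(a - 1) + 2 = -(a - 3) by ring]
  simp [flipHead]

end Spin

end TypeD

theorem proposition5p1 (n : ℕ) (hn : 4 ≤ n) :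
    -- the case `r = 1`
    ((n % 4 = 0 → ∃ v, maximalSet n 1 = {v} ∧
        oneLine n v = steps (-((n : ℤ) - 1)) (n / 2 - 1) ++ [-1] ++ steps 2 (n / 2) ∧
        act n v ((4 : ℝ) • fundWeight n 1) = (2 : ℝ) • simpleRoot n 2 +
          (2 : ℝ) • ∑ i ∈ Finset.Icc 2 (n / 2), simpleRoot n (2 * (i : ℤ))) ∧
      (n % 4 = 2 → ∃ v, maximalSet n 1 = {v} ∧
        oneLine n v = steps (-((n : ℤ) - 1)) (n / 2 - 1) ++ [1] ++ steps 2 (n / 2) ∧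
        act n v ((4 : ℝ) • fundWeight n 1) = (2 : ℝ) • simpleRoot n 1 +
          (2 : ℝ) • ∑ i ∈ Finset.Icc 2 (n / 2), simpleRoot n (2 * (i : ℤ))) ∧
      (n % 4 = 1 → ∃ v, maximalSet n 1 = {v} ∧
        oneLine n v = steps (-((n : ℤ) - 1)) ((n - 1) / 2 - 1) ++ [-1, 2] ++
          steps 3 ((n - 1) / 2) ∧
        act n v ((4 : ℝ) • fundWeight n 1) = simpleRoot n 1 + (3 : ℝ) • simpleRoot n 2 + (2 : ℝ) • simpleRoot n 3 +
          (2 : ℝ) • ∑ i ∈ Finset.Icc 2 ((n - 1) / 2), simpleRoot n (2 * (i : ℤ) + 1)) ∧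
      (n % 4 = 3 → ∃ v, maximalSet n 1 = {v} ∧
        oneLine n v = steps (-((n : ℤ) - 1)) ((n - 1) / 2 - 1) ++ [1, 2] ++
          steps 3 ((n - 1) / 2) ∧
        act n v ((4 : ℝ) • fundWeight n 1) = (3 : ℝ) • simpleRoot n 1 + simpleRoot n 2 + (2 : ℝ) • simpleRoot n 3 +
          (2 : ℝ) • ∑ i ∈ Finset.Icc 2 ((n - 1) / 2), simpleRoot n (2 * (i : ℤ) + 1))) ∧
    -- the case `r = 2`
    ((n % 4 = 0 → ∃ v, maximalSet n 2 = {v} ∧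
        oneLine n v = [(n : ℤ) - 1] ++ steps (-((n : ℤ) - 3)) (n / 2 - 2) ++ [1] ++ steps 2 (n / 2) ∧
        act n v ((4 : ℝ) • fundWeight n 2) = (2 : ℝ) • simpleRoot n 1 +
          (2 : ℝ) • ∑ i ∈ Finset.Icc 2 (n / 2), simpleRoot n (2 * (i : ℤ))) ∧
      (n % 4 = 2 → ∃ v, maximalSet n 2 = {v} ∧
        oneLine n v = [(n : ℤ) - 1] ++ steps (-((n : ℤ) - 3)) (n / 2 - 2) ++ [-1] ++ steps 2 (n / 2) ∧
        act n v ((4 : ℝ) • fundWeight n 2) = (2 : ℝ) • simpleRoot n 2 +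
          (2 : ℝ) • ∑ i ∈ Finset.Icc 2 (n / 2), simpleRoot n (2 * (i : ℤ))) ∧
      (n % 4 = 1 → ∃ v, maximalSet n 2 = {v} ∧
        oneLine n v = [(n : ℤ) - 1] ++ steps (-((n : ℤ) - 3)) ((n - 1) / 2 - 2) ++ [1, 2] ++
          steps 3 ((n - 1) / 2) ∧
        act n v ((4 : ℝ) • fundWeight n 2) = (3 : ℝ) • simpleRoot n 1 + simpleRoot n 2 + (2 : ℝ) • simpleRoot n 3 +
          (2 : ℝ) • ∑ i ∈ Finset.Icc 2 ((n - 1) / 2), simpleRoot n (2 * (i : ℤ) + 1)) ∧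
      (n % 4 = 3 → ∃ v, maximalSet n 2 = {v} ∧
        oneLine n v = [(n : ℤ) - 1] ++ steps (-((n : ℤ) - 3)) ((n - 1) / 2 - 2) ++ [-1, 2] ++
          steps 3 ((n - 1) / 2) ∧
        act n v ((4 : ℝ) • fundWeight n 2) = simpleRoot n 1 + (3 : ℝ) • simpleRoot n 2 + (2 : ℝ) • simpleRoot n 3 +
          (2 : ℝ) • ∑ i ∈ Finset.Icc 2 ((n - 1) / 2), simpleRoot n (2 * (i : ℤ) + 1))) ∧
    -- the case `3 ≤ r ≤ n - 1` with `n + 1 - r = 2 m`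
    (∀ (r : ℤ) (m : ℕ), 3 ≤ r → r ≤ (n : ℤ) - 1 → (n : ℤ) + 1 - r = 2 * (m : ℤ) →
      (∀ i ∈ J m 1 n \ Z m n, ∃ v, IsUniqueOfWeight n r (rootSum n i) v ∧ v ∈ maximalSet n r) ∧
      (∀ i ∈ J m 3 n, ∃ v, IsUniqueOfWeight n r (rootSum n i) v ∧ v ∈ maximalSet n r ∧
        oneLine n v = [if Odd m then -1 else 1] ++ up (gaps 2 n i) ++
          negRev (primed i) ++ i) ∧
      (∀ i ∈ J (m - 1) 4 n, ∃ v, IsUniqueOfWeight n r (simpleRoot n 1 + rootSum n i) v ∧ v ∈ maximalSet n r ∧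
        oneLine n v = (if Odd m then up (gaps 3 n i) else upNeg (gaps 3 n i)) ++
          negRev (primed i) ++ [1, 2] ++ i) ∧
      (∀ i ∈ J (m - 1) 4 n, ∃ v, IsUniqueOfWeight n r (simpleRoot n 2 + rootSum n i) v ∧ v ∈ maximalSet n r ∧
        oneLine n v = (if Odd m then upNeg (gaps 3 n i) else up (gaps 3 n i)) ++
          negRev (primed i) ++ [-1, 2] ++ i) ∧
      (∀ v, v ∈ maximalSet n r ↔ v ∈ minReps n r ∧ (
        (∃ i ∈ J m 3 n, act n v (fundWeight n r) =
          rootSum n i) ∨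
        (∃ i ∈ J (m - 1) 4 n, act n v (fundWeight n r) =
          simpleRoot n 1 + rootSum n i) ∨
        (∃ i ∈ J (m - 1) 4 n, act n v (fundWeight n r) =
          simpleRoot n 2 + rootSum n i)))) ∧
    -- the case `3 ≤ r ≤ n - 1` with `n + 1 - r = 2 m + 1`
    (∀ (r : ℤ) (m : ℕ), 3 ≤ r → r ≤ (n : ℤ) - 1 → (n : ℤ) + 1 - r = 2 * (m : ℤ) + 1 →
      (∀ i ∈ J m 4 n, ∃ v, IsUniqueOfWeight n r ((1 / 2 : ℝ) • simpleRoot n 1 + (1 / 2 : ℝ) • simpleRoot n 2 + rootSum n i) v ∧ v ∈ maximalSet n r ∧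
        oneLine n v = [if Odd m then -1 else 1] ++ up (gaps 3 n i) ++
          negRev (primed i) ++ [2] ++ i) ∧
      (∀ i ∈ J (m - 1) 5 n, ∃ v, IsUniqueOfWeight n r ((3 / 2 : ℝ) • simpleRoot n 1 + (1 / 2 : ℝ) • simpleRoot n 2 +
          simpleRoot n 3 + rootSum n i) v ∧ v ∈ maximalSet n r ∧
        oneLine n v = (if Odd m then up (gaps 4 n i) else upNeg (gaps 4 n i)) ++
          negRev (primed i) ++ [1, 2, 3] ++ i) ∧
      (∀ i ∈ J (m - 1) 5 n, ∃ v, IsUniqueOfWeight n r ((1 / 2 : ℝ) • simpleRoot n 1 + (3 / 2 : ℝ) • simpleRoot n 2 +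
          simpleRoot n 3 + rootSum n i) v ∧ v ∈ maximalSet n r ∧
        oneLine n v = (if Odd m then upNeg (gaps 4 n i) else up (gaps 4 n i)) ++
          negRev (primed i) ++ [-1, 2, 3] ++ i) ∧
      (∀ v, v ∈ maximalSet n r ↔ v ∈ minReps n r ∧ (
        (∃ i ∈ J m 4 n, act n v (fundWeight n r) =
          (1 / 2 : ℝ) • simpleRoot n 1 + (1 / 2 : ℝ) • simpleRoot n 2 + rootSum n i) ∨
        (∃ i ∈ J (m - 1) 5 n, act n v (fundWeight n r) =
          (3 / 2 : ℝ) • simpleRoot n 1 + (1 / 2 : ℝ) • simpleRoot n 2 +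
          simpleRoot n 3 + rootSum n i) ∨
        (∃ i ∈ J (m - 1) 5 n, act n v (fundWeight n r) =
          (1 / 2 : ℝ) • simpleRoot n 1 + (3 / 2 : ℝ) • simpleRoot n 2 +
          simpleRoot n 3 + rootSum n i)))) ∧
    -- the case `r = n`
    (∃ v, maximalSet n n = {v} ∧
      oneLine n v = [1] ++ up (Finset.Icc 3 (n : ℤ)) ++ [2] ∧
      act n v (fundWeight n n) =
        (1 / 2 : ℝ) • simpleRoot n 1 + (1 / 2 : ℝ) • simpleRoot n 2) := by
  have hn3 : 3 ≤ n := by omega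
  refine ⟨⟨?_, ?_, ?_, ?_⟩, ⟨?_, ?_, ?_, ?_⟩, ?_, ?_, last_case hn⟩
  · intro hmod
    -- Here `q` counts the pairs following the run: `n = 2 + 2q` for even `n` and `n = 3 + 2q` for
    -- odd `n`. So the residue of `n` modulo 4 gives the parity of `q`, and `r` then determines `e`.
    obtain ⟨q, hq, hodd⟩ : ∃ q, n = 2 + 2 * q ∧ Odd q :=
      ⟨n / 2 - 1, by omega, by rw [Nat.odd_iff]; omega⟩
    obtain ⟨v, h1, h2, h3⟩ := spin_even (r := 1) (e := -1) hn hq (Or.inl rfl) (Or.inl rfl)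
      (by simpa using hodd.add_one)
    refine ⟨v, h1, ?_, ?_⟩
    · rw [h2, flipHead_one, show n / 2 = q + 1 by omega, Nat.add_sub_cancel]
    · rw [h3, show n / 2 = q + 1 by omega, if_neg (by norm_num)]
  · intro hmod
    obtain ⟨q, hq, hev⟩ : ∃ q, n = 2 + 2 * q ∧ Even q :=
      ⟨n / 2 - 1, by omega, by rw [Nat.even_iff]; omega⟩
    obtain ⟨v, h1, h2, h3⟩ := spin_even (r := 1) (e := 1) hn hq (Or.inl rfl) (Or.inr rfl)
      (by simpa using hev)
    refine ⟨v, h1, ?_, ?_⟩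
    · rw [h2, flipHead_one, show n / 2 = q + 1 by omega, Nat.add_sub_cancel]
    · rw [h3, show n / 2 = q + 1 by omega, if_pos rfl]
  · intro hmod
    obtain ⟨q, hq, hodd⟩ : ∃ q, n = 3 + 2 * q ∧ Odd q :=
      ⟨(n - 1) / 2 - 1, by omega, by rw [Nat.odd_iff]; omega⟩
    obtain ⟨v, h1, h2, h3⟩ := spin_odd (r := 1) (e := -1) hn hq (Or.inl rfl) (Or.inl rfl)
      (by simpa using hodd.add_one)
    refine ⟨v, h1, ?_, ?_⟩
    · rw [h2, flipHead_one, show (n - 1) / 2 = q + 1 by omega, Nat.add_sub_cancel]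
    · rw [h3, show (n - 1) / 2 = q + 1 by omega]
      norm_num
  · intro hmod
    obtain ⟨q, hq, hev⟩ : ∃ q, n = 3 + 2 * q ∧ Even q :=
      ⟨(n - 1) / 2 - 1, by omega, by rw [Nat.even_iff]; omega⟩
    obtain ⟨v, h1, h2, h3⟩ := spin_odd (r := 1) (e := 1) hn hq (Or.inl rfl) (Or.inr rfl)
      (by simpa using hev)
    refine ⟨v, h1, ?_, ?_⟩
    · rw [h2, flipHead_one, show (n - 1) / 2 = q + 1 by omega, Nat.add_sub_cancel]
    · rw [h3, show (n - 1) / 2 = q + 1 by omega]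
      norm_num
  · intro hmod
    obtain ⟨q, hq, hodd⟩ : ∃ q, n = 2 + 2 * q ∧ Odd q :=
      ⟨n / 2 - 1, by omega, by rw [Nat.odd_iff]; omega⟩
    obtain ⟨v, h1, h2, h3⟩ := spin_even (r := 2) (e := 1) hn hq (Or.inr rfl) (Or.inr rfl)
      (by simpa using hodd)
    refine ⟨v, h1, ?_, ?_⟩
    · rw [h2, List.append_assoc, flipHead_two_steps _ (by omega), show n / 2 = q + 1 by omega,
        ← List.append_assoc]
      rfl
    · rw [h3, show n / 2 = q + 1 by omega, if_pos rfl]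
  · intro hmod
    obtain ⟨q, hq, hev⟩ : ∃ q, n = 2 + 2 * q ∧ Even q :=
      ⟨n / 2 - 1, by omega, by rw [Nat.even_iff]; omega⟩
    obtain ⟨v, h1, h2, h3⟩ := spin_even (r := 2) (e := -1) hn hq (Or.inr rfl) (Or.inl rfl)
      (by simpa using hev.add_one)
    refine ⟨v, h1, ?_, ?_⟩
    · rw [h2, List.append_assoc, flipHead_two_steps _ (by omega), show n / 2 = q + 1 by omega,
        ← List.append_assoc]
      rfl
    · rw [h3, show n / 2 = q + 1 by omega, if_neg (by norm_num)]
  · intro hmod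
    obtain ⟨q, hq, hodd⟩ : ∃ q, n = 3 + 2 * q ∧ Odd q :=
      ⟨(n - 1) / 2 - 1, by omega, by rw [Nat.odd_iff]; omega⟩
    obtain ⟨v, h1, h2, h3⟩ := spin_odd (r := 2) (e := 1) hn hq (Or.inr rfl) (Or.inr rfl)
      (by simpa using hodd)
    refine ⟨v, h1, ?_, ?_⟩
    · rw [h2, List.append_assoc, flipHead_two_steps _ (by omega),
        show (n - 1) / 2 = q + 1 by omega, ← List.append_assoc]
      rfl
    · rw [h3, show (n - 1) / 2 = q + 1 by omega]
      norm_num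
  · intro hmod
    obtain ⟨q, hq, hev⟩ : ∃ q, n = 3 + 2 * q ∧ Even q :=
      ⟨(n - 1) / 2 - 1, by omega, by rw [Nat.even_iff]; omega⟩
    obtain ⟨v, h1, h2, h3⟩ := spin_odd (r := 2) (e := -1) hn hq (Or.inr rfl) (Or.inl rfl)
      (by simpa using hev.add_one)
    refine ⟨v, h1, ?_, ?_⟩
    · rw [h2, List.append_assoc, flipHead_two_steps _ (by omega),
        show (n - 1) / 2 = q + 1 by omega, ← List.append_assoc]
      rfl
    · rw [h3, show (n - 1) / 2 = q + 1 by omega]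
      norm_num
  · intro r m hr hrn hm
    have hrn' : r ≤ n := by omega
    exact ⟨fun i hi => even_all hn3 hr hrn' hm hi, fun i hi => even_zero hn3 hr hrn' hm hi,
      fun i hi => even_one hn3 hr hrn' hm hi, fun i hi => even_two hn3 hr hrn' hm hi,
      even_iff hn3 hr hrn' hm⟩
  · intro r m hr hrn hm
    have hrn' : r ≤ n := by omega
    -- This uses `r ≤ n - 1`: the families of length `m - 1` require `m ≥ 1`, while `m = 0` is the
    -- case `r = n`.
    have hm1 : 1 ≤ m := by omega
    exact ⟨fun i hi => odd_zero hn3 hr hrn' hm hi, fun i hi => odd_one hn3 hr hrn' hm hm1 hi,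
      fun i hi => odd_two hn3 hr hrn' hm hm1 hi, odd_iff hn3 hr hrn' hm⟩
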